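/- **Setting.** A piecewise deterministic Markov process (PDMP) in $\mathbb R^d$ is given by a vector field $\Gamma$ with measurable flow $\psi$ ($\partial_t\psi(t,z)=\Gamma(\psi(t,z))$, $\psi(0,z)=z$, $\psi(s+t,z)=\psi(t,\psi(s,z))$, $s,t\ge 0$), a measurable jump rate $\lambda\ge 0$ with $\int_0^t\lambda(\psi(s,z))\,ds<\infty$ for all $z$ and $t\ge0$, and a Markov kernel $Q$ on $\mathbb R^d$. A process $Z(t)_{t\ge0}$ is such a PDMP if there is a Markov chain $(\xi_n,\theta_n)_{n\ge0}$ (the skeleton chain) such that, given the past, $\mathbb P(\theta_n>r)=\exp\bigl(-\int_0^r\lambda(\psi(s,\xi_n))\,ds\bigr)$ (the value $\theta_n=\infty$ is allowed, and then there are no further jumps) and $\xi_{n+1}\sim Q(\psi(\theta_n,\xi_n),\cdot)$ if $\theta_n<\infty$; almost surely $\theta_0+\dots+\theta_{n-1}\to\infty$; and almost surely $Z(\theta_0+\dots+\theta_{n-1}+s)=\psi(s,\xi_n)$ for all $n$ and all $0\le s<\theta_n$. Let $W\subseteq\mathbb R^d$ be open, let $Z$ be a PDMP with $\mathcal L(Z(0))=\mu$,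 and let $\tau=\inf\{t\ge0:Z(t)\notin W\}$. Assume that $\tau<\infty$ almost surely and that $\mu$ is a quasistationary distribution (QSD) of $Z$ in $W$, i.e. $\mu(W)=1$ and $\mu(A)=\mathbb P(Z(t)\in A\mid \tau>t)$ for all $t\ge 0$ and all measurable $A\subseteq W$. Let $f:\mathbb R^d\to\mathbb R$ be bounded and measurable, let $\Delta t>0$ and $R\ge1$. Let $Z^1,\dots,Z^R$ be independent PDMPs with the same characteristics $(\Gamma,\psi,\lambda,Q)$ and with $\mathcal L(Z^r(0))=\mu$, and put $\tau^r=\inf\{t\ge0:Z^r(t)\notin W\}$. **(i) Synchronous parallel step.** Let $N=\inf\{n\ge1:\exists r,\ \tau^r\le n\Delta t\}$, $J=\min\{r:\tau^r\le N\Delta t\}$, $$f_{par}=\sum_{n=1}^{N-1}\sum_{r=1}^R\int_{(n-1)\Delta t}^{n\Delta t}f(Z^r(t))\,dt+\sum_{r=1}^{J-1}\int_{(N-1)\Delta t}^{N\Delta t}f(Z^r(t))\,dt+\int_{(N-1)\Delta t}^{\tau^J}f(Z^J(t))\,dt,$$ let $T_{par}$ be given by the same formula with $1$ in place of $f$, and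 let $Z_{par}=Z^J(\tau^J)$. Then $f_{par}$ and $\int_0^\tau f(Z(t))\,dt$ are integrable, $$\mathbb E(f_{par})=\mathbb E\left(\int_0^\tau f(Z(t))\,dt\right)\qquad\text{and}\qquad (T_{par},Z_{par})\stackrel{\mathcal L}{=}(\tau,Z(\tau)).$$ **(ii) Asynchronous parallel step.** Let $(t^r_{wall}(m)_{m\ge0})^{1\le r\le R}$ be nonnegative random numbers which are independent of $(Z^r(t)_{t\ge0})^{1\le r\le R}$, such that almost surely $t^r_{wall}(m)\le t^r_{wall}(n)$ whenever $m\le n$ and $1\le r\le R$, and such that almost surely there is a unique sequence $(r_k,m_k)_{k\ge1}$ with range $\{1,\dots,R\}\times\{0,1,2,\dots\}$ for which $t^{r_1}_{wall}(m_1)<t^{r_2}_{wall}(m_2)<\cdots$. Let $K=\inf\{k\ge 1:\tau^{r_k}\le(m_k+1)\Delta t\}$, $$f_{par}=\sum_{k=1}^{K-1}\int_{m_k\Delta t}^{(m_k+1)\Delta t}f(Z^{r_k}(t))\,dt+\int_{m_K\Delta t}^{\tau^{r_K}}f(Z^{r_K}(t))\,dt,$$ let $T_{par}$ be given by the same formula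 with $1$ in place of $f$, and let $Z_{par}=Z^{r_K}(\tau^{r_K})$. Then the three conclusions of (i) hold for these $f_{par}$, $T_{par}$, $Z_{par}$. -/

import Mathlib

open MeasureTheory ProbabilityTheory Filter Topology
open scoped NNReal ENNReal

noncomputable section

/-- The ambient state space `ℝ^d`. -/
abbrev State (d : ℕ) : Type := EuclideanSpace ℝ (Fin d)

/-- The local characteristics of a piecewise deterministic Markov process in `ℝ^d`: a vector field
`Γ` together with its flow `ψ(t, z)`, a jump rate `lam`, and a Markov kernel `Q` giving the
distribution of the position after a jump. -/
structure PDMP (d : ℕ) where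
  Γ : State d → State d
  ψ : ℝ≥0 → State d → State d
  lam : State d → ℝ≥0
  Q : Kernel (State d) (State d)
  markov_Q : IsMarkovKernel Q
  ψ_zero : ∀ z, ψ 0 z = z
  ψ_add : ∀ s t z, ψ (s + t) z = ψ t (ψ s z)
  ψ_deriv : ∀ z (t : ℝ≥0),
    HasDerivWithinAt (fun s : ℝ => ψ s.toNNReal z) (Γ (ψ t z)) (Set.Ici 0) (t : ℝ)
  measurable_ψ : Measurable (Function.uncurry ψ)
  measurable_lam : Measurable lam
  integrable_lam : ∀ z (t : ℝ≥0),
    IntegrableOn (fun s : ℝ => (lam (ψ s.toNNReal z) : ℝ)) (Set.Icc 0 (t : ℝ))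

namespace PDMP

variable {d : ℕ} (D : PDMP d)

instance : IsMarkovKernel D.Q := D.markov_Q

/-- The accumulated jump rate `∫₀ʳ lam (ψ(s, z)) ds` along the flow line started at `z`. -/
def cumRate (z : State d) (r : ℝ≥0) : ℝ :=
  ∫ s in (0 : ℝ)..r, (D.lam (D.ψ s.toNNReal z) : ℝ)

/-- The first time at which the accumulated rate from `z` reaches the level `u`
(infinite if it never does). -/
def holdTime (z : State d) (u : ℝ) : ℝ≥0∞ :=
  ⨅ (r : ℝ≥0) (_ : u ≤ D.cumRate z r), (r : ℝ≥0∞)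

lemma intervalIntegrable_lam (z : State d) (a b : ℝ≥0) :
    IntervalIntegrable (fun s : ℝ => (D.lam (D.ψ s.toNNReal z) : ℝ)) volume a b := by
  rw [intervalIntegrable_iff]
  refine (D.integrable_lam z (max a b)).mono_set ?_
  intro x hx
  rw [Set.uIoc, Set.mem_Ioc] at hx
  refine ⟨(le_min a.2 b.2).trans hx.1.le, ?_⟩
  rw [NNReal.coe_max]
  exact hx.2

lemma cumRate_mono (z : State d) : Monotone (D.cumRate z) := by
  intro a b hab
  have h := intervalIntegral.integral_add_adjacent_intervals
    (by simpa using D.intervalIntegrable_lam z 0 a) (D.intervalIntegrable_lam z a b)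
  have h2 : 0 ≤ ∫ s in (a : ℝ)..b, (D.lam (D.ψ s.toNNReal z) : ℝ) :=
    intervalIntegral.integral_nonneg (by exact_mod_cast hab) (fun _ _ => NNReal.coe_nonneg _)
  unfold cumRate
  linarith

lemma continuous_cumRate (z : State d) : Continuous (D.cumRate z) := by
  rw [continuous_iff_continuousAt]
  intro r
  have h := intervalIntegral.continuousOn_primitive_interval
    (μ := volume) (f := fun s : ℝ => (D.lam (D.ψ s.toNNReal z) : ℝ)) (a := 0)
    (b := ((r + 1 : ℝ≥0) : ℝ))
    (by rw [Set.uIcc_of_le (NNReal.coe_nonneg _)]; exact D.integrable_lam z (r + 1))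
  rw [Set.uIcc_of_le (NNReal.coe_nonneg _)] at h
  have hr : (r : ℝ) ∈ Set.Icc (0 : ℝ) ((r + 1 : ℝ≥0) : ℝ) := ⟨r.2, by push_cast; linarith⟩
  have h1 := h r hr
  refine Tendsto.comp h1 (tendsto_nhdsWithin_iff.2 ⟨NNReal.continuous_coe.tendsto r, ?_⟩)
  have : ∀ᶠ x : ℝ≥0 in 𝓝 r, x < r + 1 := eventually_lt_nhds (by simp)
  filter_upwards [this] with x hx
  exact ⟨x.2, by exact_mod_cast hx.le⟩

lemma measurable_cumRate (r : ℝ≥0) : Measurable (fun z => D.cumRate z r) := by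
  have h : Measurable (fun p : State d × ℝ => (D.lam (D.ψ p.2.toNNReal p.1) : ℝ)) := by
    have h1 : Measurable (fun p : State d × ℝ => (p.2.toNNReal, p.1)) := by fun_prop
    exact (D.measurable_lam.comp (D.measurable_ψ.comp h1)).coe_nnreal_real
  have : (fun z => D.cumRate z r)
      = fun z => ∫ s in Set.Ioc (0 : ℝ) r, (D.lam (D.ψ s.toNNReal z) : ℝ) := by
    funext z
    exact intervalIntegral.integral_of_le r.2
  rw [this]
  exact (h.stronglyMeasurable.integral_prod_right (ν := volume.restrict (Set.Ioc (0 : ℝ) r))).measurable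

lemma lt_holdTime_iff (z : State d) (u : ℝ) (r : ℝ≥0) :
    (r : ℝ≥0∞) < D.holdTime z u ↔ D.cumRate z r < u := by
  constructor
  · intro h
    by_contra! hu
    exact absurd h (not_lt.2 (iInf₂_le r hu))
  · intro h
    have h1 : ∀ᶠ x in 𝓝[>] r, D.cumRate z x < u :=
      nhdsWithin_le_nhds (((D.continuous_cumRate z).tendsto r).eventually (eventually_lt_nhds h))
    obtain ⟨x, hx, hrx⟩ := (h1.and self_mem_nhdsWithin).exists
    refine lt_of_lt_of_le (ENNReal.coe_lt_coe.2 hrx) (le_iInf₂ fun y hy => ?_)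
    by_contra! hlt
    have := D.cumRate_mono z (ENNReal.coe_lt_coe.1 hlt).le
    linarith

lemma measurable_holdTime : Measurable (Function.uncurry D.holdTime) := by
  refine measurable_of_Ioi fun a => ?_
  induction a using ENNReal.recTopCoe with
  | top => simp
  | coe r =>
    have : Function.uncurry D.holdTime ⁻¹' Set.Ioi (r : ℝ≥0∞)
        = {p : State d × ℝ | D.cumRate p.1 r < p.2} := by
      ext p
      exact D.lt_holdTime_iff p.1 p.2 r
    rw [this]
    exact measurableSet_lt ((D.measurable_cumRate r).comp measurable_fst) measurable_snd

instance isProbabilityMeasure_exp_one : IsProbabilityMeasure (expMeasure 1) :=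
  isProbabilityMeasure_expMeasure one_pos

/-- The law of the holding time started at `z`, a probability measure on `[0, ∞]`;
it is characterised by `hold_Ioi`. -/
def hold : Kernel (State d) ℝ≥0∞ :=
  (Kernel.id ×ₖ Kernel.const (State d) (expMeasure 1)).map (Function.uncurry D.holdTime)

instance isMarkovKernel_hold : IsMarkovKernel D.hold :=
  Kernel.IsMarkovKernel.map _ D.measurable_holdTime

/-- `ℙ(θ > r) = exp (-∫₀ʳ lam (ψ(s, z)) ds)`. -/
lemma hold_Ioi (z : State d) (r : ℝ≥0) :
    D.hold z (Set.Ioi (r : ℝ≥0∞)) = ENNReal.ofReal (Real.exp (-D.cumRate z r)) := by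
  have h0 : 0 ≤ D.cumRate z r := by
    have := D.cumRate_mono z (bot_le : (0 : ℝ≥0) ≤ r)
    simpa [cumRate] using this
  have hset : Prod.mk z ⁻¹' (Function.uncurry D.holdTime ⁻¹' Set.Ioi (r : ℝ≥0∞))
      = (Set.Iic (D.cumRate z r))ᶜ := by
    ext u
    simpa using D.lt_holdTime_iff z u r
  have hcdf := cdf_expMeasure_eq one_pos (D.cumRate z r)
  rw [if_pos h0, one_mul, cdf_eq_real] at hcdf
  rw [hold, Kernel.map_apply' _ D.measurable_holdTime _ measurableSet_Ioi, Kernel.prod_apply,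
    Kernel.id_apply, Kernel.const_apply, Measure.dirac_prod,
    Measure.map_apply measurable_prodMk_left (D.measurable_holdTime measurableSet_Ioi), hset,
    ← ofReal_measureReal, probReal_compl_eq_one_sub measurableSet_Iic, hcdf]
  congr 1
  ring

lemma measurable_preJump :
    Measurable (fun x : State d × ℝ≥0∞ => D.ψ x.2.toNNReal x.1) :=
  D.measurable_ψ.comp (measurable_snd.ennreal_toNNReal.prodMk measurable_fst)

lemma measurableSet_noJump : MeasurableSet {x : State d × ℝ≥0∞ | x.2 = ⊤} :=
  measurable_snd (measurableSet_singleton ⊤)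

/-- The law of the next post-jump position given the current post-jump position `z` and the holding
time `s`: it is `Q(ψ(s, z), ·)` if `s < ∞`. If `s = ∞` there is no further jump, and the position is
kept by convention. -/
def postJump : Kernel (State d × ℝ≥0∞) (State d) :=
  open Classical in
  Kernel.piecewise (measurableSet_noJump (d := d))
    (Kernel.deterministic Prod.fst measurable_fst)
    (D.Q.comap (fun x => D.ψ x.2.toNNReal x.1) D.measurable_preJump)

instance isMarkovKernel_postJump : IsMarkovKernel D.postJump := by
  unfold postJump
  infer_instance

/-- The transition kernel of the skeleton chain `(ξ_n, θ_n)`. -/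
def step : Kernel (State d × ℝ≥0∞) (State d × ℝ≥0∞) :=
  D.postJump ⊗ₖ Kernel.prodMkLeft (State d × ℝ≥0∞) D.hold

instance isMarkovKernel_step : IsMarkovKernel D.step := by
  unfold step
  infer_instance

variable {Ω : Type*} [MeasurableSpace Ω]

/-- `X n = (ξ_n, θ_n)` is a skeleton chain: a time homogeneous Markov chain with transition kernel
`D.step`, where `θ_0` has the holding time distribution given `ξ_0`. -/
structure IsSkeletonChain (P : Measure Ω) (X : ℕ → Ω → State d × ℝ≥0∞) : Prop where
  measurable : ∀ n, Measurable (X n)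
  initial : P.map (X 0) = (P.map fun ω => (X 0 ω).1) ⊗ₘ D.hold
  transition : ∀ n : ℕ,
    P.map (fun ω => ((fun i : Finset.Iic n => X i ω), X (n + 1) ω))
      = (P.map fun ω => fun i : Finset.Iic n => X i ω) ⊗ₘ
        (D.step.comap (fun h => h ⟨n, Finset.mem_Iic.2 le_rfl⟩) (measurable_pi_apply _))

/-- The `n`-th jump time `θ_0 + ⋯ + θ_{n-1}`, with values in `[0, ∞]`. -/
def jumpTime (X : ℕ → Ω → State d × ℝ≥0∞) (n : ℕ) (ω : Ω) : ℝ≥0∞ :=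
  ∑ i ∈ Finset.range n, (X i ω).2

/-- `Z` is a piecewise deterministic Markov process with characteristics `D`: almost surely the jump
times of its skeleton chain do not accumulate, and between jumps `Z` follows the flow. -/
def IsRealization (P : Measure Ω) (Z : ℝ≥0 → Ω → State d) : Prop :=
  (∀ t, Measurable (Z t)) ∧
  ∃ X : ℕ → Ω → State d × ℝ≥0∞,
    D.IsSkeletonChain P X ∧
    (∀ᵐ ω ∂P, Tendsto (fun n => jumpTime X n ω) atTop (𝓝 ⊤)) ∧
    ∀ᵐ ω ∂P, ∀ (n : ℕ) (t : ℝ≥0), jumpTime X n ω ≤ t → (t : ℝ≥0∞) < jumpTime X (n + 1) ω →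
      Z t ω = D.ψ (t - (jumpTime X n ω).toNNReal) (X n ω).1

end PDMP

/-- The first exit time `inf {t ≥ 0 : z(t) ∉ W}` of the path `z`. -/
def exitTime {E : Type*} (W : Set E) (z : ℝ≥0 → E) : ℝ≥0∞ :=
  ⨅ (t : ℝ≥0) (_ : z t ∉ W), (t : ℝ≥0∞)

/-- `∫_a^b f(z(t)) dt`, for `0 ≤ a ≤ b`. -/
def pathIntegral {E : Type*} (f : E → ℝ) (z : ℝ≥0 → E) (a b : ℝ) : ℝ :=
  ∫ t in a..b, f (z t.toNNReal)

/-- `μ` is the quasistationary distribution in `W` of a process `Z` which is started from `μ`. -/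
structure IsQSD {Ω E : Type*} [MeasurableSpace Ω] [MeasurableSpace E] (P : Measure Ω)
    (Z : ℝ≥0 → Ω → E) (W : Set E) (μ : Measure E) : Prop where
  initial : P.map (Z 0) = μ
  support : μ W = 1
  quasistationary : ∀ (t : ℝ≥0) (A : Set E), MeasurableSet A → A ⊆ W →
    (ProbabilityTheory.cond P {ω | (t : ℝ≥0∞) < exitTime W (fun s => Z s ω)}) (Z t ⁻¹' A) = μ A

section Synchronous

variable {E : Type*} {R : ℕ} (W : Set E) (Δ : ℝ) (z : Fin R → ℝ≥0 → E)

/-- `N = inf {n ≥ 1 : ∃ r, τ^r ≤ n Δ}`. -/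
def syncN : ℕ :=
  sInf {n : ℕ | 1 ≤ n ∧ ∃ r, exitTime W (z r) ≤ ENNReal.ofReal (n * Δ)}

/-- `J = min {r : τ^r ≤ N Δ}`. -/
def syncJ [NeZero R] : Fin R :=
  Classical.epsilon fun j => IsLeast {r | exitTime W (z r) ≤ ENNReal.ofReal (syncN W Δ z * Δ)} j

/-- The contribution `f_par` of the synchronous parallel step. -/
def syncPar [NeZero R] (f : E → ℝ) : ℝ :=
  (∑ n ∈ Finset.Icc 1 (syncN W Δ z - 1), ∑ r, pathIntegral f (z r) (((n : ℝ) - 1) * Δ) (n * Δ))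
  + (∑ r ∈ Finset.Iio (syncJ W Δ z),
      pathIntegral f (z r) (((syncN W Δ z : ℝ) - 1) * Δ) (syncN W Δ z * Δ))
  + pathIntegral f (z (syncJ W Δ z)) (((syncN W Δ z : ℝ) - 1) * Δ)
      (exitTime W (z (syncJ W Δ z))).toReal

/-- The time `T_par` of the synchronous parallel step. -/
def syncTime [NeZero R] : ℝ := syncPar W Δ z fun _ => 1

/-- The escape point `Z_par = Z^J(τ^J)` of the synchronous parallel step. -/
def syncExit [NeZero R] : E :=
  z (syncJ W Δ z) (exitTime W (z (syncJ W Δ z))).toNNReal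

end Synchronous

section Asynchronous

/-- `κ k = (r_k, m_k)` enumerates all pairs in strictly increasing order of wall-clock time.
(The enumeration starts with `k = 0`, and so do the processors `r`.) -/
def IsWallClockOrder {R : ℕ} (w : Fin R → ℕ → ℝ≥0) (κ : ℕ → Fin R × ℕ) : Prop :=
  Function.Surjective κ ∧ StrictMono fun k => w (κ k).1 (κ k).2

/-- The wall-clock order (arbitrary if there is none). -/
def wallClockOrder {R : ℕ} [NeZero R] (w : Fin R → ℕ → ℝ≥0) : ℕ → Fin R × ℕ :=
  Classical.epsilon (IsWallClockOrder w)

variable {E : Type*} {R : ℕ} (W : Set E) (Δ : ℝ) (z : Fin R → ℝ≥0 → E) (κ : ℕ → Fin R × ℕ)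

/-- `K = inf {k : τ^{r_k} ≤ (m_k + 1) Δ}`. -/
def asyncK : ℕ :=
  sInf {k : ℕ | exitTime W (z (κ k).1) ≤ ENNReal.ofReal (((κ k).2 + 1) * Δ)}

/-- The contribution `f_par` of the asynchronous parallel step. -/
def asyncPar (f : E → ℝ) : ℝ :=
  (∑ k ∈ Finset.range (asyncK W Δ z κ),
    pathIntegral f (z (κ k).1) ((κ k).2 * Δ) (((κ k).2 + 1) * Δ))
  + pathIntegral f (z (κ (asyncK W Δ z κ)).1) ((κ (asyncK W Δ z κ)).2 * Δ)
      (exitTime W (z (κ (asyncK W Δ z κ)).1)).toReal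

/-- The time `T_par` of the asynchronous parallel step. -/
def asyncTime : ℝ := asyncPar W Δ z κ fun _ => 1

/-- The escape point `Z_par = Z^{r_K}(τ^{r_K})` of the asynchronous parallel step. -/
def asyncExit : E :=
  z (κ (asyncK W Δ z κ)).1 (exitTime W (z (κ (asyncK W Δ z κ)).1)).toNNReal

end Asynchronous

end

/-! The driving fact is a renewal property at fixed times. By the Markov property at time `t`, the
future of `Z` on `{τ > t}` is that of a process started from `Z t`. By quasistationarity, `Z t` has
law `μ` given `τ > t`. Hence, given `τ > t`, the shifted path has the law `ν` of the original path
(`PDMP.IsRealization.renewal`). With `p = ν(τ > Δ)` this gives `ν(τ > mΔ) = p ^ m`, and `p < 1`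
because `τ` is finite almost surely.

Cut a single path into segments of length `Δ`. On the event `A k` that the first `k` segments stay
in `W`, the path from time `kΔ` on has law `p ^ k • ν`. The same holds for independent paths run in
an order that is independent of them: if processor `r` has completed `n r` segments before position
`k`, then `∑ r, n r = k`, and the product over the processors of the survival probabilities `p ^ (n
r)` is again `p ^ k`, while the current path is a fresh sample of `ν`. Both procedures are therefore
instances of `IsRenewalScheme` with the same `Δ` and `ν`. In any such scheme the expected total
contribution is `∑ p ^ k * E(segment)`, and the law of duration and exit point is likewise a series
in `p` and `ν` alone (`IsRenewalScheme.integral_eq`, `IsRenewalScheme.map_exit`). The synchronous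
step is the asynchronous one in which the processors take turns (`sync_eq_async`).

The Markov property is proved for the skeleton chain by induction on the number of jumps up to time
`t`, starting from the memorylessness of the holding times along the flow. It is first obtained for
events which constrain the path at countably many times. To reach `{τ > t}` with `W` open, this
event is written, up to a null set, as a countable union of events that the path lies in a fixed
closed subset of `W` at all times of a countable dense set. This needs that the path keeps a
positive distance from the complement of `W` until it leaves. It could fail only if a left limit at
a jump lay outside `W`, so that the flow line left `W` exactly at the jump time, which has
probability zero because holding times have no atoms in `[0, ∞)`. -/

noncomputable section

/-! ### Laws of time homogeneous Markov chains on sequence space -/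

section MarkovChain

variable {S : Type*} [MeasurableSpace S]

/-- The sequence `x` stopped at time `n`. -/
def stopAt (n : ℕ) (x : ℕ → S) : ℕ → S := fun i => x (min i n)

lemma measurable_stopAt (n : ℕ) : Measurable (stopAt (S := S) n) :=
  measurable_pi_lambda _ fun _ => measurable_pi_apply _

/-- The sequence which starts with `s` and continues with `x`. -/
def consSeq (s : S) (x : ℕ → S) : ℕ → S
  | 0 => s
  | n + 1 => x n

lemma measurable_consSeq : Measurable fun p : S × (ℕ → S) => consSeq p.1 p.2 := by
  refine measurable_pi_lambda _ fun n => ?_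
  cases n with
  | zero => exact measurable_fst
  | succ n => exact (measurable_pi_apply n).comp measurable_snd

/-- `M` is the law of a time homogeneous Markov chain with transition kernel `η`. -/
def IsMarkovChainLaw (η : Kernel S S) (M : Measure (ℕ → S)) : Prop :=
  ∀ (n : ℕ) (g : (ℕ → S) × S → ℝ≥0∞), Measurable g →
    ∫⁻ x, g (stopAt n x, x (n + 1)) ∂M = ∫⁻ x, ∫⁻ s, g (stopAt n x, s) ∂η (x n) ∂M

/-- The sequence which agrees with `p.1` up to time `n` and has the value `p.2` afterwards. -/
def glueAt (n : ℕ) (p : (ℕ → S) × S) : ℕ → S := fun i => if i ≤ n then p.1 i else p.2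

lemma measurable_glueAt (n : ℕ) : Measurable (glueAt (S := S) n) := by
  refine measurable_pi_lambda _ fun i => ?_
  by_cases h : i ≤ n
  · simp only [glueAt, h, if_true]
    fun_prop
  · simpa [glueAt, h] using measurable_snd

lemma glueAt_stopAt {S : Type*} (n : ℕ) (x : ℕ → S) :
    glueAt n (stopAt n x, x (n + 1)) = stopAt (n + 1) x := by
  funext i
  by_cases h : i ≤ n
  · simp [glueAt, stopAt, h, h.trans n.le_succ]
  · simp [glueAt, stopAt, h, Nat.succ_le_of_lt (not_le.1 h)]

/-- The chain stopped at `n + 1` is a function of the chain stopped at `n` and of the next state.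
This is the recursion behind uniqueness of the law. -/
lemma IsMarkovChainLaw.map_stopAt_succ {η : Kernel S S} [IsMarkovKernel η]
    {M : Measure (ℕ → S)} (h : IsMarkovChainLaw η M) (n : ℕ) (g : (ℕ → S) → ℝ≥0∞)
    (hg : Measurable g) :
    ∫⁻ x, g x ∂(M.map (stopAt (n + 1)))
      = ∫⁻ x, ∫⁻ s, g (glueAt n (x, s)) ∂η (x n) ∂(M.map (stopAt n)) := by
  have h1 : Measurable fun x : ℕ → S => ∫⁻ s, g (glueAt n (x, s)) ∂η (x n) :=
    Measurable.lintegral_kernel_prod_right' (κ := η.comap (fun x : ℕ → S => x n)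
      (measurable_pi_apply n)) (f := fun p => g (glueAt n p)) (hg.comp (measurable_glueAt n))
  rw [lintegral_map hg (measurable_stopAt _), lintegral_map h1 (measurable_stopAt _)]
  have := h n (fun p => g (glueAt n p)) (hg.comp (measurable_glueAt n))
  simp only [glueAt_stopAt] at this
  rw [this]
  simp [stopAt]

/-- The law of a Markov chain is determined by its initial law and its transition kernel. -/
theorem IsMarkovChainLaw.unique {η : Kernel S S} [IsMarkovKernel η]
    {M₁ M₂ : Measure (ℕ → S)} [IsFiniteMeasure M₁] [IsFiniteMeasure M₂]
    (h₁ : IsMarkovChainLaw η M₁) (h₂ : IsMarkovChainLaw η M₂)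
    (h0 : M₁.map (fun x => x 0) = M₂.map (fun x => x 0)) : M₁ = M₂ := by
  have key : ∀ n, M₁.map (stopAt n) = M₂.map (stopAt n) := by
    intro n
    induction n with
    | zero =>
      have hc : Measurable fun (s : S) (_ : ℕ) => s := measurable_pi_lambda _ fun _ => measurable_id
      have hs : stopAt (S := S) 0 = (fun (s : S) (_ : ℕ) => s) ∘ fun x => x 0 := by
        funext x i
        simp [stopAt]
      rw [hs, ← Measure.map_map hc (measurable_pi_apply 0), h0,
        Measure.map_map hc (measurable_pi_apply 0)]
    | succ n ih =>
      refine Measure.ext_of_lintegral _ fun g hg => ?_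
      rw [h₁.map_stopAt_succ n g hg, h₂.map_stopAt_succ n g hg, ih]
  -- Finite dimensional marginals determine the law, and restriction to a finite set of indices
  -- factors through stopping at its maximum.
  refine IsProjectiveLimit.unique (P := fun I : Finset ℕ => M₂.map I.restrict) (fun I => ?_)
    (fun I => rfl)
  have hI : I.restrict = I.restrict (π := fun _ => S) ∘ stopAt (I.sup id) := by
    funext x i
    simp [stopAt, show i.1 ≤ I.sup id from Finset.le_sup (f := id) i.2]
  have h2 := congrArg (fun ν => ν.map (I.restrict (π := fun _ => S))) (key (I.sup id))
  rw [Measure.map_map (by fun_prop) (measurable_stopAt _),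
    Measure.map_map (by fun_prop) (measurable_stopAt _), ← hI] at h2
  exact h2

/-- Histories indexed by `Finset.Iic n` live in a different space for each `n`. Extending them as
constant after time `n` turns them into stopped sequences, which all live in `ℕ → S`. -/
lemma isMarkovChainLaw_map {η : Kernel S S} [IsMarkovKernel η] {Ω : Type*} [MeasurableSpace Ω]
    {P : Measure Ω} [SFinite P] {X : ℕ → Ω → S} (hX : ∀ n, Measurable (X n))
    (h : ∀ n : ℕ, P.map (fun ω => ((fun i : Finset.Iic n => X i ω), X (n + 1) ω))
      = (P.map fun ω => fun i : Finset.Iic n => X i ω) ⊗ₘ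
        (η.comap (fun h => h ⟨n, Finset.mem_Iic.2 le_rfl⟩) (measurable_pi_apply _))) :
    IsMarkovChainLaw η (P.map fun ω n => X n ω) := by
  intro n g hg
  have hX' : Measurable fun ω n => X n ω := measurable_pi_lambda _ hX
  have hh : Measurable fun ω => fun i : Finset.Iic n => X i ω := by fun_prop
  set e : (Finset.Iic n → S) → ℕ → S := fun y i => y ⟨min i n, Finset.mem_Iic.2 (min_le_right _ _)⟩
  have he : Measurable e := measurable_pi_lambda _ fun i => measurable_pi_apply _
  have hge : Measurable fun p : (Finset.Iic n → S) × S => g (e p.1, p.2) := by fun_prop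
  have key : ∫⁻ ω, g (stopAt n (fun n => X n ω), X (n + 1) ω) ∂P
      = ∫⁻ p, g (e p.1, p.2) ∂(P.map
        (fun ω => ((fun i : Finset.Iic n => X i ω), X (n + 1) ω))) := by
    rw [lintegral_map hge (by fun_prop)]
    rfl
  have hm2 : Measurable fun x : ℕ → S => ∫⁻ s, g (stopAt n x, s) ∂η (x n) :=
    Measurable.lintegral_kernel_prod_right' (κ := η.comap (fun x : ℕ → S => x n)
      (measurable_pi_apply n)) (f := fun p => g (stopAt n p.1, p.2))
      (hg.comp (((measurable_stopAt n).comp measurable_fst).prodMk measurable_snd))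
  have hm1 : Measurable fun x : ℕ → S => g (stopAt n x, x (n + 1)) :=
    hg.comp ((measurable_stopAt n).prodMk (measurable_pi_apply _))
  rw [lintegral_map hm1 hX', lintegral_map hm2 hX', key, h n, Measure.lintegral_compProd hge,
    lintegral_map _ hh]
  · rfl
  · exact Measurable.lintegral_kernel_prod_right' (κ := η.comap (fun x : Finset.Iic n → S =>
      x ⟨n, Finset.mem_Iic.2 le_rfl⟩) (measurable_pi_apply _)) hge

/-- The law of the Markov chain with transition kernel `η` which starts from a given state. -/
def markovChain (η : Kernel S S) [IsMarkovKernel η] : Kernel S (ℕ → S) :=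
  (Kernel.traj (X := fun _ => S) (fun n => η.comap (fun h : (Π _ : Finset.Iic n, S) =>
    h ⟨n, Finset.mem_Iic.2 le_rfl⟩) (measurable_pi_apply _)) 0).comap
    (fun s _ => s) (measurable_pi_lambda _ fun _ => measurable_id)

variable (η : Kernel S S) [IsMarkovKernel η]

instance : IsMarkovKernel (markovChain η) := by
  unfold markovChain
  infer_instance

lemma isMarkovChainLaw_markovChain (s : S) : IsMarkovChainLaw η (markovChain η s) := by
  have := isMarkovChainLaw_map (η := η) (P := markovChain η s) (X := fun n x => x n)
    (fun n => measurable_pi_apply n) ?_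
  · simpa using this
  · intro n
    have h := Kernel.partialTraj_compProd_eq_map_traj (X := fun _ => S)
      (κ := fun n => η.comap (fun h : (Π _ : Finset.Iic n, S) =>
        h ⟨n, Finset.mem_Iic.2 le_rfl⟩) (measurable_pi_apply _)) (Nat.zero_le n) (x₀ := fun _ => s)
    rw [← Kernel.traj_map_frestrictLe_apply] at h
    exact h.symm

lemma markovChain_map_zero (s : S) : (markovChain η s).map (fun x => x 0) = Measure.dirac s := by
  have h := Kernel.traj_map_frestrictLe_apply (X := fun _ => S)
      (κ := fun n => η.comap (fun h : (Π _ : Finset.Iic n, S) =>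
        h ⟨n, Finset.mem_Iic.2 le_rfl⟩) (measurable_pi_apply _)) 0 0 (fun _ => s)
  rw [Kernel.partialTraj_self, Kernel.id_apply] at h
  have h2 := congrArg (fun ν => ν.map fun y : (Finset.Iic 0 → S) =>
    y ⟨0, Finset.mem_Iic.2 le_rfl⟩) h
  rw [Measure.map_map (by fun_prop) (by fun_prop), Measure.map_dirac' (by fun_prop)] at h2
  exact h2

/-- The defining identity is linear in the law, hence stable under mixtures. -/
lemma IsMarkovChainLaw.bind {T : Type*} [MeasurableSpace T] (M : Measure T)
    {κ : Kernel T (ℕ → S)} (h : ∀ t, IsMarkovChainLaw η (κ t)) :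
    IsMarkovChainLaw η (M.bind κ) := by
  intro n g hg
  have hm2 : Measurable fun x : ℕ → S => ∫⁻ s, g (stopAt n x, s) ∂η (x n) :=
    Measurable.lintegral_kernel_prod_right' (κ := η.comap (fun x : ℕ → S => x n)
      (measurable_pi_apply n)) (f := fun p => g (stopAt n p.1, p.2))
      (hg.comp (((measurable_stopAt n).comp measurable_fst).prodMk measurable_snd))
  have hm1 : Measurable fun x : ℕ → S => g (stopAt n x, x (n + 1)) :=
    hg.comp ((measurable_stopAt n).prodMk (measurable_pi_apply _))
  rw [Measure.lintegral_bind κ.aemeasurable hm1.aemeasurable,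
    Measure.lintegral_bind κ.aemeasurable hm2.aemeasurable]
  exact lintegral_congr fun t => h t n g hg

lemma stopAt_consSeq_succ {S : Type*} (n : ℕ) (s : S) (x : ℕ → S) :
    stopAt (n + 1) (consSeq s x) = consSeq s (stopAt n x) := by
  funext i
  cases i with
  | zero => simp [stopAt, consSeq]
  | succ i => simp only [stopAt, consSeq, Nat.add_min_add_right]

/-- The Markov chain started from `s`, seen from its first step. -/
theorem markovChain_eq_map_consSeq [MeasurableSingletonClass S] (s : S) :
    markovChain η s = ((η s).bind (markovChain η)).map (consSeq s) := by
  have hc : Measurable (consSeq s) := measurable_consSeq.comp measurable_prodMk_left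
  have : IsProbabilityMeasure (((η s).bind (markovChain η)).map (consSeq s)) :=
    Measure.isProbabilityMeasure_map hc.aemeasurable
  -- Both sides are chain laws with the same kernel and start at `s`, so uniqueness applies.
  refine (isMarkovChainLaw_markovChain η s).unique ?_ ?_
  · have hb : IsMarkovChainLaw η ((η s).bind (markovChain η)) :=
      IsMarkovChainLaw.bind η _ (isMarkovChainLaw_markovChain η)
    intro n g hg
    have hm2 : Measurable fun x : ℕ → S => ∫⁻ s, g (stopAt n x, s) ∂η (x n) :=
      Measurable.lintegral_kernel_prod_right' (κ := η.comap (fun x : ℕ → S => x n)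
        (measurable_pi_apply n)) (f := fun p => g (stopAt n p.1, p.2))
        (hg.comp (((measurable_stopAt n).comp measurable_fst).prodMk measurable_snd))
    have hm1 : Measurable fun x : ℕ → S => g (stopAt n x, x (n + 1)) :=
      hg.comp ((measurable_stopAt n).prodMk (measurable_pi_apply _))
    rw [lintegral_map hm1 hc, lintegral_map hm2 hc]
    -- For positive times the identity is that of the tail. At time zero it says that the tail
    -- starts from a sample of `η s`.
    cases n with
    | succ n =>
      simp only [stopAt_consSeq_succ]
      exact hb n (fun p => g (consSeq s p.1, p.2))
        (hg.comp ((hc.comp measurable_fst).prodMk measurable_snd))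
    | zero =>
      have h0 : ∀ x : ℕ → S, stopAt 0 (consSeq s x) = fun _ => s := by
        intro x
        funext i
        simp [stopAt, consSeq]
      have hgs : Measurable fun t : S => g (fun _ => s, t) := hg.comp measurable_prodMk_left
      have hz : Measurable fun a : ℕ → S => a 0 := measurable_pi_apply 0
      simp only [h0, consSeq, lintegral_const, measure_univ, mul_one]
      rw [Measure.lintegral_bind (f := fun a => g (fun _ => s, a 0)) (markovChain η).aemeasurable
        (show Measurable fun a : ℕ → S => g (fun _ => s, a 0) from hgs.comp hz).aemeasurable]
      refine lintegral_congr fun t => ?_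
      have := lintegral_map (μ := markovChain η t) hgs hz
      rw [markovChain_map_zero, lintegral_dirac' _ hgs] at this
      exact this.symm
  · rw [markovChain_map_zero, Measure.map_map (measurable_pi_apply 0) hc]
    have : (fun x : ℕ → S => x 0) ∘ consSeq s = fun _ => s := rfl
    rw [this, Measure.map_const, measure_univ, one_smul]

end MarkovChain

/-! ### Memoryless holding times, the skeleton chain and its path -/

namespace PDMP

variable {d : ℕ} (D : PDMP d)

lemma cumRate_zero (z : State d) : D.cumRate z 0 = 0 := by
  simp [cumRate]

/-- This is the semigroup property of the flow. After exponentiation it becomes the memorylessness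
of the holding time. -/
lemma cumRate_add (z : State d) (t r : ℝ≥0) :
    D.cumRate z (t + r) = D.cumRate z t + D.cumRate (D.ψ t z) r := by
  have h := intervalIntegral.integral_add_adjacent_intervals
    (by simpa using D.intervalIntegrable_lam z 0 t) (D.intervalIntegrable_lam z t (t + r))
  unfold cumRate
  rw [← h]
  congr 1
  have h2 : ∫ s in (0 : ℝ)..r, (D.lam (D.ψ s.toNNReal (D.ψ t z)) : ℝ)
      = ∫ s in (0 : ℝ)..r, (fun s : ℝ => (D.lam (D.ψ s.toNNReal z) : ℝ)) (s + t) := by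
    refine intervalIntegral.integral_congr fun s hs => ?_
    rw [Set.uIcc_of_le (NNReal.coe_nonneg r)] at hs
    have : (s + t).toNNReal = t + s.toNNReal := by
      rw [Real.toNNReal_add hs.1 (NNReal.coe_nonneg t), Real.toNNReal_coe, add_comm]
    simp only [this, D.ψ_add]
  rw [h2, intervalIntegral.integral_comp_add_right (fun s : ℝ => (D.lam (D.ψ s.toNNReal z) : ℝ))]
  congr 1
  · simp
  · push_cast
    ring

lemma hold_Ioi_add (z : State d) (t r : ℝ≥0) :
    D.hold z (Set.Ioi ((t + r : ℝ≥0) : ℝ≥0∞))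
      = D.hold z (Set.Ioi (t : ℝ≥0∞)) * D.hold (D.ψ t z) (Set.Ioi (r : ℝ≥0∞)) := by
  rw [hold_Ioi, hold_Ioi, hold_Ioi, cumRate_add, ← ENNReal.ofReal_mul (Real.exp_nonneg _),
    ← Real.exp_add]
  congr 2
  ring

/-- The holding time is memoryless along the flow. -/
theorem hold_memoryless (z : State d) (t : ℝ≥0) :
    ((D.hold z).restrict (Set.Ioi (t : ℝ≥0∞))).map (fun θ : ℝ≥0∞ => θ - t)
      = D.hold z (Set.Ioi (t : ℝ≥0∞)) • D.hold (D.ψ t z) := by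
  have hm : Measurable fun θ : ℝ≥0∞ => θ - t := by fun_prop
  have hfin : IsFiniteMeasure
      (((D.hold z).restrict (Set.Ioi (t : ℝ≥0∞))).map (fun θ : ℝ≥0∞ => θ - t)) := inferInstance
  have huniv : (((D.hold z).restrict (Set.Ioi (t : ℝ≥0∞))).map (fun θ : ℝ≥0∞ => θ - t)) Set.univ
      = (D.hold z (Set.Ioi (t : ℝ≥0∞)) • D.hold (D.ψ t z)) Set.univ := by
    rw [Measure.map_apply hm .univ]
    simp
  have hfin2 : IsFiniteMeasure (D.hold z (Set.Ioi (t : ℝ≥0∞)) • D.hold (D.ψ t z)) :=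
    ⟨by rw [← huniv]; exact measure_lt_top _ _⟩
  -- Both measures are finite with the same total mass, so it suffices to compare the tails `Ioi r`,
  -- where the claim is `hold_Ioi_add`.
  refine Measure.ext_of_Iic _ _ fun a => ?_
  induction a using ENNReal.recTopCoe with
  | top => rw [← Set.Iic_top] at huniv; exact huniv
  | coe r =>
    have hI : (Set.Iic (r : ℝ≥0∞)) = (Set.Ioi (r : ℝ≥0∞))ᶜ := Set.compl_Ioi.symm
    rw [hI, measure_compl measurableSet_Ioi (measure_ne_top _ _),
      measure_compl measurableSet_Ioi (measure_ne_top _ _), huniv]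
    congr 1
    rw [Measure.map_apply hm measurableSet_Ioi, Measure.restrict_apply (hm measurableSet_Ioi),
      Measure.smul_apply, smul_eq_mul, ← hold_Ioi_add]
    congr 1
    ext θ
    simp only [Set.mem_inter_iff, Set.mem_preimage, Set.mem_Ioi, ENNReal.coe_add]
    constructor
    · rintro ⟨h, -⟩
      rw [add_comm]
      exact lt_tsub_iff_right.1 h
    · intro h
      exact ⟨lt_tsub_iff_left.2 h, lt_of_le_of_lt le_self_add h⟩

lemma lintegral_hold_memoryless (z : State d) (t : ℝ≥0) {g : ℝ≥0∞ → ℝ≥0∞} (hg : Measurable g) :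
    ∫⁻ θ in Set.Ioi (t : ℝ≥0∞), g (θ - t) ∂D.hold z
      = D.hold z (Set.Ioi (t : ℝ≥0∞)) * ∫⁻ θ, g θ ∂D.hold (D.ψ t z) := by
  rw [← lintegral_map (f := g) hg (by fun_prop), hold_memoryless, lintegral_smul_measure,
    smul_eq_mul]

/-- The law of the holding time has no atom in `[0, ∞)`. -/
lemma hold_singleton (z : State d) (r : ℝ≥0) : D.hold z {(r : ℝ≥0∞)} = 0 := by
  have hanti : ∀ s : ℝ≥0, s < r → D.hold z {(r : ℝ≥0∞)}
      ≤ ENNReal.ofReal (Real.exp (-D.cumRate z s))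
        - ENNReal.ofReal (Real.exp (-D.cumRate z r)) := by
    intro s hs
    rw [← hold_Ioi, ← hold_Ioi, ← measure_sdiff (Set.Ioi_subset_Ioi (by exact_mod_cast hs.le))
      measurableSet_Ioi.nullMeasurableSet (measure_ne_top _ _)]
    refine measure_mono ?_
    rintro _ rfl
    exact ⟨by simpa using hs, by simp⟩
  -- An atom at `0` is excluded because `Ioi 0` has full mass. An atom at `r > 0` is bounded by
  -- increments of the continuous survival function over `(s, r]`, which vanish as `s` increases to
  -- `r`.
  rcases eq_or_ne r 0 with rfl | hr
  · have h0 := D.hold_Ioi z 0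
    rw [cumRate_zero, neg_zero, Real.exp_zero, ENNReal.ofReal_one] at h0
    have : D.hold z (Set.Ioi ((0 : ℝ≥0) : ℝ≥0∞))ᶜ = 0 := by
      rw [measure_compl measurableSet_Ioi (measure_ne_top _ _), h0, measure_univ, tsub_self]
    refine measure_mono_null ?_ this
    rintro _ rfl
    simp
  · have hpos : 0 < r := pos_iff_ne_zero.2 hr
    have hne : (𝓝[<] r).NeBot := nhdsLT_neBot_of_exists_lt ⟨0, hpos⟩
    have hc : Continuous fun s : ℝ≥0 => ENNReal.ofReal (Real.exp (-D.cumRate z s))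
        - ENNReal.ofReal (Real.exp (-D.cumRate z r)) :=
      (ENNReal.continuous_sub_right _).comp
        (ENNReal.continuous_ofReal.comp (Real.continuous_exp.comp (D.continuous_cumRate z).neg))
    have ht := (hc.tendsto r).mono_left (nhdsWithin_le_nhds (s := Set.Iio r))
    rw [tsub_self] at ht
    exact le_antisymm (ge_of_tendsto ht (by
      filter_upwards [self_mem_nhdsWithin] with s hs using hanti s hs)) zero_le

/-- The law of the skeleton chain `(ξ_n, θ_n)` with `ξ_0 = z`. -/
def skeletonLaw : Kernel (State d) (ℕ → State d × ℝ≥0∞) :=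
  markovChain D.step ∘ₖ (Kernel.id ×ₖ D.hold)

instance : IsMarkovKernel D.skeletonLaw := by
  unfold skeletonLaw
  infer_instance

lemma lintegral_skeletonLaw_eq (z : State d) {g : (ℕ → State d × ℝ≥0∞) → ℝ≥0∞}
    (hg : Measurable g) :
    ∫⁻ x, g x ∂D.skeletonLaw z = ∫⁻ θ, ∫⁻ x, g x ∂markovChain D.step (z, θ) ∂D.hold z := by
  have h1 : Measurable fun s : State d × ℝ≥0∞ => ∫⁻ x, g x ∂markovChain D.step s :=
    hg.lintegral_kernel
  rw [skeletonLaw, Kernel.lintegral_comp _ _ _ hg, Kernel.lintegral_id_prod h1]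

/-- The skeleton chain seen from the first jump. -/
theorem lintegral_skeletonLaw (z : State d) {g : (ℕ → State d × ℝ≥0∞) → ℝ≥0∞}
    (hg : Measurable g) :
    ∫⁻ x, g x ∂D.skeletonLaw z
      = ∫⁻ θ, ∫⁻ z', ∫⁻ y, g (consSeq (z, θ) y) ∂D.skeletonLaw z' ∂D.postJump (z, θ)
          ∂D.hold z := by
  rw [lintegral_skeletonLaw_eq D z hg]
  refine lintegral_congr fun θ => ?_
  have hc : Measurable (consSeq (z, θ)) := measurable_consSeq.comp measurable_prodMk_left
  have hgc : Measurable fun y => g (consSeq (z, θ) y) := hg.comp hc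
  have h1 : Measurable fun s : State d × ℝ≥0∞ =>
      ∫⁻ y, g (consSeq (z, θ) y) ∂markovChain D.step s := hgc.lintegral_kernel
  rw [markovChain_eq_map_consSeq, lintegral_map hg hc,
    Measure.lintegral_bind (markovChain D.step).aemeasurable hgc.aemeasurable]
  -- One step of the chain draws the new position `z'` and then its holding time from `hold z'`, so
  -- the tail is again a skeleton chain started from `z'`.
  refine (Kernel.lintegral_compProd D.postJump (Kernel.prodMkLeft _ D.hold) (z, θ) h1).trans ?_
  refine lintegral_congr fun z' => ?_
  rw [lintegral_skeletonLaw_eq D z' hgc]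
  rfl

lemma measurable_lintegral_consSeq {g : (ℕ → State d × ℝ≥0∞) → ℝ≥0∞} (hg : Measurable g) :
    Measurable fun s : State d × ℝ≥0∞ =>
      ∫⁻ z', ∫⁻ y, g (consSeq s y) ∂D.skeletonLaw z' ∂D.postJump s := by
  have h1 : Measurable fun p : (State d × ℝ≥0∞) × State d =>
      ∫⁻ y, g (consSeq p.1 y) ∂D.skeletonLaw p.2 :=
    Measurable.lintegral_kernel_prod_right'
      (κ := D.skeletonLaw.comap (fun p : (State d × ℝ≥0∞) × State d => p.2) measurable_snd)
      (f := fun q => g (consSeq q.1.1 q.2))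
      (hg.comp (measurable_consSeq.comp
        ((measurable_fst.comp measurable_fst).prodMk measurable_snd)))
  exact Measurable.lintegral_kernel_prod_right' (κ := D.postJump) h1

/-- The pre-jump position is the same whether the flow is followed from `z` for time `θ` or from `ψ
t z` for the remaining time. The value `θ = ⊤` is excluded because there the convention keeps the
position, which is `z` on one side and `ψ t z` on the other. -/
lemma postJump_flow (z : State d) {t : ℝ≥0} {θ : ℝ≥0∞} (ht : (t : ℝ≥0∞) < θ) (hθ : θ ≠ ⊤) :
    D.postJump (D.ψ t z, θ - t) = D.postJump (z, θ) := by
  lift θ to ℝ≥0 using hθ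
  have hψ : D.ψ (θ - t) (D.ψ t z) = D.ψ θ z := by
    rw [← D.ψ_add, add_tsub_cancel_of_le (ENNReal.coe_lt_coe.1 ht).le]
  rw [← ENNReal.coe_sub]
  unfold postJump
  ext s hs
  simp [Kernel.piecewise_apply, Kernel.comap_apply, hψ, -ENNReal.coe_sub]

/-- The `n`-th jump time of the skeleton chain. -/
def chainTime (n : ℕ) (x : ℕ → State d × ℝ≥0∞) : ℝ≥0∞ := ∑ i ∈ Finset.range n, (x i).2

lemma measurable_chainTime (n : ℕ) : Measurable (chainTime (d := d) n) :=
  Finset.measurable_sum _ fun i _ => measurable_snd.comp (measurable_pi_apply i)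

lemma chainTime_zero (x : ℕ → State d × ℝ≥0∞) : chainTime 0 x = 0 := by simp [chainTime]

lemma chainTime_succ (n : ℕ) (x : ℕ → State d × ℝ≥0∞) :
    chainTime (n + 1) x = chainTime n x + (x n).2 := Finset.sum_range_succ _ _

lemma chainTime_mono (x : ℕ → State d × ℝ≥0∞) : Monotone fun n => chainTime n x :=
  monotone_nat_of_le_succ fun n => by simp [chainTime_succ]

lemma chainTime_consSeq (n : ℕ) (s : State d × ℝ≥0∞) (y : ℕ → State d × ℝ≥0∞) :
    chainTime (n + 1) (consSeq s y) = s.2 + chainTime n y := by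
  rw [chainTime, Finset.sum_range_succ', add_comm]
  rfl

open Classical in
/-- The path of the process with skeleton chain `x`. -/
def chainPath (x : ℕ → State d × ℝ≥0∞) (t : ℝ≥0) : State d :=
  if h : ∃ n, (t : ℝ≥0∞) < chainTime (n + 1) x then
    D.ψ (t - (chainTime (Nat.find h) x).toNNReal) (x (Nat.find h)).1
  else 0

lemma chainPath_eq {x : ℕ → State d × ℝ≥0∞} {t : ℝ≥0} {n : ℕ} (h1 : chainTime n x ≤ t)
    (h2 : (t : ℝ≥0∞) < chainTime (n + 1) x) :
    D.chainPath x t = D.ψ (t - (chainTime n x).toNNReal) (x n).1 := by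
  classical
  have h : ∃ n, (t : ℝ≥0∞) < chainTime (n + 1) x := ⟨n, h2⟩
  have hn : Nat.find h = n := by
    rw [Nat.find_eq_iff]
    refine ⟨h2, fun m hm hlt => ?_⟩
    exact absurd (hlt.trans_le (chainTime_mono x (Nat.succ_le_of_lt hm))) (not_lt.2 h1)
  rw [chainPath, dif_pos h]
  convert rfl <;> exact hn.symm

lemma exists_chainTime_le {x : ℕ → State d × ℝ≥0∞} {t : ℝ≥0}
    (h : ∃ n, (t : ℝ≥0∞) < chainTime (n + 1) x) :
    ∃ n, chainTime n x ≤ t ∧ (t : ℝ≥0∞) < chainTime (n + 1) x := by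
  classical
  refine ⟨Nat.find h, ?_, Nat.find_spec h⟩
  rcases hk : Nat.find h with - | m
  · simp [chainTime_zero]
  · exact not_lt.1 (Nat.find_min h (m := m) (by omega))

lemma chainPath_consSeq_of_lt {z : State d} {θ : ℝ≥0∞} {y : ℕ → State d × ℝ≥0∞} {t : ℝ≥0}
    (h : (t : ℝ≥0∞) < θ) : D.chainPath (consSeq (z, θ) y) t = D.ψ t z := by
  have := D.chainPath_eq (x := consSeq (z, θ) y) (t := t) (n := 0) (by simp [chainTime_zero])
    (by rw [chainTime_consSeq, chainTime_zero, add_zero]; exact h)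
  rw [this, chainTime_zero]
  simp [consSeq]

lemma chainPath_consSeq_of_le {z : State d} {θ : ℝ≥0} {y : ℕ → State d × ℝ≥0∞} {t : ℝ≥0}
    (h : θ ≤ t) : D.chainPath (consSeq (z, (θ : ℝ≥0∞)) y) t = D.chainPath y (t - θ) := by
  have hlt : ∀ n, (t : ℝ≥0∞) < chainTime (n + 1) (consSeq (z, (θ : ℝ≥0∞)) y)
      ↔ ((t - θ : ℝ≥0) : ℝ≥0∞) < chainTime n y := by
    intro n
    rw [chainTime_consSeq, ENNReal.coe_sub]
    exact (ENNReal.sub_lt_iff_lt_left ENNReal.coe_ne_top (by exact_mod_cast h)).symm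
  by_cases hex : ∃ n, ((t - θ : ℝ≥0) : ℝ≥0∞) < chainTime (n + 1) y
  · obtain ⟨n, h1, h2⟩ := exists_chainTime_le hex
    have h1' : chainTime (n + 1) (consSeq (z, (θ : ℝ≥0∞)) y) ≤ t :=
      not_lt.1 fun hc => absurd ((hlt n).1 hc) (not_lt.2 h1)
    rw [D.chainPath_eq h1 h2, D.chainPath_eq h1' ((hlt (n + 1)).2 h2), chainTime_consSeq]
    have hfin : chainTime n y ≠ ⊤ := ne_top_of_le_ne_top ENNReal.coe_ne_top h1
    simp only [consSeq]
    rw [ENNReal.toNNReal_add ENNReal.coe_ne_top hfin, ENNReal.toNNReal_coe, tsub_add_eq_tsub_tsub]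
  -- Here both chains have exploded by the time in question, and both paths take the same default
  -- value.
  · have hex' : ¬ ∃ n, (t : ℝ≥0∞) < chainTime (n + 1) (consSeq (z, (θ : ℝ≥0∞)) y) := by
      rintro ⟨n, hn⟩
      exact hex ⟨n, ((hlt n).1 hn).trans_le (chainTime_mono y n.le_succ)⟩
    rw [chainPath, dif_neg hex', chainPath, dif_neg hex]

lemma measurable_chainPath (t : ℝ≥0) : Measurable fun x => D.chainPath x t := by
  classical
  have hU : MeasurableSet {x : ℕ → State d × ℝ≥0∞ | ∃ n, (t : ℝ≥0∞) < chainTime (n + 1) x} := by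
    simp only [Set.ofPred_exists]
    exact .iUnion fun n => measurableSet_lt measurable_const (measurable_chainTime _)
  refine measurable_of_restrict_of_restrict_compl hU ?_ ?_
  · have : {x : ℕ → State d × ℝ≥0∞ | ∃ n, (t : ℝ≥0∞) < chainTime (n + 1) x}.domRestrict
        (fun x => D.chainPath x t) = fun x => (fun n (x : {x : ℕ → State d × ℝ≥0∞ |
          ∃ n, (t : ℝ≥0∞) < chainTime (n + 1) x}) =>
          D.ψ (t - (chainTime n x.1).toNNReal) (x.1 n).1) (Nat.find x.2) x := by
      funext x
      exact dif_pos x.2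
    rw [this]
    refine Measurable.find (f := fun n (x : {x : ℕ → State d × ℝ≥0∞ |
          ∃ n, (t : ℝ≥0∞) < chainTime (n + 1) x}) =>
          D.ψ (t - (chainTime n x.1).toNNReal) (x.1 n).1) (p := fun n (x : {x : ℕ → State d × ℝ≥0∞ |
          ∃ n, (t : ℝ≥0∞) < chainTime (n + 1) x}) => (t : ℝ≥0∞) < chainTime (n + 1) x.1)
          (fun n => ?_) (fun n => ?_) (fun x => x.2)
    · have h1 : Measurable fun x : ℕ → State d × ℝ≥0∞ =>
          D.ψ (t - (chainTime n x).toNNReal) (x n).1 := by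
        refine D.measurable_ψ.comp (Measurable.prodMk ?_ ?_)
        · exact measurable_const.sub (measurable_chainTime n).ennreal_toNNReal
        · exact measurable_fst.comp (measurable_pi_apply n)
      exact h1.comp measurable_subtype_coe
    · exact measurableSet_lt measurable_const
        ((measurable_chainTime _).comp measurable_subtype_coe)
  · have : {x : ℕ → State d × ℝ≥0∞ | ∃ n, (t : ℝ≥0∞) < chainTime (n + 1) x}ᶜ.domRestrict
        (fun x => D.chainPath x t) = fun _ => 0 := by
      funext x
      exact dif_neg x.2
    rw [this]
    exact measurable_const

lemma measurable_chainPath' : Measurable D.chainPath :=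
  measurable_pi_lambda _ D.measurable_chainPath

/-- The law of the path of the process started from `z`. -/
def pathLaw : Kernel (State d) (ℝ≥0 → State d) := D.skeletonLaw.map D.chainPath

end PDMP

/-! ### The Markov property of the skeleton path at a fixed time -/

/-- The path `z` seen from time `t` on. -/
def shiftPath {E : Type*} (t : ℝ≥0) (z : ℝ≥0 → E) : ℝ≥0 → E := fun s => z (t + s)

lemma measurable_shiftPath {E : Type*} [MeasurableSpace E] (t : ℝ≥0) :
    Measurable (shiftPath (E := E) t) :=
  measurable_pi_lambda _ fun _ => measurable_pi_apply _

lemma measurableSet_forall_mem {Ω E : Type*} [MeasurableSpace Ω] [MeasurableSpace E]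
    {Y : ℝ≥0 → Ω → E} (hY : ∀ t, Measurable (Y t)) {F : Set E} (hF : MeasurableSet F)
    {I : Set ℝ≥0} (hI : I.Countable) : MeasurableSet {ω | ∀ s ∈ I, Y s ω ∈ F} := by
  have : {ω | ∀ s ∈ I, Y s ω ∈ F} = ⋂ s ∈ I, Y s ⁻¹' F := by
    ext
    simp
  rw [this]
  exact .biInter hI fun s _ => hY s hF

namespace PDMP

variable {d : ℕ} (D : PDMP d)

lemma pathLaw_apply (z : State d) {B : Set (ℝ≥0 → State d)} (hB : MeasurableSet B) :
    D.pathLaw z B = ∫⁻ x, B.indicator 1 (D.chainPath x) ∂D.skeletonLaw z := by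
  rw [pathLaw, Kernel.map_apply' _ D.measurable_chainPath' _ hB,
    ← lintegral_indicator_one (D.measurable_chainPath' hB)]
  rfl

/-- The skeleton chains with exactly `n` jumps up to time `t`, whose path is in `F` at all times
in `I`. -/
def chainEvent (F : Set (State d)) (n : ℕ) (t : ℝ≥0) (I : Set ℝ≥0) :
    Set (ℕ → State d × ℝ≥0∞) :=
  {x | chainTime n x ≤ t ∧ (t : ℝ≥0∞) < chainTime (n + 1) x ∧ ∀ s ∈ I, D.chainPath x s ∈ F}

lemma measurableSet_chainEvent {F : Set (State d)} (hF : MeasurableSet F) (n : ℕ) (t : ℝ≥0)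
    {I : Set ℝ≥0} (hI : I.Countable) : MeasurableSet (D.chainEvent F n t I) :=
  (measurableSet_le (measurable_chainTime n) measurable_const).inter
    ((measurableSet_lt measurable_const (measurable_chainTime _)).inter
      (measurableSet_forall_mem (Y := fun t x => D.chainPath x t) D.measurable_chainPath hF hI))

/-- If the first jump comes after `t`, the path from `t` on starts at `ψ t z` with remaining holding
time `θ - t`. For `θ = ⊤` the two post-jump kernels differ, but both integrands are constant since
no jump occurs. -/
lemma lintegral_flow_shift (z : State d) {t : ℝ≥0} {θ : ℝ≥0∞} (h : (t : ℝ≥0∞) < θ)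
    (g : (ℝ≥0 → State d) → ℝ≥0∞) :
    ∫⁻ z', ∫⁻ y, g (shiftPath t (D.chainPath (consSeq (z, θ) y))) ∂D.skeletonLaw z'
        ∂D.postJump (z, θ)
      = ∫⁻ z', ∫⁻ y, g (D.chainPath (consSeq (D.ψ t z, θ - t) y)) ∂D.skeletonLaw z'
        ∂D.postJump (D.ψ t z, θ - t) := by
  by_cases hθ : θ = ⊤
  · subst hθ
    have h1 : ∀ y, shiftPath t (D.chainPath (consSeq (z, ⊤) y)) = fun s => D.ψ s (D.ψ t z) := by
      intro y
      funext s
      rw [shiftPath, chainPath_consSeq_of_lt _ (by simp), D.ψ_add]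
    have h2 : ∀ y, D.chainPath (consSeq (D.ψ t z, ⊤ - t) y) = fun s => D.ψ s (D.ψ t z) := by
      intro y
      funext s
      rw [chainPath_consSeq_of_lt _ (by simp)]
    simp_rw [h1, h2]
    simp
  · rw [postJump_flow D z h hθ]
    lift θ to ℝ≥0 using hθ
    have h' : t < θ := by exact_mod_cast h
    refine lintegral_congr fun z' => lintegral_congr fun y => ?_
    congr 1
    funext s
    rw [← ENNReal.coe_sub, shiftPath]
    by_cases hs : t + s < θ
    · rw [chainPath_consSeq_of_lt _ (by exact_mod_cast hs),
        chainPath_consSeq_of_lt _ (by exact_mod_cast lt_tsub_iff_left.2 hs), D.ψ_add]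
    · rw [chainPath_consSeq_of_le _ (not_lt.1 hs),
        chainPath_consSeq_of_le _ (tsub_le_iff_left.2 (not_lt.1 hs)),
        tsub_tsub_eq_add_tsub_of_le h'.le, add_comm]

/-- The Markov property at time `t` on the event that there are exactly `n` jumps up to time `t`. -/
theorem skeletonLaw_chainEvent_inter {F : Set (State d)} (hF : MeasurableSet F)
    {B : Set (ℝ≥0 → State d)} (hB : MeasurableSet B) (n : ℕ) (t : ℝ≥0) {I : Set ℝ≥0}
    (hI : I.Countable) (hIt : ∀ s ∈ I, s ≤ t) (z : State d) :
    D.skeletonLaw z (D.chainEvent F n t I ∩ {x | shiftPath t (D.chainPath x) ∈ B})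
      = ∫⁻ x in D.chainEvent F n t I, D.pathLaw (D.chainPath x t) B ∂D.skeletonLaw z := by
  have hshift : ∀ t, Measurable fun x => shiftPath t (D.chainPath x) := fun t =>
    (measurable_shiftPath t).comp D.measurable_chainPath'
  have hBi : Measurable (B.indicator (1 : (ℝ≥0 → State d) → ℝ≥0∞)) :=
    measurable_one.indicator hB
  have hG1 : ∀ n t (I : Set ℝ≥0), I.Countable → Measurable ((D.chainEvent F n t I).indicator
      fun x => B.indicator (1 : (ℝ≥0 → State d) → ℝ≥0∞) (shiftPath t (D.chainPath x))) :=
    fun n t I hI => (hBi.comp (hshift t)).indicator (D.measurableSet_chainEvent hF n t hI)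
  have hG2 : ∀ n t (I : Set ℝ≥0), I.Countable → Measurable ((D.chainEvent F n t I).indicator
      fun x => D.pathLaw (D.chainPath x t) B) := fun n t I hI =>
    ((D.pathLaw.measurable_coe hB).comp (D.measurable_chainPath t)).indicator
      (D.measurableSet_chainEvent hF n t hI)
  suffices h : ∫⁻ x, (D.chainEvent F n t I).indicator
      (fun x => B.indicator 1 (shiftPath t (D.chainPath x))) x ∂D.skeletonLaw z
      = ∫⁻ x, (D.chainEvent F n t I).indicator
        (fun x => D.pathLaw (D.chainPath x t) B) x ∂D.skeletonLaw z by
    rw [lintegral_indicator (D.measurableSet_chainEvent hF n t hI)] at h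
    rw [lintegral_indicator (D.measurableSet_chainEvent hF n t hI)] at h
    have hs : MeasurableSet {x | shiftPath t (D.chainPath x) ∈ B} := hshift t hB
    rw [← h, Set.inter_comm, ← Measure.restrict_apply hs, ← lintegral_indicator_one hs]
    rfl
  -- Induction on the number of jumps up to `t`. The time, the set of tested times and the starting
  -- point all change when the first jump is removed.
  induction n generalizing t I z with
  | zero =>
    rw [lintegral_skeletonLaw D z (hG1 0 t I hI), lintegral_skeletonLaw D z (hG2 0 t I hI)]
    have hmem : ∀ θ y, consSeq (z, θ) y ∈ D.chainEvent F 0 t I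
        ↔ (t : ℝ≥0∞) < θ ∧ ∀ s ∈ I, D.ψ s z ∈ F := by
      intro θ y
      simp only [chainEvent, Set.mem_ofPred_eq, chainTime_zero, chainTime_consSeq, add_zero,
        zero_le, true_and]
      refine and_congr_right fun h => forall₂_congr fun s hs => ?_
      rw [chainPath_consSeq_of_lt _ (lt_of_le_of_lt (by exact_mod_cast hIt s hs) h)]
    -- Without a jump up to `t` the constraint at the times in `I` is deterministic, and only the
    -- event `t < θ` remains random. The claim is then memorylessness at time `t`.
    by_cases hb : ∀ s ∈ I, D.ψ s z ∈ F
    · set H : State d × ℝ≥0∞ → ℝ≥0∞ := fun s => ∫⁻ z', ∫⁻ y,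
        B.indicator 1 (D.chainPath (consSeq s y)) ∂D.skeletonLaw z' ∂D.postJump s with hH
      have hHm : Measurable H :=
        D.measurable_lintegral_consSeq (hBi.comp D.measurable_chainPath')
      have hL : ∀ θ, ∫⁻ z', ∫⁻ y, (D.chainEvent F 0 t I).indicator
          (fun x => B.indicator 1 (shiftPath t (D.chainPath x))) (consSeq (z, θ) y)
            ∂D.skeletonLaw z' ∂D.postJump (z, θ)
          = (Set.Ioi (t : ℝ≥0∞)).indicator (fun θ => H (D.ψ t z, θ - t)) θ := by
        intro θ
        by_cases hθ : (t : ℝ≥0∞) < θ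
        · rw [Set.indicator_of_mem (show θ ∈ Set.Ioi (t : ℝ≥0∞) from hθ)]
          refine Eq.trans ?_ (lintegral_flow_shift D z hθ _)
          refine lintegral_congr fun z' => lintegral_congr fun y => ?_
          rw [Set.indicator_of_mem ((hmem θ y).2 ⟨hθ, hb⟩)]
        · rw [Set.indicator_of_notMem (show θ ∉ Set.Ioi (t : ℝ≥0∞) from hθ)]
          have : ∀ y, consSeq (z, θ) y ∉ D.chainEvent F 0 t I := fun y h => hθ ((hmem θ y).1 h).1
          simp [this]
      have hR : ∀ θ, ∫⁻ z', ∫⁻ y, (D.chainEvent F 0 t I).indicator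
          (fun x => D.pathLaw (D.chainPath x t) B) (consSeq (z, θ) y)
            ∂D.skeletonLaw z' ∂D.postJump (z, θ)
          = (Set.Ioi (t : ℝ≥0∞)).indicator (fun θ => D.pathLaw (D.ψ t z) B) θ := by
        intro θ
        by_cases hθ : (t : ℝ≥0∞) < θ
        · rw [Set.indicator_of_mem (show θ ∈ Set.Ioi (t : ℝ≥0∞) from hθ)]
          simp [Set.indicator_of_mem ((hmem θ _).2 ⟨hθ, hb⟩), chainPath_consSeq_of_lt _ hθ]
        · rw [Set.indicator_of_notMem (show θ ∉ Set.Ioi (t : ℝ≥0∞) from hθ)]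
          have : ∀ y, consSeq (z, θ) y ∉ D.chainEvent F 0 t I := fun y h => hθ ((hmem θ y).1 h).1
          simp [this]
      simp_rw [hL, hR]
      rw [lintegral_indicator measurableSet_Ioi, lintegral_indicator measurableSet_Ioi,
        lintegral_hold_memoryless D z t (g := fun θ => H (D.ψ t z, θ))
          (hHm.comp measurable_prodMk_left), pathLaw_apply D _ hB,
        lintegral_skeletonLaw D _ (g := fun x => B.indicator 1 (D.chainPath x))
          (hBi.comp D.measurable_chainPath'), setLIntegral_const, mul_comm]
    · have : ∀ θ y, consSeq (z, θ) y ∉ D.chainEvent F 0 t I := fun θ y h => hb ((hmem θ y).1 h).2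
      simp [this]
  | succ n ih =>
    rw [lintegral_skeletonLaw D z (hG1 (n + 1) t I hI),
      lintegral_skeletonLaw D z (hG2 (n + 1) t I hI)]
    refine lintegral_congr fun θ => lintegral_congr fun z' => ?_
    -- Either the first jump occurs at some `r ≤ t` and the flow line meets the constraint before
    -- it, in which case the event is one for the tail, with `n` jumps up to `t - r` and the times
    -- of `I` shifted by `r`; or the event is empty.
    by_cases h : ∃ θ' : ℝ≥0, θ = θ' ∧ θ' ≤ t ∧ ∀ s ∈ I, s < θ' → D.ψ s z ∈ F
    · obtain ⟨r, rfl, hrt, hr⟩ := h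
      set I' : Set ℝ≥0 := (fun u => u + r) ⁻¹' I with hI'
      have hI'c : I'.Countable := hI.preimage (add_left_injective r)
      have hI't : ∀ s ∈ I', s ≤ t - r := fun s hs => le_tsub_of_add_le_right (hIt _ hs)
      have hmem : ∀ y, consSeq (z, (r : ℝ≥0∞)) y ∈ D.chainEvent F (n + 1) t I
          ↔ y ∈ D.chainEvent F n (t - r) I' := by
        intro y
        have hrt' : (r : ℝ≥0∞) ≤ t := by exact_mod_cast hrt
        simp only [chainEvent, Set.mem_ofPred_eq, chainTime_consSeq, ENNReal.coe_sub]
        refine and_congr ?_ (and_congr ?_ ?_)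
        · rw [add_comm]
          exact (ENNReal.le_sub_iff_add_le_right ENNReal.coe_ne_top hrt').symm
        · exact (ENNReal.sub_lt_iff_lt_left ENNReal.coe_ne_top hrt').symm
        · constructor
          · intro hs u hu
            have := hs (u + r) hu
            rwa [chainPath_consSeq_of_le _ le_add_self, add_tsub_cancel_right] at this
          · intro hu s hs
            by_cases hsr : s < r
            · rw [chainPath_consSeq_of_lt _ (by exact_mod_cast hsr)]
              exact hr s hs hsr
            · rw [chainPath_consSeq_of_le _ (not_lt.1 hsr)]
              refine hu _ ?_
              rw [hI', Set.mem_preimage, tsub_add_cancel_of_le (not_lt.1 hsr)]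
              exact hs
      have hsh : ∀ y, shiftPath t (D.chainPath (consSeq (z, (r : ℝ≥0∞)) y))
          = shiftPath (t - r) (D.chainPath y) := by
        intro y
        funext s
        rw [shiftPath, chainPath_consSeq_of_le _ (hrt.trans le_self_add), shiftPath,
          tsub_add_eq_add_tsub hrt]
      have h1 : ∀ y, (D.chainEvent F (n + 1) t I).indicator
          (fun x => B.indicator (1 : (ℝ≥0 → State d) → ℝ≥0∞) (shiftPath t (D.chainPath x)))
            (consSeq (z, (r : ℝ≥0∞)) y)
          = (D.chainEvent F n (t - r) I').indicator
            (fun x => B.indicator 1 (shiftPath (t - r) (D.chainPath x))) y := by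
        intro y
        by_cases hy : y ∈ D.chainEvent F n (t - r) I'
        · rw [Set.indicator_of_mem hy, Set.indicator_of_mem ((hmem y).2 hy), hsh]
        · rw [Set.indicator_of_notMem hy, Set.indicator_of_notMem fun h => hy ((hmem y).1 h)]
      have h2 : ∀ y, (D.chainEvent F (n + 1) t I).indicator
          (fun x => D.pathLaw (D.chainPath x t) B) (consSeq (z, (r : ℝ≥0∞)) y)
          = (D.chainEvent F n (t - r) I').indicator
            (fun x => D.pathLaw (D.chainPath x (t - r)) B) y := by
        intro y
        by_cases hy : y ∈ D.chainEvent F n (t - r) I'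
        · rw [Set.indicator_of_mem hy, Set.indicator_of_mem ((hmem y).2 hy),
            chainPath_consSeq_of_le _ hrt]
        · rw [Set.indicator_of_notMem hy, Set.indicator_of_notMem fun h => hy ((hmem y).1 h)]
      simp_rw [h1, h2]
      exact ih (t - r) hI'c hI't z'
    · have : ∀ y, consSeq (z, θ) y ∉ D.chainEvent F (n + 1) t I := by
        intro y hy
        obtain ⟨h1, h2, h3⟩ := hy
        rw [chainTime_consSeq] at h1
        have hθ : θ ≤ t := le_self_add.trans h1
        lift θ to ℝ≥0 using ne_top_of_le_ne_top ENNReal.coe_ne_top hθ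
        refine h ⟨θ, rfl, by exact_mod_cast hθ, fun s hs hsθ => ?_⟩
        have := h3 s hs
        rwa [chainPath_consSeq_of_lt _ (by exact_mod_cast hsθ)] at this
      simp [this]

end PDMP

/-! ### Exit times of regular paths through countably many closed conditions -/

section RegularPath

variable {E : Type*} [MetricSpace E]

/-- The points of `W` whose distance to the complement of `W` is at least `1 / (k + 1)`. -/
def innerSet (W : Set E) (k : ℕ) : Set E := {x | ((k : ℝ≥0∞) + 1)⁻¹ ≤ Metric.infEDist x Wᶜ}

lemma isClosed_innerSet (W : Set E) (k : ℕ) : IsClosed (innerSet W k) :=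
  isClosed_le continuous_const Metric.continuous_infEDist

lemma innerSet_subset (W : Set E) (k : ℕ) : innerSet W k ⊆ W := by
  intro x hx
  by_contra h
  rw [innerSet, Set.mem_ofPred_eq, Metric.infEDist_zero_of_mem h, nonpos_iff_eq_zero,
    ENNReal.inv_eq_zero] at hx
  exact ENNReal.add_ne_top.2 ⟨ENNReal.natCast_ne_top k, ENNReal.one_ne_top⟩ hx

lemma innerSet_mono (W : Set E) : Monotone (innerSet W) := by
  intro k l h x hx
  refine le_trans (ENNReal.inv_le_inv.2 ?_) hx
  gcongr

/-- The distance to the closed set `Wᶜ` attains a positive minimum on a nonempty compact subset of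
`W`. Being extended valued, it needs no separate treatment of an empty complement. -/
lemma exists_subset_innerSet {W K : Set E} (hW : IsOpen W) (hK : IsCompact K) (h : K ⊆ W) :
    ∃ k, K ⊆ innerSet W k := by
  rcases K.eq_empty_or_nonempty with rfl | hne
  · exact ⟨0, Set.empty_subset _⟩
  obtain ⟨x, hx, hmin⟩ :=
    hK.exists_isMinOn hne (Metric.continuous_infEDist (s := Wᶜ)).continuousOn
  have hpos : Metric.infEDist x Wᶜ ≠ 0 := by
    intro h0
    have := Metric.mem_closure_iff_infEDist_zero.2 h0
    rw [hW.isClosed_compl.closure_eq] at this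
    exact this (h hx)
  obtain ⟨k, hk⟩ := ENNReal.exists_inv_nat_lt hpos
  refine ⟨k, fun y hy => ?_⟩
  exact ((ENNReal.inv_le_inv.2 le_self_add).trans hk.le).trans (hmin hy)

/-- A right continuous path which does not approach the boundary of `W` before it leaves `W`. -/
structure IsRegularPath (W : Set E) (z : ℝ≥0 → E) : Prop where
  right_continuous : ∀ t, ContinuousWithinAt z (Set.Ici t) t
  margin : ∀ t, (∀ s ≤ t, z s ∈ W) → ∃ k, ∀ s ≤ t, z s ∈ innerSet W k

lemma IsRegularPath.of_continuous {W : Set E} (hW : IsOpen W) {z : ℝ≥0 → E} (hz : Continuous z) :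
    IsRegularPath W z where
  right_continuous t := hz.continuousWithinAt
  margin t ht := by
    obtain ⟨k, hk⟩ := exists_subset_innerSet hW
      ((isCompact_Icc (a := (0 : ℝ≥0)) (b := t)).image hz)
      (by rintro _ ⟨s, hs, rfl⟩; exact ht s hs.2)
    exact ⟨k, fun s hs => hk ⟨s, ⟨zero_le, hs⟩, rfl⟩⟩

lemma mem_of_lt_exitTime {E : Type*} {W : Set E} {z : ℝ≥0 → E} {t : ℝ≥0}
    (h : (t : ℝ≥0∞) < exitTime W z) : z t ∈ W := by
  by_contra hc
  exact absurd h (not_lt.2 (iInf₂_le t hc))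

/-- A right continuous path which is in the open set `W` at time `t` stays there for a short while,
which makes the inequality strict. -/
lemma lt_exitTime_iff {W : Set E} (hW : IsOpen W) {z : ℝ≥0 → E}
    (hz : ∀ t, ContinuousWithinAt z (Set.Ici t) t) (t : ℝ≥0) :
    (t : ℝ≥0∞) < exitTime W z ↔ ∀ s ≤ t, z s ∈ W := by
  constructor
  · intro h s hs
    exact mem_of_lt_exitTime (lt_of_le_of_lt (by exact_mod_cast hs) h)
  · intro h
    have h1 : ∀ᶠ s in 𝓝[≥] t, z s ∈ W := hz t (hW.mem_nhds (h t le_rfl))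
    obtain ⟨u, hu, hsub⟩ := (mem_nhdsGE_iff_exists_Ico_subset' (a := t) (u' := t + 1)
      (lt_add_of_pos_right t one_pos)).1 h1
    refine lt_of_lt_of_le (ENNReal.coe_lt_coe.2 (show t < u from hu)) (le_iInf₂ fun s hs => ?_)
    by_contra! hlt
    have hsu : s < u := by exact_mod_cast hlt
    rcases le_total s t with hst | hst
    · exact hs (h s hst)
    · exact hs (hsub ⟨hst, hsu⟩)

/-- A countable dense set of times in `[0, t]`, which contains `t`. -/
def timeGrid (t : ℝ≥0) : Set ℝ≥0 := insert t (Set.range (fun q : ℚ => (q : ℝ).toNNReal) ∩ Set.Iic t)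

lemma countable_timeGrid (t : ℝ≥0) : (timeGrid t).Countable :=
  ((Set.countable_range _).mono Set.inter_subset_left).insert _

lemma le_of_mem_timeGrid {t s : ℝ≥0} (h : s ∈ timeGrid t) : s ≤ t := by
  rcases h with rfl | ⟨-, h⟩
  · exact le_rfl
  · exact h

/-- Every `s < t` is a limit of grid times from the right, and `F` is closed. The endpoint `t` has
no grid times to its right, which is why the grid contains it. -/
lemma forall_mem_of_timeGrid {F : Set E} (hF : IsClosed F) {z : ℝ≥0 → E}
    (hz : ∀ t, ContinuousWithinAt z (Set.Ici t) t) {t : ℝ≥0} (h : ∀ s ∈ timeGrid t, z s ∈ F) :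
    ∀ s ≤ t, z s ∈ F := by
  intro s hs
  rcases hs.eq_or_lt with rfl | hlt
  · exact h s (Set.mem_insert _ _)
  have hcl : s ∈ closure (timeGrid t ∩ Set.Ici s) := by
    rw [Metric.mem_closure_iff]
    intro ε hε
    have hst : (s : ℝ) < min (t : ℝ) (s + ε) := lt_min (by exact_mod_cast hlt) (by linarith)
    obtain ⟨q, hq1, hq2⟩ := exists_rat_btwn hst
    have hq0 : (0 : ℝ) ≤ q := (NNReal.coe_nonneg s).trans hq1.le
    refine ⟨(q : ℝ).toNNReal, ⟨Or.inr ⟨⟨q, rfl⟩, ?_⟩, ?_⟩, ?_⟩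
    · exact Real.toNNReal_le_iff_le_coe.2 (hq2.le.trans (min_le_left _ _))
    · exact (Real.le_toNNReal_iff_coe_le hq0).2 hq1.le
    · rw [NNReal.dist_eq, Real.coe_toNNReal _ hq0, abs_sub_comm, abs_of_nonneg (by linarith)]
      linarith [hq2.trans_le (min_le_right _ _)]
  have hc : ContinuousWithinAt z (timeGrid t ∩ Set.Ici s) s := (hz s).mono Set.inter_subset_right
  have := hc.mem_closure_image hcl
  refine hF.closure_subset_iff.2 ?_ this
  rintro _ ⟨u, hu, rfl⟩
  exact h u hu.1

/-- Testing membership in the open set `W` at grid times would not control the times in between.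
Closed inner sets do, and the margin of a regular path provides one of them. -/
lemma IsRegularPath.lt_exitTime_iff {W : Set E} (hW : IsOpen W) {z : ℝ≥0 → E}
    (hz : IsRegularPath W z) (t : ℝ≥0) :
    (t : ℝ≥0∞) < exitTime W z ↔ ∃ k, ∀ s ∈ timeGrid t, z s ∈ innerSet W k := by
  rw [_root_.lt_exitTime_iff hW hz.right_continuous]
  constructor
  · intro h
    obtain ⟨k, hk⟩ := hz.margin t h
    exact ⟨k, fun s hs => hk s (le_of_mem_timeGrid hs)⟩
  · rintro ⟨k, hk⟩ s hs
    exact innerSet_subset W k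
      (forall_mem_of_timeGrid (isClosed_innerSet W k) hz.right_continuous hk s hs)

lemma measurable_exitTime {Ω : Type*} [MeasurableSpace Ω] [MeasurableSpace E] [BorelSpace E]
    {W : Set E} (hW : IsOpen W) {Y : ℝ≥0 → Ω → E} (hY : ∀ t, Measurable (Y t))
    (hreg : ∀ ω, IsRegularPath W fun t => Y t ω) :
    Measurable fun ω => exitTime W fun t => Y t ω := by
  refine measurable_of_Ioi fun a => ?_
  induction a using ENNReal.recTopCoe with
  | top => simp
  | coe r =>
    have : (fun ω => exitTime W fun t => Y t ω) ⁻¹' Set.Ioi (r : ℝ≥0∞)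
        = ⋃ k, {ω | ∀ s ∈ timeGrid r, Y s ω ∈ innerSet W k} := by
      ext ω
      rw [Set.mem_iUnion]
      exact (hreg ω).lt_exitTime_iff hW r
    rw [this]
    exact .iUnion fun k =>
      measurableSet_forall_mem hY (isClosed_innerSet W k).measurableSet (countable_timeGrid r)

end RegularPath

/-! ### Almost sure regularity: no grazing of the boundary at a jump -/

namespace PDMP

variable {d : ℕ} (D : PDMP d)

lemma continuous_flow (z : State d) : Continuous fun t : ℝ≥0 => D.ψ t z := by
  rw [continuous_iff_continuousAt]
  intro t
  have h := (D.ψ_deriv z t).continuousWithinAt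
  have h2 : Tendsto (fun s : ℝ≥0 => (s : ℝ)) (𝓝 t) (𝓝[Set.Ici 0] (t : ℝ)) :=
    tendsto_nhdsWithin_iff.2 ⟨NNReal.continuous_coe.tendsto t,
      Eventually.of_forall fun s => NNReal.coe_nonneg s⟩
  have h3 := h.tendsto.comp h2
  simpa [ContinuousAt, Function.comp_def] using h3

lemma measurable_flow_exitTime {W : Set (State d)} (hW : IsOpen W) :
    Measurable fun z => exitTime W fun t => D.ψ t z :=
  measurable_exitTime hW (fun _ => D.measurable_ψ.comp measurable_prodMk_left)
    fun z => .of_continuous hW (D.continuous_flow z)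

/-- The states of the skeleton chain whose flow line hits the complement of `W` exactly at the
jump. -/
def grazing (W : Set (State d)) : Set (State d × ℝ≥0∞) :=
  {x | x.2 ≠ ⊤ ∧ x.2 = exitTime W fun t => D.ψ t x.1}

lemma measurableSet_grazing {W : Set (State d)} (hW : IsOpen W) :
    MeasurableSet (D.grazing W) := by
  refine .inter (measurableSet_noJump (d := d)).compl ?_
  exact measurableSet_eq_fun measurable_snd ((D.measurable_flow_exitTime hW).comp measurable_fst)

/-- For fixed `z` the exit time of the flow line is one number, and the holding time has no finite
atom. -/
lemma hold_grazing (W : Set (State d)) (z : State d) :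
    D.hold z (Prod.mk z ⁻¹' D.grazing W) = 0 := by
  by_cases h : exitTime W (fun t => D.ψ t z) = ⊤
  · have : Prod.mk z ⁻¹' D.grazing W = ∅ := by
      ext θ
      simp only [grazing, Set.mem_preimage, Set.mem_ofPred_eq, h, Set.mem_empty_iff_false]
      tauto
    rw [this, measure_empty]
  · lift exitTime W (fun t => D.ψ t z) to ℝ≥0 using h with r hr
    refine measure_mono_null ?_ (D.hold_singleton z r)
    rintro θ ⟨-, hθ⟩
    rw [Set.mem_singleton_iff, hr]
    exact hθ

/-- A skeleton chain without explosion and without grazing of the boundary of `W`. -/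
structure IsRegularChain (W : Set (State d)) (x : ℕ → State d × ℝ≥0∞) : Prop where
  no_explosion : ∀ t : ℝ≥0, ∃ n, (t : ℝ≥0∞) < chainTime (n + 1) x
  no_grazing : ∀ n, x n ∉ D.grazing W

/-- Right continuity comes from the flow on each interval between jumps. The margin is built by
induction over these intervals: on each of them the path runs along a compact piece of a flow line,
which lies in `W` including its right endpoint. Finitely many intervals cover `[0, t]`. -/
lemma IsRegularChain.isRegularPath {D : PDMP d} {W : Set (State d)} (hW : IsOpen W)
    {x : ℕ → State d × ℝ≥0∞} (h : D.IsRegularChain W x) : IsRegularPath W (D.chainPath x) where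
  right_continuous t := by
    obtain ⟨n, h1, h2⟩ := exists_chainTime_le (h.no_explosion t)
    have hc : Continuous fun s : ℝ≥0 => D.ψ (s - (chainTime n x).toNNReal) (x n).1 :=
      (D.continuous_flow _).comp (continuous_id.sub continuous_const)
    refine hc.continuousWithinAt.congr_of_eventuallyEq ?_ (D.chainPath_eq h1 h2)
    have h3 : ∀ᶠ s : ℝ≥0 in 𝓝 t, (s : ℝ≥0∞) < chainTime (n + 1) x :=
      ENNReal.continuous_coe.tendsto t (eventually_lt_nhds h2)
    filter_upwards [nhdsWithin_le_nhds h3, self_mem_nhdsWithin] with s hs hts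
    exact D.chainPath_eq (h1.trans (by exact_mod_cast hts)) hs
  margin t ht := by
    have key : ∀ n, ∃ k, ∀ s ≤ t, (s : ℝ≥0∞) < chainTime n x → D.chainPath x s ∈ innerSet W k := by
      intro n
      induction n with
      | zero => exact ⟨0, fun s _ hs => by simp [chainTime_zero] at hs⟩
      | succ n ih =>
        obtain ⟨k, hk⟩ := ih
        by_cases hn : chainTime n x ≤ t
        swap
        · exact ⟨k, fun s hs _ => hk s hs (lt_of_le_of_lt (by exact_mod_cast hs) (not_le.1 hn))⟩
        have hfin : chainTime n x ≠ ⊤ := ne_top_of_le_ne_top ENNReal.coe_ne_top hn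
        set T := (chainTime n x).toNNReal with hT
        have hTc : chainTime n x = T := (ENNReal.coe_toNNReal hfin).symm
        have hpath : ∀ u : ℝ≥0, (u : ℝ≥0∞) < (x n).2 →
            D.chainPath x (T + u) = D.ψ u (x n).1 := by
          intro u hu
          rw [D.chainPath_eq (n := n) (by rw [hTc]; exact_mod_cast le_self_add)
            (by rw [chainTime_succ, hTc, ENNReal.coe_add]
                exact ENNReal.add_lt_add_left ENNReal.coe_ne_top hu), ← hT, add_tsub_cancel_left]
        have hTt : T ≤ t := by rw [hTc] at hn; exact_mod_cast hn
        -- The case `u = θ_n` is the left limit at the jump, which the path itself need not visit.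
        -- If it were outside `W`, the flow line would leave `W` exactly at the jump, which is
        -- grazing.
        have hW' : ∀ u : ℝ≥0, u ≤ t - T → (u : ℝ≥0∞) ≤ (x n).2 → D.ψ u (x n).1 ∈ W := by
          intro u hut hu
          rcases hu.lt_or_eq with hlt | heq
          · rw [← hpath u hlt]
            exact ht _ (by rw [add_comm]; exact (le_tsub_iff_right hTt).1 hut)
          · by_contra hc
            refine h.no_grazing n ⟨by rw [← heq]; simp, le_antisymm ?_ ?_⟩
            · refine le_iInf₂ fun v hv => ?_
              by_contra! hvlt
              have hvu : v < u := by rw [← heq] at hvlt; exact_mod_cast hvlt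
              refine hv ?_
              change D.ψ v (x n).1 ∈ W
              rw [← hpath v hvlt]
              exact ht _ (by rw [add_comm]; exact (le_tsub_iff_right hTt).1 (hvu.le.trans hut))
            · rw [← heq]
              exact iInf₂_le u hc
        obtain ⟨l, hl⟩ := exists_subset_innerSet hW
          ((isCompact_Icc (a := (0 : ℝ≥0))
            (b := (min (x n).2 ((t - T : ℝ≥0) : ℝ≥0∞)).toNNReal)).image
            (D.continuous_flow (x n).1)) (by
              rintro _ ⟨u, hu, rfl⟩
              have hmin : (u : ℝ≥0∞) ≤ min (x n).2 ((t - T : ℝ≥0) : ℝ≥0∞) := by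
                rw [← ENNReal.coe_toNNReal (ne_top_of_le_ne_top ENNReal.coe_ne_top
                  (min_le_right (x n).2 ((t - T : ℝ≥0) : ℝ≥0∞)))]
                exact_mod_cast hu.2
              exact hW' u (by exact_mod_cast hmin.trans (min_le_right _ _))
                (hmin.trans (min_le_left _ _)))
        refine ⟨max k l, fun s hst hs => ?_⟩
        by_cases hsn : (s : ℝ≥0∞) < chainTime n x
        · exact innerSet_mono W (le_max_left k l) (hk s hst hsn)
        · rw [not_lt, hTc] at hsn
          have hTs : T ≤ s := by exact_mod_cast hsn
          obtain ⟨u, rfl⟩ := exists_add_of_le hTs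
          have hu : (u : ℝ≥0∞) < (x n).2 := by
            rw [chainTime_succ, hTc, ENNReal.coe_add] at hs
            exact lt_of_add_lt_add_left hs
          rw [hpath u hu]
          refine innerSet_mono W (le_max_right k l) (hl ⟨u, ⟨zero_le, ?_⟩, rfl⟩)
          rw [← ENNReal.coe_le_coe, ENNReal.coe_toNNReal (ne_top_of_le_ne_top ENNReal.coe_ne_top
                  (min_le_right (x n).2 ((t - T : ℝ≥0) : ℝ≥0∞)))]
          refine le_min hu.le ?_
          exact_mod_cast le_tsub_of_add_le_left hst
    obtain ⟨n, hn⟩ := h.no_explosion t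
    obtain ⟨k, hk⟩ := key (n + 1)
    exact ⟨k, fun s hs => hk s hs (lt_of_le_of_lt (by exact_mod_cast hs) hn)⟩

end PDMP

/-! ### Uniqueness in law and the Markov property of realizations -/

namespace PDMP

variable {d : ℕ} {D : PDMP d} {Ω : Type*} [MeasurableSpace Ω] {P : Measure Ω}
  {X : ℕ → Ω → State d × ℝ≥0∞} {Z : ℝ≥0 → Ω → State d} {W : Set (State d)}

lemma IsSkeletonChain.measurable_seq (hX : D.IsSkeletonChain P X) :
    Measurable fun ω n => X n ω := measurable_pi_lambda _ hX.measurable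

lemma IsRealization.measurable_path (hZ : D.IsRealization P Z) : Measurable fun ω t => Z t ω :=
  measurable_pi_lambda _ hZ.1

variable [IsProbabilityMeasure P]

/-- The law of the skeleton chain is determined by the law of its initial position. -/
theorem IsSkeletonChain.map_eq (hX : D.IsSkeletonChain P X) :
    P.map (fun ω n => X n ω) = (P.map fun ω => (X 0 ω).1).bind D.skeletonLaw := by
  have h0 : Measurable fun ω => (X 0 ω).1 := measurable_fst.comp (hX.measurable 0)
  have : IsProbabilityMeasure (P.map fun ω => (X 0 ω).1) :=
    Measure.isProbabilityMeasure_map h0.aemeasurable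
  have : IsProbabilityMeasure (P.map fun ω n => X n ω) :=
    Measure.isProbabilityMeasure_map hX.measurable_seq.aemeasurable
  refine (isMarkovChainLaw_map hX.measurable hX.transition).unique
    (IsMarkovChainLaw.bind _ _ fun z => ?_) ?_
  · unfold skeletonLaw
    rw [Kernel.comp_apply]
    exact IsMarkovChainLaw.bind _ _ (isMarkovChainLaw_markovChain D.step)
  · have hz : Measurable fun x : ℕ → State d × ℝ≥0∞ => x 0 := measurable_pi_apply 0
    rw [Measure.map_map hz hX.measurable_seq]
    refine hX.initial.trans (Measure.ext_of_lintegral _ fun g hg => ?_)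
    rw [Measure.lintegral_compProd hg, lintegral_map hg hz,
      Measure.lintegral_bind (f := fun x => g (x 0)) D.skeletonLaw.aemeasurable
        (show Measurable fun x : ℕ → State d × ℝ≥0∞ => g (x 0) from hg.comp hz).aemeasurable]
    refine lintegral_congr fun z => ?_
    rw [lintegral_skeletonLaw_eq D z
      (show Measurable fun x : ℕ → State d × ℝ≥0∞ => g (x 0) from hg.comp hz)]
    refine lintegral_congr fun θ => ?_
    have := lintegral_map (μ := markovChain D.step (z, θ)) hg hz
    rw [markovChain_map_zero, lintegral_dirac' _ hg] at this
    exact this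

/-- Both the initial law and every transition end with drawing the holding time from `hold` at the
current position, so a set with null sections is never hit. -/
lemma IsSkeletonChain.ae_notMem (hX : D.IsSkeletonChain P X) {A : Set (State d × ℝ≥0∞)}
    (hA : MeasurableSet A) (h : ∀ z, D.hold z (Prod.mk z ⁻¹' A) = 0) :
    ∀ᵐ ω ∂P, ∀ n, X n ω ∉ A := by
  have hAi : Measurable (A.indicator (1 : State d × ℝ≥0∞ → ℝ≥0∞)) := measurable_one.indicator hA
  have hz : ∀ z, ∫⁻ θ, A.indicator 1 (z, θ) ∂D.hold z = 0 := by
    intro z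
    rw [← h z, ← lintegral_indicator_one (measurable_prodMk_left hA)]
    rfl
  rw [ae_all_iff]
  intro n
  have key : ∫⁻ ω, A.indicator 1 (X n ω) ∂P = 0 := by
    cases n with
    | zero =>
      have := lintegral_map (μ := P) hAi (hX.measurable 0)
      rw [← this, hX.initial, Measure.lintegral_compProd hAi]
      simp [hz]
    | succ n =>
      have hm : Measurable fun ω => ((fun i : Finset.Iic n => X i ω), X (n + 1) ω) := by
        have := hX.measurable
        fun_prop
      have := lintegral_map (μ := P) (hAi.comp measurable_snd) hm
      refine this.symm.trans ?_
      rw [hX.transition n, Measure.lintegral_compProd (hAi.comp measurable_snd)]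
      refine (lintegral_congr fun y => ?_).trans lintegral_zero
      refine (Kernel.lintegral_compProd D.postJump (Kernel.prodMkLeft _ D.hold) _ hAi).trans ?_
      refine (lintegral_congr fun z' => ?_).trans lintegral_zero
      exact hz z'
  rw [lintegral_eq_zero_iff (show Measurable fun ω =>
    A.indicator (1 : State d × ℝ≥0∞ → ℝ≥0∞) (X n ω) from hAi.comp (hX.measurable n))] at key
  filter_upwards [key] with ω hω hmem
  simp [Set.indicator_of_mem hmem] at hω

lemma IsRealization.exists_chain (hZ : D.IsRealization P Z) (hW : IsOpen W) :
    ∃ X, D.IsSkeletonChain P X ∧ (fun ω => (X 0 ω).1) =ᵐ[P] Z 0 ∧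
      ∀ᵐ ω ∂P, D.IsRegularChain W (fun n => X n ω) ∧
        (fun t => Z t ω) = D.chainPath fun n => X n ω := by
  obtain ⟨-, X, hX, hT, hpath⟩ := hZ
  -- If `θ_0` were `0`, the path at time zero would already have jumped away from `ξ_0`. Positive
  -- holding times identify `Z 0` with `ξ_0`.
  have hpos : ∀ᵐ ω ∂P, ∀ n, X n ω ∉ {x : State d × ℝ≥0∞ | x.2 = ((0 : ℝ≥0) : ℝ≥0∞)} :=
    hX.ae_notMem (measurable_snd (measurableSet_singleton _)) fun z => D.hold_singleton z 0
  have hgr := hX.ae_notMem (D.measurableSet_grazing hW) (D.hold_grazing W)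
  have hreg : ∀ᵐ ω ∂P, D.IsRegularChain W (fun n => X n ω) := by
    filter_upwards [hT, hgr] with ω h1 h2
    refine ⟨fun t => ?_, h2⟩
    have h3 := (tendsto_add_atTop_iff_nat 1).2 h1
    exact (h3.eventually (eventually_gt_nhds ENNReal.coe_lt_top)).exists
  refine ⟨X, hX, ?_, ?_⟩
  · filter_upwards [hpath, hpos] with ω h1 h2
    have h3 := h1 0 0 (by simp [jumpTime]) (by
      simp only [jumpTime, zero_add, Finset.sum_range_one]
      exact pos_iff_ne_zero.2 (h2 0))
    rw [h3]
    simp [D.ψ_zero]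
  · filter_upwards [hpath, hreg] with ω h1 h2
    refine ⟨h2, ?_⟩
    funext t
    obtain ⟨n, h3, h4⟩ := exists_chainTime_le (h2.no_explosion t)
    rw [D.chainPath_eq h3 h4]
    exact h1 n t h3 h4

lemma IsRealization.ae_isRegularPath (hZ : D.IsRealization P Z) (hW : IsOpen W) :
    ∀ᵐ ω ∂P, IsRegularPath W fun t => Z t ω := by
  obtain ⟨X, -, -, h⟩ := hZ.exists_chain hW
  filter_upwards [h] with ω hω
  rw [hω.2]
  exact hω.1.isRegularPath hW

/-- The law of the path is determined by the law of the initial position. -/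
theorem IsRealization.map_path (hZ : D.IsRealization P Z) :
    P.map (fun ω t => Z t ω) = (P.map (Z 0)).bind D.pathLaw := by
  -- Only the absence of explosion matters here; for `W = univ` the grazing condition is void.
  obtain ⟨X, hX, h0, h⟩ := hZ.exists_chain isOpen_univ
  have h1 : (fun ω t => Z t ω) =ᵐ[P] fun ω => D.chainPath fun n => X n ω := by
    filter_upwards [h] with ω hω using hω.2
  rw [Measure.map_congr h1, ← Measure.map_congr h0]
  have h2 := Measure.map_map (μ := P) D.measurable_chainPath' hX.measurable_seq
  rw [hX.map_eq] at h2
  refine h2.symm.trans ?_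
  rw [pathLaw, Measure.map_comp _ _ D.measurable_chainPath']

/-- The Markov property of the path at time `t`. -/
theorem IsRealization.markov (hZ : D.IsRealization P Z) {F : Set (State d)}
    (hF : MeasurableSet F) {B : Set (ℝ≥0 → State d)} (hB : MeasurableSet B) (t : ℝ≥0)
    {I : Set ℝ≥0} (hI : I.Countable) (hIt : ∀ s ∈ I, s ≤ t) :
    P ({ω | ∀ s ∈ I, Z s ω ∈ F} ∩ {ω | shiftPath t (fun s => Z s ω) ∈ B})
      = ∫⁻ ω in {ω | ∀ s ∈ I, Z s ω ∈ F}, D.pathLaw (Z t ω) B ∂P := by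
  obtain ⟨X, hX, -, h⟩ := hZ.exists_chain isOpen_univ
  set M := P.map (fun ω n => X n ω) with hM
  -- The event is split according to the number of jumps up to `t`. By non-explosion the pieces
  -- exhaust it almost surely, and on each piece the property for a fixed start is mixed over the
  -- law of `ξ_0`.
  set U := ⋃ n, D.chainEvent F n t I with hU
  have hEm := fun n => D.measurableSet_chainEvent hF n t hI
  have hUm : MeasurableSet U := .iUnion hEm
  set S := {x | shiftPath t (D.chainPath x) ∈ B} with hS
  have hSm : MeasurableSet S := ((measurable_shiftPath t).comp D.measurable_chainPath') hB
  have hφ : Measurable fun x => D.pathLaw (D.chainPath x t) B :=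
    (D.pathLaw.measurable_coe hB).comp (D.measurable_chainPath t)
  have hdisj : Pairwise (Function.onFun Disjoint fun n => D.chainEvent F n t I) := by
    have hlt : ∀ m n, m < n → Disjoint (D.chainEvent F m t I) (D.chainEvent F n t I) := by
      intro m n hmn
      rw [Set.disjoint_left]
      rintro x ⟨-, h2, -⟩ ⟨h1, -, -⟩
      exact absurd (h2.trans_le (chainTime_mono x (Nat.succ_le_of_lt hmn))) (not_lt.2 h1)
    intro m n hmn
    rcases lt_or_gt_of_ne hmn with h | h
    · exact hlt m n h
    · exact (hlt n m h).symm
  have hn : ∀ n, M (D.chainEvent F n t I ∩ S)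
      = ∫⁻ x in D.chainEvent F n t I, D.pathLaw (D.chainPath x t) B ∂M := by
    intro n
    rw [← lintegral_indicator (hEm n), hM, hX.map_eq, Measure.bind_apply ((hEm n).inter hSm)
      D.skeletonLaw.aemeasurable, Measure.lintegral_bind D.skeletonLaw.aemeasurable
      (hφ.indicator (hEm n)).aemeasurable]
    refine lintegral_congr fun z => ?_
    rw [lintegral_indicator (hEm n)]
    exact D.skeletonLaw_chainEvent_inter hF hB n t hI hIt z
  have hMU : M (U ∩ S) = ∫⁻ x in U, D.pathLaw (D.chainPath x t) B ∂M := by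
    rw [hU, lintegral_iUnion hEm hdisj, Set.iUnion_inter, measure_iUnion
      (fun m n hmn => (hdisj hmn).mono Set.inter_subset_left Set.inter_subset_left)
      (fun n => (hEm n).inter hSm)]
    exact tsum_congr hn
  have hE : {ω | ∀ s ∈ I, Z s ω ∈ F} =ᵐ[P] (fun ω n => X n ω) ⁻¹' U := by
    filter_upwards [h] with ω hω
    refine propext ?_
    change (∀ s ∈ I, Z s ω ∈ F) ↔ (fun n => X n ω) ∈ U
    have hp : ∀ s, Z s ω = D.chainPath (fun n => X n ω) s := fun s => congrFun hω.2 s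
    simp only [hp, hU, Set.mem_iUnion, chainEvent, Set.mem_ofPred_eq]
    constructor
    · intro hs
      obtain ⟨n, h1, h2⟩ := exists_chainTime_le (hω.1.no_explosion t)
      exact ⟨n, h1, h2, hs⟩
    · rintro ⟨n, -, -, hs⟩
      exact hs
  have hSae : {ω | shiftPath t (fun s => Z s ω) ∈ B} =ᵐ[P] (fun ω n => X n ω) ⁻¹' S := by
    filter_upwards [h] with ω hω
    refine propext ?_
    change shiftPath t (fun s => Z s ω) ∈ B ↔ shiftPath t (D.chainPath fun n => X n ω) ∈ B
    rw [hω.2]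
  rw [measure_congr (hE.inter hSae), ← Set.preimage_inter,
    ← Measure.map_apply hX.measurable_seq (hUm.inter hSm), hMU, setLIntegral_congr hE, hM,
    setLIntegral_map hUm hφ hX.measurable_seq]
  refine lintegral_congr_ae (ae_restrict_of_ae ?_)
  filter_upwards [h] with ω hω
  rw [← congrFun hω.2 t]

/-- The Markov property at time `t` on the event that `W` was not left up to time `t`. -/
theorem IsRealization.markov_exitTime (hZ : D.IsRealization P Z) (hW : IsOpen W)
    {B : Set (ℝ≥0 → State d)} (hB : MeasurableSet B) (t : ℝ≥0) :
    P ({ω | (t : ℝ≥0∞) < exitTime W fun s => Z s ω} ∩ {ω | shiftPath t (fun s => Z s ω) ∈ B})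
      = ∫⁻ ω in {ω | (t : ℝ≥0∞) < exitTime W fun s => Z s ω}, D.pathLaw (Z t ω) B ∂P := by
  set A : ℕ → Set Ω := fun k => {ω | ∀ s ∈ timeGrid t, Z s ω ∈ innerSet W k} with hA
  have hAm : ∀ k, MeasurableSet (A k) := fun k =>
    measurableSet_forall_mem hZ.1 (isClosed_innerSet W k).measurableSet (countable_timeGrid t)
  have hAmono : Monotone A := fun k l hkl ω hω s hs => innerSet_mono W hkl (hω s hs)
  have hS : MeasurableSet {ω | shiftPath t (fun s => Z s ω) ∈ B} :=
    ((measurable_shiftPath t).comp hZ.measurable_path) hB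
  have hE : {ω | (t : ℝ≥0∞) < exitTime W fun s => Z s ω} =ᵐ[P] ⋃ k, A k := by
    filter_upwards [hZ.ae_isRegularPath hW] with ω hω
    refine propext ?_
    change ((t : ℝ≥0∞) < exitTime W fun s => Z s ω) ↔ ω ∈ ⋃ k, A k
    rw [hω.lt_exitTime_iff hW, Set.mem_iUnion]
    rfl
  have hφ : Measurable fun ω => D.pathLaw (Z t ω) B := (D.pathLaw.measurable_coe hB).comp (hZ.1 t)
  have hES : ({ω | (t : ℝ≥0∞) < exitTime W fun s => Z s ω}
      ∩ {ω | shiftPath t (fun s => Z s ω) ∈ B} : Set Ω) =ᵐ[P]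
      ((⋃ k, A k) ∩ {ω | shiftPath t (fun s => Z s ω) ∈ B} : Set Ω) := hE.inter (ae_eq_refl _)
  rw [measure_congr hES, setLIntegral_congr hE, Set.inter_comm, ← Measure.restrict_apply hS,
    ← withDensity_apply _ (.iUnion hAm)]
  have h1 : P.restrict (⋃ k, A k) {ω | shiftPath t (fun s => Z s ω) ∈ B}
      = P.restrict {ω | shiftPath t (fun s => Z s ω) ∈ B} (⋃ k, A k) := by
    rw [Measure.restrict_apply hS, Measure.restrict_apply (.iUnion hAm), Set.inter_comm]
  -- Both sides are now measures of the same increasing union: one of `P` restricted to the shift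
  -- event, the other of `P` with a density. By continuity from below it suffices to compare them on
  -- each `A k`.
  rw [h1, hAmono.measure_iUnion, hAmono.measure_iUnion]
  congr 1
  funext k
  rw [Measure.restrict_apply (hAm k), withDensity_apply _ (hAm k)]
  exact hZ.markov (isClosed_innerSet W k).measurableSet hB t (countable_timeGrid t)
    fun s hs => le_of_mem_timeGrid hs

end PDMP

/-! ### Quasistationarity and the renewal property -/

namespace IsQSD

variable {Ω E : Type*} [MeasurableSpace Ω] [MeasurableSpace E] {P : Measure Ω}
  {Z : ℝ≥0 → Ω → E} {W : Set E} {μ : Measure E}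

/-- Conditioning on a null event yields the zero measure, which is incompatible with `μ W = 1`. -/
lemma measure_lt_exitTime_ne_zero (h : IsQSD P Z W μ) (hW : MeasurableSet W) (t : ℝ≥0) :
    P {ω | (t : ℝ≥0∞) < exitTime W fun s => Z s ω} ≠ 0 := by
  intro h0
  have := h.quasistationary t W hW subset_rfl
  rw [ProbabilityTheory.cond, Measure.restrict_eq_zero.2 h0, h.support] at this
  simp at this

/-- Quasistationarity, for all measurable sets. -/
lemma map_restrict [IsProbabilityMeasure P] (h : IsQSD P Z W μ) [IsFiniteMeasure μ] (hμ : μ Wᶜ = 0)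
    (hZ : ∀ t, Measurable (Z t)) (hW : MeasurableSet W) (t : ℝ≥0) :
    (P.restrict {ω | (t : ℝ≥0∞) < exitTime W fun s => Z s ω}).map (Z t)
      = P {ω | (t : ℝ≥0∞) < exitTime W fun s => Z s ω} • μ := by
  set S := {ω | (t : ℝ≥0∞) < exitTime W fun s => Z s ω} with hS
  have h0 := h.measure_lt_exitTime_ne_zero hW t
  refine Measure.ext fun A hA => ?_
  have h1 := h.quasistationary t (A ∩ W) (hA.inter hW) Set.inter_subset_right
  rw [ProbabilityTheory.cond, Measure.smul_apply, smul_eq_mul] at h1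
  -- Quasistationarity is given for subsets of `W` only. It extends because `μ` is carried by `W`,
  -- and so is `Z t` on the survival event.
  have h2 : μ A = μ (A ∩ W) := by
    rw [← measure_inter_add_sdiff A hW,
      measure_mono_null (show A \ W ⊆ Wᶜ from fun x hx => hx.2) hμ, add_zero]
  have h3 : P.restrict S (Z t ⁻¹' A) = P.restrict S (Z t ⁻¹' (A ∩ W)) := by
    rw [Measure.restrict_apply (hZ t hA), Measure.restrict_apply (hZ t (hA.inter hW))]
    congr 1
    ext ω
    exact ⟨fun hω => ⟨⟨hω.1, mem_of_lt_exitTime hω.2⟩, hω.2⟩, fun hω => ⟨hω.1.1, hω.2⟩⟩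
  rw [Measure.map_apply (hZ t) hA, Measure.smul_apply, smul_eq_mul, h2, h3, ← h1, ← mul_assoc,
    ENNReal.mul_inv_cancel h0 (measure_ne_top _ _), one_mul]

end IsQSD

/-- Renewal at a fixed time for a process started from its quasistationary distribution. -/
theorem PDMP.IsRealization.renewal {d : ℕ} {D : PDMP d} {Ω : Type*} [MeasurableSpace Ω]
    {P : Measure Ω} [IsProbabilityMeasure P] {Z : ℝ≥0 → Ω → State d} (hZ : D.IsRealization P Z)
    {W : Set (State d)} (hW : IsOpen W) {μ : Measure (State d)} (hμ : IsQSD P Z W μ)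
    {B : Set (ℝ≥0 → State d)} (hB : MeasurableSet B) (t : ℝ≥0) :
    P ({ω | (t : ℝ≥0∞) < exitTime W fun s => Z s ω} ∩ {ω | shiftPath t (fun s => Z s ω) ∈ B})
      = P {ω | (t : ℝ≥0∞) < exitTime W fun s => Z s ω} * P {ω | (fun s => Z s ω) ∈ B} := by
  have hμp : IsProbabilityMeasure μ := by
    rw [← hμ.initial]
    exact Measure.isProbabilityMeasure_map (hZ.1 0).aemeasurable
  have hμ0 : μ Wᶜ = 0 := by
    rw [prob_compl_eq_zero_iff hW.measurableSet]
    exact hμ.support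
  have hφ : Measurable fun z => D.pathLaw z B := D.pathLaw.measurable_coe hB
  -- On survival up to `t` the position has law `μ` times the survival probability, so the future is
  -- a path started from `μ`, as is `Z` itself.
  rw [hZ.markov_exitTime hW hB, ← lintegral_map hφ (hZ.1 t),
    hμ.map_restrict hμ0 hZ.1 hW.measurableSet, lintegral_smul_measure, smul_eq_mul]
  congr 1
  have := Measure.map_apply (μ := P) hZ.measurable_path hB
  rw [hZ.map_path, Measure.bind_apply hB D.pathLaw.aemeasurable, hμ.initial] at this
  exact this

/-! ### The measurable space of regular paths -/

section PathSpace

variable {E : Type*} [MetricSpace E]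

/-- The space of regular paths. -/
abbrev RegularPath (W : Set E) : Type _ := {z : ℝ≥0 → E // IsRegularPath W z}

namespace RegularPath

variable {W : Set E}

/-- The first exit time from `W`. -/
def exit (z : RegularPath W) : ℝ≥0∞ := exitTime W z.1

/-- The position at the first exit time from `W`. -/
def exitPoint (z : RegularPath W) : E := z.1 z.exit.toNNReal

/-- The margin up to `u` is inherited from that up to `t + u`, which is only available if the path
has stayed in `W` up to `t`. -/
lemma isRegularPath_shiftPath (hW : IsOpen W) {z : ℝ≥0 → E} (hz : IsRegularPath W z) {t : ℝ≥0}
    (ht : (t : ℝ≥0∞) < exitTime W z) : IsRegularPath W (shiftPath t z) where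
  right_continuous s := by
    have hc : Tendsto (fun u : ℝ≥0 => t + u) (𝓝[≥] s) (𝓝[≥] (t + s)) :=
      tendsto_nhdsWithin_iff.2 ⟨((continuous_const.add continuous_id).tendsto s).mono_left
        nhdsWithin_le_nhds, by
          filter_upwards [self_mem_nhdsWithin] with u hu
          exact add_le_add_right hu t⟩
    exact (hz.right_continuous (t + s)).tendsto.comp hc
  margin u hu := by
    obtain ⟨k, hk⟩ := hz.margin (t + u) fun s hs => by
      rcases le_total s t with hst | hst
      · exact (lt_exitTime_iff hW hz.right_continuous t).1 ht s hst
      · obtain ⟨v, rfl⟩ := exists_add_of_le hst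
        exact hu v (le_of_add_le_add_left hs)
    exact ⟨k, fun s hs => hk (t + s) (add_le_add_right hs t)⟩

open Classical in
/-- The path seen from time `t` on, if it has not left `W` up to this time. -/
def shift (hW : IsOpen W) (t : ℝ≥0) (z : RegularPath W) : RegularPath W :=
  if h : (t : ℝ≥0∞) < z.exit then ⟨shiftPath t z.1, isRegularPath_shiftPath hW z.2 h⟩ else z

lemma shift_val (hW : IsOpen W) {t : ℝ≥0} {z : RegularPath W} (h : (t : ℝ≥0∞) < z.exit) :
    (z.shift hW t).1 = shiftPath t z.1 := by
  rw [shift, dif_pos h]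

lemma exit_shift (hW : IsOpen W) {t : ℝ≥0} {z : RegularPath W} (h : (t : ℝ≥0∞) < z.exit) :
    z.exit = t + (z.shift hW t).exit := by
  refine eq_of_forall_lt_iff fun c => ?_
  induction c using ENNReal.recTopCoe with
  | top => simp
  | coe c =>
    rcases lt_or_ge c t with hct | hct
    · have hct' : (c : ℝ≥0∞) < t := by exact_mod_cast hct
      exact ⟨fun _ => hct'.trans_le le_self_add, fun _ => hct'.trans h⟩
    · obtain ⟨v, rfl⟩ := exists_add_of_le hct
      rw [ENNReal.coe_add, ENNReal.add_lt_add_iff_left ENNReal.coe_ne_top, ← ENNReal.coe_add, exit,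
        exit, lt_exitTime_iff hW z.2.right_continuous,
        lt_exitTime_iff hW (z.shift hW t).2.right_continuous, shift_val hW h]
      constructor
      · intro hs s hsv
        exact hs (t + s) (add_le_add_right hsv t)
      · intro hs s hsv
        rcases le_total s t with hst | hst
        · exact (lt_exitTime_iff hW z.2.right_continuous t).1 h s hst
        · obtain ⟨u, rfl⟩ := exists_add_of_le hst
          exact hs u (le_of_add_le_add_left hsv)

lemma add_lt_exit_iff (hW : IsOpen W) {t s : ℝ≥0} {z : RegularPath W} :
    ((t + s : ℝ≥0) : ℝ≥0∞) < z.exit ↔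
      (t : ℝ≥0∞) < z.exit ∧ (s : ℝ≥0∞) < (z.shift hW t).exit := by
  constructor
  · intro h
    have h1 : (t : ℝ≥0∞) < z.exit := lt_of_le_of_lt (by exact_mod_cast le_self_add) h
    refine ⟨h1, ?_⟩
    rw [exit_shift hW h1, ENNReal.coe_add] at h
    exact lt_of_add_lt_add_left h
  · rintro ⟨h1, h2⟩
    rw [exit_shift hW h1, ENNReal.coe_add]
    exact ENNReal.add_lt_add_left ENNReal.coe_ne_top h2

/-- Finiteness matters: for an infinite exit time each exit point would be the value of its own path
at time `0`, since `toNNReal` sends `⊤` to `0`. -/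
lemma exitPoint_shift (hW : IsOpen W) {t : ℝ≥0} {z : RegularPath W} (h : (t : ℝ≥0∞) < z.exit)
    (hfin : z.exit ≠ ⊤) : (z.shift hW t).exitPoint = z.exitPoint := by
  have h1 := exit_shift hW h
  have h2 : (z.shift hW t).exit ≠ ⊤ := fun h' => hfin (by rw [h1, h']; simp)
  rw [exitPoint, exitPoint, shift_val hW h, shiftPath, h1,
    ENNReal.toNNReal_add ENNReal.coe_ne_top h2, ENNReal.toNNReal_coe]

variable [MeasurableSpace E]

lemma measurable_apply (t : ℝ≥0) : Measurable fun z : RegularPath W => z.1 t :=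
  (measurable_pi_apply t).comp measurable_subtype_coe

variable [BorelSpace E]

lemma measurable_exit (hW : IsOpen W) : Measurable (exit (W := W)) :=
  measurable_exitTime hW measurable_apply fun z => z.2

lemma measurable_shift (hW : IsOpen W) (t : ℝ≥0) : Measurable (shift hW t) := by
  classical
  have h : (fun z : RegularPath W => (z.shift hW t).1)
      = fun z : RegularPath W => if (t : ℝ≥0∞) < z.exit then shiftPath t z.1 else z.1 := by
    funext z
    by_cases hz : (t : ℝ≥0∞) < z.exit
    · rw [shift_val hW hz, if_pos hz]
    · rw [shift, dif_neg hz, if_neg hz]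
  have h2 : Measurable fun z : RegularPath W => (z.shift hW t).1 := by
    rw [h]
    exact Measurable.ite (measurableSet_lt measurable_const (measurable_exit hW))
      ((measurable_shiftPath t).comp measurable_subtype_coe) measurable_subtype_coe
  exact h2.subtype_mk (h := fun z => (z.shift hW t).2)

/-- The time is approximated from the right by multiples of `1 / (j + 1)`. Each approximation takes
countably many values, and right continuity gives convergence. -/
lemma measurable_uncurry : Measurable fun p : RegularPath W × ℝ≥0 => p.1.1 p.2 := by
  set a : ℕ → ℝ≥0 → ℝ≥0 := fun j t => ((⌊((j : ℝ≥0) + 1) * t⌋₊ : ℝ≥0) + 1) / ((j : ℝ≥0) + 1) with ha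
  have hlt : ∀ j t, t ≤ a j t := by
    intro j t
    rw [ha, le_div_iff₀ (by positivity), mul_comm]
    exact (Nat.lt_floor_add_one _).le
  have hle : ∀ j t, a j t ≤ t + 1 / ((j : ℝ≥0) + 1) := by
    intro j t
    have hj : (0 : ℝ≥0) < (j : ℝ≥0) + 1 := by positivity
    have h2 : (t + 1 / ((j : ℝ≥0) + 1)) * ((j : ℝ≥0) + 1) = ((j : ℝ≥0) + 1) * t + 1 := by
      field_simp
    rw [ha, div_le_iff₀ hj, h2]
    gcongr
    exact Nat.floor_le zero_le
  have hinv : Tendsto (fun j : ℕ => 1 / ((j : ℝ≥0) + 1)) atTop (𝓝 0) :=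
    tendsto_one_div_add_atTop_nhds_zero_nat
  have hlim : ∀ t, Tendsto (fun j => a j t) atTop (𝓝[≥] t) := by
    intro t
    refine tendsto_nhdsWithin_iff.2 ⟨?_, Eventually.of_forall fun j => hlt j t⟩
    have h1 : Tendsto (fun j : ℕ => t + 1 / ((j : ℝ≥0) + 1)) atTop (𝓝 t) := by
      simpa using tendsto_const_nhds.add hinv
    exact tendsto_of_tendsto_of_tendsto_of_le_of_le tendsto_const_nhds h1 (fun j => hlt j t)
      fun j => hle j t
  refine measurable_of_tendsto_metrizable (f := fun j (p : RegularPath W × ℝ≥0) => p.1.1 (a j p.2))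
    (fun j => ?_) (tendsto_pi_nhds.2 fun p => (p.1.2.right_continuous p.2).tendsto.comp (hlim p.2))
  have h1 : Measurable fun q : RegularPath W × ℕ =>
      q.1.1 (((q.2 : ℝ≥0) + 1) / ((j : ℝ≥0) + 1)) :=
    measurable_from_prod_countable_left fun n =>
      measurable_apply (((n : ℝ≥0) + 1) / ((j : ℝ≥0) + 1))
  have h2 : Measurable fun p : RegularPath W × ℝ≥0 => ⌊((j : ℝ≥0) + 1) * p.2⌋₊ :=
    Nat.measurable_floor.comp (measurable_snd.const_mul _)
  exact h1.comp (measurable_fst.prodMk h2)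

lemma measurable_path (z : RegularPath W) : Measurable z.1 :=
  measurable_uncurry.comp (measurable_prodMk_left (x := z))

lemma measurable_exitPoint (hW : IsOpen W) : Measurable (exitPoint (W := W)) :=
  measurable_uncurry.comp (measurable_id.prodMk (measurable_exit hW).ennreal_toNNReal)

/-- Moving the random endpoint into an indicator makes this an integral against a fixed measure,
which is measurable in the parameter. -/
lemma measurable_pathIntegral {f : E → ℝ} (hf : Measurable f) {b : RegularPath W → ℝ}
    (hb : Measurable b) (hb0 : ∀ z, 0 ≤ b z) :
    Measurable fun z : RegularPath W => pathIntegral f z.1 0 (b z) := by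
  have h : (fun z : RegularPath W => pathIntegral f z.1 0 (b z)) = fun z : RegularPath W =>
      ∫ t, {p : RegularPath W × ℝ | 0 < p.2 ∧ p.2 ≤ b p.1}.indicator
        (fun p => f (p.1.1 p.2.toNNReal)) (z, t) := by
    funext z
    rw [pathIntegral, intervalIntegral.integral_of_le (hb0 z),
      ← integral_indicator measurableSet_Ioc]
    rfl
  rw [h]
  refine (StronglyMeasurable.integral_prod_right (ν := volume) ?_).measurable
  refine (Measurable.indicator ?_ ?_).stronglyMeasurable
  · exact hf.comp (measurable_uncurry.comp
      (measurable_fst.prodMk measurable_snd.real_toNNReal))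
  · exact (measurableSet_lt measurable_const measurable_snd).inter
      (measurableSet_le measurable_snd (hb.comp measurable_fst))

end RegularPath

lemma pathIntegral_shiftPath {E : Type*} (f : E → ℝ) (z : ℝ≥0 → E) (t : ℝ≥0) {b : ℝ}
    (hb : 0 ≤ b) : pathIntegral f (shiftPath t z) 0 b = pathIntegral f z t (t + b) := by
  have h : pathIntegral f (shiftPath t z) 0 b
      = ∫ s in (0 : ℝ)..b, (fun u : ℝ => f (z u.toNNReal)) (s + t) := by
    refine intervalIntegral.integral_congr fun s hs => ?_
    rw [Set.uIcc_of_le hb] at hs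
    simp only [shiftPath]
    rw [Real.toNNReal_add hs.1 (NNReal.coe_nonneg t), Real.toNNReal_coe, add_comm]
  rw [h, intervalIntegral.integral_comp_add_right (fun u : ℝ => f (z u.toNNReal)), zero_add,
    add_comm b]
  rfl

lemma pathIntegral_one {E : Type*} (z : ℝ≥0 → E) (a b : ℝ) :
    pathIntegral (fun _ => 1) z a b = b - a := by
  simp [pathIntegral]

lemma abs_pathIntegral_le {E : Type*} {f : E → ℝ} {C : ℝ} (hf : ∀ x, |f x| ≤ C) (z : ℝ≥0 → E)
    (a b : ℝ) : |pathIntegral f z a b| ≤ C * |b - a| := by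
  rw [pathIntegral, ← Real.norm_eq_abs]
  exact intervalIntegral.norm_integral_le_of_norm_le_const fun t _ => hf _

/-- A process with almost surely regular paths has a version with values in the path space. -/
lemma exists_regularPath_version [MeasurableSpace E] {Ω : Type*} [MeasurableSpace Ω]
    {P : Measure Ω} {W : Set E} (hW : IsOpen W) {Z : ℝ≥0 → Ω → E} (hZ : ∀ t, Measurable (Z t))
    (h : ∀ᵐ ω ∂P, IsRegularPath W fun t => Z t ω) :
    ∃ Y : Ω → RegularPath W, Measurable Y ∧ ∀ᵐ ω ∂P, (Y ω).1 = fun t => Z t ω := by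
  classical
  set N := toMeasurable P {ω | ¬ IsRegularPath W fun t => Z t ω} with hN
  have hN0 : P N = 0 := by rw [hN, measure_toMeasurable]; exact h
  have hNm : MeasurableSet N := measurableSet_toMeasurable _ _
  -- On the exceptional null set the path is replaced by a constant one, which is continuous and
  -- hence regular.
  have hreg : ∀ ω, IsRegularPath W (if ω ∈ N then fun _ => Z 0 ω else fun t => Z t ω) := by
    intro ω
    by_cases hω : ω ∈ N
    · rw [if_pos hω]
      exact .of_continuous hW continuous_const
    · rw [if_neg hω]
      by_contra hc
      exact hω (subset_toMeasurable _ _ hc)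
  refine ⟨fun ω => ⟨_, hreg ω⟩, Measurable.subtype_mk ?_, ?_⟩
  · exact Measurable.ite hNm (measurable_pi_lambda _ fun _ => hZ 0) (measurable_pi_lambda _ hZ)
  · have : ∀ᵐ ω ∂P, ω ∉ N := measure_eq_zero_iff_ae_notMem.1 hN0
    filter_upwards [this] with ω hω
    exact if_neg hω

end PathSpace

/-! ### Renewal schemes: expectation and exit law depend only on `δ` and `ν` -/

section RenewalScheme

variable {E : Type*} [MetricSpace E] [MeasurableSpace E] {W : Set E}

/-- The law `ν` of a path which, as long as it stays in `W`, starts afresh at fixed times, and which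
leaves `W` in finite time. -/
structure IsRenewalLaw (hW : IsOpen W) (ν : Measure (RegularPath W)) : Prop where
  exit_pos : ∀ᵐ z ∂ν, 0 < z.exit
  exit_lt_top : ∀ᵐ z ∂ν, z.exit < ⊤
  renewal : ∀ (t : ℝ≥0) (B : Set (RegularPath W)), MeasurableSet B →
    ν ({z | (t : ℝ≥0∞) < z.exit} ∩ (RegularPath.shift hW t) ⁻¹' B)
      = ν {z | (t : ℝ≥0∞) < z.exit} * ν B

namespace IsRenewalLaw

variable {hW : IsOpen W} {ν : Measure (RegularPath W)} [IsProbabilityMeasure ν]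

/-- Renewal at `m * δ` splits off one factor at a time. The base case needs that the path does not
start outside `W`. -/
lemma measure_lt_exit [BorelSpace E] (h : IsRenewalLaw hW ν) (δ : ℝ≥0) (m : ℕ) :
    ν {z | ((m * δ : ℝ≥0) : ℝ≥0∞) < z.exit} = ν {z | (δ : ℝ≥0∞) < z.exit} ^ m := by
  induction m with
  | zero =>
    rw [pow_zero]
    refine (mem_ae_iff_prob_eq_one
      (measurableSet_lt measurable_const (RegularPath.measurable_exit hW))).1 ?_
    filter_upwards [h.exit_pos] with z hz
    simpa using hz
  | succ m ih =>
    rw [pow_succ, ← ih, ← h.renewal _ _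
      (measurableSet_lt measurable_const (RegularPath.measurable_exit hW))]
    congr 1
    ext z
    have : ((m + 1 : ℕ) * δ : ℝ≥0) = m * δ + δ := by push_cast; ring
    rw [Set.mem_ofPred_eq, this, RegularPath.add_lt_exit_iff hW]
    rfl

/-- With survival probability one, the exit time would almost surely exceed every multiple of `δ`,
contradicting its finiteness. -/
lemma measure_lt_exit_lt_one [BorelSpace E] (h : IsRenewalLaw hW ν) {δ : ℝ≥0} (hδ : 0 < δ) :
    ν {z | (δ : ℝ≥0∞) < z.exit} < 1 := by
  refine lt_of_le_of_ne prob_le_one fun h1 => ?_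
  have h2 : ∀ m : ℕ, ∀ᵐ z ∂ν, ((m * δ : ℝ≥0) : ℝ≥0∞) < z.exit := by
    intro m
    exact (mem_ae_iff_prob_eq_one
      (measurableSet_lt measurable_const (RegularPath.measurable_exit hW))).2
      ((h.measure_lt_exit δ m).trans (by rw [h1, one_pow]))
  have h3 : ∀ᵐ z ∂ν, False := by
    filter_upwards [ae_all_iff.2 h2, h.exit_lt_top] with z hz hfin
    obtain ⟨m, hm⟩ := exists_nat_ge (z.exit.toNNReal / δ)
    rw [div_le_iff₀ hδ] at hm
    have := hz m
    rw [← ENNReal.coe_toNNReal hfin.ne] at this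
    exact absurd (ENNReal.coe_lt_coe.1 this) (not_lt.2 hm)
  exact h3.exists.elim fun _ hz => hz

end IsRenewalLaw

/-- The contribution of the path up to time `δ` or up to its exit from `W`. -/
def RegularPath.segment (f : E → ℝ) (δ : ℝ≥0) (z : RegularPath W) : ℝ :=
  pathIntegral f z.1 0 (min z.exit δ).toReal

lemma RegularPath.measurable_segment [BorelSpace E] (hW : IsOpen W) {f : E → ℝ} (hf : Measurable f)
    (δ : ℝ≥0) : Measurable (RegularPath.segment (W := W) f δ) :=
  measurable_pathIntegral hf ((measurable_exit hW).min measurable_const).ennreal_toReal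
    fun _ => ENNReal.toReal_nonneg

lemma RegularPath.abs_segment_le {E : Type*} [MetricSpace E] {W : Set E} {f : E → ℝ} {C : ℝ}
    (hf : ∀ x, |f x| ≤ C) (δ : ℝ≥0) (z : RegularPath W) : |z.segment f δ| ≤ C * δ := by
  refine (abs_pathIntegral_le hf _ _ _).trans ?_
  have hC : 0 ≤ C := (abs_nonneg _).trans (hf (z.1 0))
  rw [sub_zero, abs_of_nonneg ENNReal.toReal_nonneg]
  refine mul_le_mul_of_nonneg_left ?_ hC
  exact ENNReal.toReal_mono ENNReal.coe_ne_top (min_le_right _ _)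

/-- A succession of paths `Y k`, each of which is run until time `δ`, where the `k`-th one is run on
the event `A k` that none of the preceding ones has left `W` before. Given `A k`, the law of `Y k`
is `ν`. -/
structure IsRenewalScheme {Ω : Type*} [MeasurableSpace Ω] (δ : ℝ≥0) (ν : Measure (RegularPath W))
    (P : Measure Ω) (A : ℕ → Set Ω) (Y : ℕ → Ω → RegularPath W) : Prop where
  measurableSet : ∀ k, MeasurableSet (A k)
  measurable : ∀ k, Measurable (Y k)
  ae_zero : ∀ᵐ ω ∂P, ω ∈ A 0
  succ : ∀ k, A (k + 1) = A k ∩ {ω | (δ : ℝ≥0∞) < (Y k ω).exit}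
  map_eq : ∀ k, (P.restrict (A k)).map (Y k) = ν {z | (δ : ℝ≥0∞) < z.exit} ^ k • ν

namespace IsRenewalScheme

variable {Ω : Type*} [MeasurableSpace Ω] {δ : ℝ≥0} {ν : Measure (RegularPath W)}
  {P : Measure Ω} {A : ℕ → Set Ω} {Y : ℕ → Ω → RegularPath W}

lemma antitone (h : IsRenewalScheme δ ν P A Y) : Antitone A :=
  antitone_nat_of_succ_le fun k => by rw [h.succ k]; exact Set.inter_subset_left

lemma comp {Ω' : Type*} [MeasurableSpace Ω'] {P' : Measure Ω'} {φ : Ω' → Ω} (hφ : Measurable φ)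
    (hP : P'.map φ = P) (h : IsRenewalScheme δ ν P A Y) :
    IsRenewalScheme δ ν P' (fun k => φ ⁻¹' A k) fun k ω => Y k (φ ω) where
  measurableSet k := hφ (h.measurableSet k)
  measurable k := (h.measurable k).comp hφ
  ae_zero := by
    have := h.ae_zero
    rw [← hP] at this
    exact ae_of_ae_map hφ.aemeasurable this
  succ k := by rw [h.succ k]; rfl
  map_eq k := by
    rw [← h.map_eq k, ← hP, Measure.restrict_map hφ (h.measurableSet k),
      Measure.map_map (h.measurable k) hφ]
    rfl

variable [IsProbabilityMeasure ν]

lemma measure_eq (h : IsRenewalScheme δ ν P A Y) (k : ℕ) :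
    P (A k) = ν {z | (δ : ℝ≥0∞) < z.exit} ^ k := by
  have := congrArg (fun m => m Set.univ) (h.map_eq k)
  simpa [Measure.map_apply (h.measurable k) .univ] using this

/-- The probabilities of `A k` decay geometrically, so almost surely some segment is the first to
leave `W`. -/
lemma ae_exists [IsFiniteMeasure P] (h : IsRenewalScheme δ ν P A Y)
    (hp : ν {z | (δ : ℝ≥0∞) < z.exit} < 1) : ∀ᵐ ω ∂P, ∃ K, ω ∈ A K ∧ ω ∉ A (K + 1) := by
  have h0 : P (⋂ k, A k) = 0 := by
    have h1 := tendsto_measure_iInter_atTop (μ := P)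
      (fun k => (h.measurableSet k).nullMeasurableSet)
      h.antitone ⟨0, measure_ne_top _ _⟩
    simp only [Function.comp_def, h.measure_eq] at h1
    exact tendsto_nhds_unique h1 (ENNReal.tendsto_pow_atTop_nhds_zero_of_lt_one hp)
  have h2 : ∀ᵐ ω ∂P, ω ∉ ⋂ k, A k := measure_eq_zero_iff_ae_notMem.1 h0
  filter_upwards [h2, h.ae_zero] with ω hω h0
  by_contra! hc
  exact hω (Set.mem_iInter.2 fun k => by
    induction k with
    | zero => exact h0
    | succ k ih => exact hc k ih)

/-- The total contribution of the succession of paths is integrable, and its expectation depends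
only on `ν` and `δ`. -/
theorem integral_eq [BorelSpace E] [IsProbabilityMeasure P] (h : IsRenewalScheme δ ν P A Y)
    (hW : IsOpen W) (hp : ν {z | (δ : ℝ≥0∞) < z.exit} < 1) {f : E → ℝ} (hf : Measurable f) {C : ℝ}
    (hfC : ∀ x, |f x| ≤ C) {V : Ω → ℝ}
    (hV : ∀ᵐ ω ∂P, ∀ K, ω ∈ A K → ω ∉ A (K + 1) →
      V ω = ∑ k ∈ Finset.range (K + 1), (Y k ω).segment f δ) :
    Integrable V P ∧ ∫ ω, V ω ∂P
      = ∑' k : ℕ, (ν {z | (δ : ℝ≥0∞) < z.exit}).toReal ^ k * ∫ z, z.segment f δ ∂ν := by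
  set p := ν {z | (δ : ℝ≥0∞) < z.exit} with hpdef
  have hpr : p.toReal < 1 := by
    rw [← ENNReal.toReal_one]
    exact (ENNReal.toReal_lt_toReal hp.ne_top ENNReal.one_ne_top).2 hp
  -- Segments after the exit contribute zero, which turns the sum with a random number of terms into
  -- a series with fixed index set.
  set G : ℕ → Ω → ℝ := fun k => (A k).indicator fun ω => (Y k ω).segment f δ with hG
  have hseg := RegularPath.measurable_segment hW hf δ
  have hGm : ∀ k, Measurable (G k) := fun k =>
    (hseg.comp (h.measurable k)).indicator (h.measurableSet k)
  have hC0 : 0 ≤ C * δ := by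
    obtain ⟨z⟩ : Nonempty (RegularPath W) := nonempty_of_isProbabilityMeasure ν
    exact (abs_nonneg _).trans (z.abs_segment_le hfC δ)
  have hGb : ∀ k ω, ‖G k ω‖ ≤ (A k).indicator (fun _ => C * δ) ω := by
    intro k ω
    rw [hG, norm_indicator_eq_indicator_norm]
    exact Set.indicator_le_indicator ((Y k ω).abs_segment_le hfC δ)
  have hGi : ∀ k, Integrable (G k) P := fun k =>
    Integrable.mono' ((integrable_const (C * δ)).indicator (h.measurableSet k))
      (hGm k).aestronglyMeasurable (Eventually.of_forall (hGb k))
  -- A segment contributes at most `C * δ` and is run with probability `p ^ k`. The geometric bound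
  -- yields integrability and the exchange of sum and integral.
  have hGn : ∀ k, ∫ ω, ‖G k ω‖ ∂P ≤ C * δ * p.toReal ^ k := by
    intro k
    refine (integral_mono (hGi k).norm ((integrable_const (C * δ)).indicator (h.measurableSet k))
      (hGb k)).trans ?_
    rw [integral_indicator_const _ (h.measurableSet k), smul_eq_mul, mul_comm, measureReal_def,
      h.measure_eq, ENNReal.toReal_pow]
  have hsum : Summable fun k => ∫ ω, ‖G k ω‖ ∂P :=
    Summable.of_nonneg_of_le (fun k => integral_nonneg fun _ => norm_nonneg _) hGn
      ((summable_geometric_of_lt_one ENNReal.toReal_nonneg hpr).mul_left _)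
  have hVs : ∀ᵐ ω ∂P, HasSum (fun k => G k ω) (V ω) := by
    filter_upwards [hV, h.ae_exists hp] with ω hω ⟨K, hK, hK'⟩
    have h0 : ∀ k ∉ Finset.range (K + 1), G k ω = 0 := by
      intro k hk
      refine Set.indicator_of_notMem (fun hc => hK' (h.antitone ?_ hc)) _
      simpa using hk
    have h1 : ∑ k ∈ Finset.range (K + 1), (Y k ω).segment f δ
        = ∑ k ∈ Finset.range (K + 1), G k ω := Finset.sum_congr rfl fun k hk =>
      (Set.indicator_of_mem (h.antitone (Nat.lt_succ_iff.1 (Finset.mem_range.1 hk)) hK)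
        fun ω => (Y k ω).segment f δ).symm
    rw [hω K hK hK', h1]
    exact hasSum_sum_of_ne_finset_zero h0
  have hVeq : V =ᵐ[P] fun ω => ∑' k, G k ω := by
    filter_upwards [hVs] with ω hω using hω.tsum_eq.symm
  have hGint : ∀ k, ∫ ω, G k ω ∂P = p.toReal ^ k * ∫ z, z.segment f δ ∂ν := by
    intro k
    rw [hG, integral_indicator (h.measurableSet k)]
    have := integral_map (μ := P.restrict (A k)) (h.measurable k).aemeasurable
      (f := fun z => z.segment f δ) hseg.aestronglyMeasurable
    rw [← this, h.map_eq, integral_smul_measure, ENNReal.toReal_pow, smul_eq_mul]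
  constructor
  · refine ⟨?_, ?_⟩
    · refine aestronglyMeasurable_of_tendsto_ae (u := atTop)
        (f := fun n ω => ∑ k ∈ Finset.range n, G k ω) (fun n => ?_) ?_
      · exact (Finset.measurable_sum _ fun k _ => hGm k).aestronglyMeasurable
      · filter_upwards [hVs] with ω hω using hω.tendsto_sum_nat
    · refine lt_of_le_of_lt (b := ∫⁻ ω, ∑' k, ‖G k ω‖ₑ ∂P) (lintegral_mono_ae ?_) ?_
      · filter_upwards [hVeq] with ω hω
        rw [hω]
        exact enorm_tsum_le_tsum_enorm
      · rw [lintegral_tsum fun k => (hGm k).enorm.aemeasurable]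
        have : ∀ k, ∫⁻ ω, ‖G k ω‖ₑ ∂P = ENNReal.ofReal (∫ ω, ‖G k ω‖ ∂P) := fun k =>
          (ofReal_integral_norm_eq_lintegral_enorm (hGi k)).symm
        simp_rw [this]
        exact hsum.tsum_ofReal_lt_top
  · rw [integral_congr_ae hVeq, ← (hasSum_integral_of_summable_integral_norm hGi hsum).tsum_eq]
    exact tsum_congr hGint

/-- The law of the total duration and of the exit point of the succession of paths. -/
theorem map_exit [BorelSpace E] [IsProbabilityMeasure P] (h : IsRenewalScheme δ ν P A Y)
    (hW : IsOpen W) (hp : ν {z | (δ : ℝ≥0∞) < z.exit} < 1) {V : Ω → ℝ × E}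
    (hV : ∀ᵐ ω ∂P, ∀ K, ω ∈ A K → ω ∉ A (K + 1) →
      V ω = (K * δ + (Y K ω).exit.toReal, (Y K ω).exitPoint)) :
    AEMeasurable V P ∧ ∀ B, MeasurableSet B → P.map V B = ∑' k : ℕ,
      ν {z | (δ : ℝ≥0∞) < z.exit} ^ k * ν ({z | (δ : ℝ≥0∞) < z.exit}ᶜ ∩
        {z | ((k * δ + z.exit.toReal, z.exitPoint) : ℝ × E) ∈ B}) := by
  have hSm : ∀ k, MeasurableSet (A k \ A (k + 1)) := fun k =>
    (h.measurableSet k).diff (h.measurableSet _)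
  have hg : ∀ k : ℕ, Measurable fun z : RegularPath W =>
      ((k * δ + z.exit.toReal, z.exitPoint) : ℝ × E) := fun k =>
    ((RegularPath.measurable_exit hW).ennreal_toReal.const_add _).prodMk
      (RegularPath.measurable_exitPoint hW)
  have hU : ∀ᵐ ω ∂P, ω ∈ ⋃ k, A k \ A (k + 1) := by
    filter_upwards [h.ae_exists hp] with ω hω
    exact Set.mem_iUnion.2 hω
  have hVk : ∀ k, V =ᵐ[P.restrict (A k \ A (k + 1))]
      fun ω => ((k * δ + (Y k ω).exit.toReal, (Y k ω).exitPoint) : ℝ × E) := by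
    intro k
    filter_upwards [ae_restrict_of_ae hV, ae_restrict_mem (hSm k)] with ω hω hmem
    exact hω k hmem.1 hmem.2
  have hVm : AEMeasurable V P := by
    have := aemeasurable_iUnion_iff.2 fun k =>
      ((hg k).comp (h.measurable k)).aemeasurable.congr (hVk k).symm
    rwa [Measure.restrict_eq_self_of_ae_mem hU] at this
  have hdisj : Pairwise (Function.onFun Disjoint fun k => A k \ A (k + 1)) := by
    have hlt : ∀ m n, m < n → Disjoint (A m \ A (m + 1)) (A n \ A (n + 1)) := by
      intro m n hmn
      rw [Set.disjoint_left]
      exact fun ω h1 h2 => h1.2 (h.antitone (Nat.succ_le_of_lt hmn) h2.1)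
    intro m n hmn
    rcases lt_or_gt_of_ne hmn with h | h
    · exact hlt m n h
    · exact (hlt n m h).symm
  have hexm : MeasurableSet {z : RegularPath W | (δ : ℝ≥0∞) < z.exit} :=
    measurableSet_lt measurable_const (RegularPath.measurable_exit hW)
  refine ⟨hVm, fun B hB => ?_⟩
  have h1 : P.map V B = ∑' k, (P.restrict (A k \ A (k + 1))).map V B := by
    conv_lhs => rw [← Measure.restrict_eq_self_of_ae_mem hU]
    rw [Measure.map_apply_of_aemeasurable
      (by rwa [Measure.restrict_eq_self_of_ae_mem hU]) hB,
      Measure.restrict_iUnion hdisj hSm, Measure.sum_apply_of_countable]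
    exact tsum_congr fun k => (Measure.map_apply_of_aemeasurable hVm.restrict hB).symm
  rw [h1]
  refine tsum_congr fun k => ?_
  -- Ending at position `k` means that `A k` holds and that `Y k` exits within `δ`. The latter is an
  -- event for `Y k` alone, so `map_eq` applies.
  have h2 : A k \ A (k + 1) = A k ∩ Y k ⁻¹' {z | (δ : ℝ≥0∞) < z.exit}ᶜ := by
    rw [h.succ k]
    ext ω
    simp only [Set.mem_sdiff, Set.mem_inter_iff, Set.mem_preimage, Set.mem_compl_iff,
      Set.mem_ofPred_eq]
    tauto
  have hgY : Measurable fun ω =>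
      ((k * δ + (Y k ω).exit.toReal, (Y k ω).exitPoint) : ℝ × E) := (hg k).comp (h.measurable k)
  rw [Measure.map_congr (hVk k), Measure.map_apply hgY hB, Measure.restrict_apply (hgY hB), h2]
  have h3 := congrArg (fun m => m ({z | (δ : ℝ≥0∞) < z.exit}ᶜ ∩
        {z | ((k * δ + z.exit.toReal, z.exitPoint) : ℝ × E) ∈ B})) (h.map_eq k)
  have hm3 : MeasurableSet ({z : RegularPath W | (δ : ℝ≥0∞) < z.exit}ᶜ ∩
        {z | ((k * δ + z.exit.toReal, z.exitPoint) : ℝ × E) ∈ B}) := hexm.compl.inter (hg k hB)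
  simp only [Measure.smul_apply, smul_eq_mul] at h3
  rw [Measure.map_apply (h.measurable k) hm3,
    Measure.restrict_apply (h.measurable k hm3)] at h3
  rw [← h3]
  congr 1
  ext ω
  simp only [Set.mem_inter_iff, Set.mem_preimage, Set.mem_ofPred_eq]
  tauto

end IsRenewalScheme

end RenewalScheme

/-! ### Single and parallel runs as renewal schemes -/

section ParallelScheme

lemma RegularPath.pathIntegral_add {E : Type*} [MetricSpace E] [MeasurableSpace E] [BorelSpace E]
    {W : Set E} (z : RegularPath W) {f : E → ℝ} (hf : Measurable f) {C : ℝ} (hfC : ∀ x, |f x| ≤ C)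
    (a b c : ℝ) : pathIntegral f z.1 a b + pathIntegral f z.1 b c = pathIntegral f z.1 a c := by
  have h : ∀ a b : ℝ, IntervalIntegrable (fun t : ℝ => f (z.1 t.toNNReal)) volume a b := by
    intro a b
    refine (intervalIntegrable_const (c := C)).mono_fun ?_ ?_
    · exact (hf.comp (z.measurable_path.comp measurable_real_toNNReal)).aestronglyMeasurable
    · exact Eventually.of_forall fun t => (hfC _).trans (le_abs_self C)
  exact intervalIntegral.integral_add_adjacent_intervals (h a b) (h b c)

variable {E : Type*} [MetricSpace E] {W : Set E}

lemma RegularPath.segment_shift_of_lt (hW : IsOpen W) {z : RegularPath W} {t δ : ℝ≥0}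
    (h : ((t + δ : ℝ≥0) : ℝ≥0∞) < z.exit) (f : E → ℝ) :
    (z.shift hW t).segment f δ = pathIntegral f z.1 t (t + δ) := by
  obtain ⟨h1, h2⟩ := (add_lt_exit_iff hW).1 h
  rw [segment, shift_val hW h1, min_eq_right h2.le, ENNReal.coe_toReal,
    pathIntegral_shiftPath f z.1 t (NNReal.coe_nonneg δ)]

lemma RegularPath.exit_toReal (hW : IsOpen W) {z : RegularPath W} {t : ℝ≥0}
    (h : (t : ℝ≥0∞) < z.exit) (hfin : z.exit ≠ ⊤) :
    z.exit.toReal = t + (z.shift hW t).exit.toReal := by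
  have h2 : (z.shift hW t).exit ≠ ⊤ := fun h' => hfin (by rw [exit_shift hW h, h']; simp)
  rw [exit_shift hW h, ENNReal.toReal_add ENNReal.coe_ne_top h2, ENNReal.coe_toReal]

lemma RegularPath.segment_shift_of_le (hW : IsOpen W) {z : RegularPath W} {t δ : ℝ≥0}
    (h : (t : ℝ≥0∞) < z.exit) (hδ : ¬ ((t + δ : ℝ≥0) : ℝ≥0∞) < z.exit) (hfin : z.exit ≠ ⊤)
    (f : E → ℝ) : (z.shift hW t).segment f δ = pathIntegral f z.1 t z.exit.toReal := by
  have h2 : (z.shift hW t).exit ≤ δ := by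
    by_contra! hc
    exact hδ ((add_lt_exit_iff hW).2 ⟨h, hc⟩)
  rw [segment, shift_val hW h, min_eq_left h2, pathIntegral_shiftPath f z.1 t
    ENNReal.toReal_nonneg, ← exit_toReal hW h hfin]

/-- The path integral up to the exit time, cut into pieces of length `δ`. -/
lemma RegularPath.pathIntegral_eq_sum [MeasurableSpace E] [BorelSpace E] (hW : IsOpen W)
    {z : RegularPath W} {δ : ℝ≥0} {K : ℕ} (h1 : ((K * δ : ℝ≥0) : ℝ≥0∞) < z.exit)
    (h2 : ¬ (((K + 1 : ℕ) * δ : ℝ≥0) : ℝ≥0∞) < z.exit) (hfin : z.exit ≠ ⊤) {f : E → ℝ}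
    (hf : Measurable f) {C : ℝ} (hfC : ∀ x, |f x| ≤ C) :
    pathIntegral f z.1 0 z.exit.toReal
      = ∑ k ∈ Finset.range (K + 1), (z.shift hW (k * δ)).segment f δ := by
  have hadd : ∀ k : ℕ, ((k + 1 : ℕ) * δ : ℝ≥0) = k * δ + δ := fun k => by push_cast; ring
  have key : ∀ n ≤ K, ∑ k ∈ Finset.range n, (z.shift hW (k * δ)).segment f δ
      = pathIntegral f z.1 0 ((n * δ : ℝ≥0) : ℝ) := by
    intro n hn
    induction n with
    | zero => simp [pathIntegral]
    | succ n ih =>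
      rw [Finset.sum_range_succ, ih (by omega), segment_shift_of_lt hW, z.pathIntegral_add hf hfC,
        hadd, NNReal.coe_add]
      rw [← hadd]
      refine lt_of_le_of_lt (ENNReal.coe_le_coe.2 ?_) h1
      gcongr
  rw [Finset.sum_range_succ, key K le_rfl, segment_shift_of_le hW h1 (by rwa [← hadd]) hfin,
    z.pathIntegral_add hf hfC]

/-- Running a single path is a renewal scheme. -/
lemma IsRenewalLaw.isRenewalScheme [MeasurableSpace E] [BorelSpace E] {hW : IsOpen W}
    {ν : Measure (RegularPath W)} [IsProbabilityMeasure ν] (h : IsRenewalLaw hW ν) (δ : ℝ≥0) :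
    IsRenewalScheme δ ν ν (fun k => {z | ((k * δ : ℝ≥0) : ℝ≥0∞) < z.exit})
      fun k z => z.shift hW (k * δ) where
  measurableSet k := measurableSet_lt measurable_const (RegularPath.measurable_exit hW)
  measurable k := RegularPath.measurable_shift hW _
  ae_zero := by simpa using h.exit_pos
  succ k := by
    ext z
    have : ((k + 1 : ℕ) * δ : ℝ≥0) = k * δ + δ := by push_cast; ring
    simp only [Set.mem_ofPred_eq, this, RegularPath.add_lt_exit_iff hW]
    rfl
  map_eq k := by
    ext B hB
    rw [Measure.map_apply (RegularPath.measurable_shift hW _) hB,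
      Measure.restrict_apply (RegularPath.measurable_shift hW _ hB), Set.inter_comm,
      h.renewal _ _ hB, h.measure_lt_exit]
    rfl

variable {R : ℕ}

/-- The number of times that the processor `r` occurs among the first `k` members of the
sequence `ρ`. -/
def visits (ρ : ℕ → Fin R) (r : Fin R) (k : ℕ) : ℕ := Nat.count (fun j => ρ j = r) k

lemma visits_succ (ρ : ℕ → Fin R) (r : Fin R) (k : ℕ) :
    visits ρ r (k + 1) = visits ρ r k + if ρ k = r then 1 else 0 := Nat.count_succ _ _

/-- Each position is served by exactly one processor. This is what makes the product of the survival
probabilities the `k`-th power for every order. -/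
lemma sum_visits (ρ : ℕ → Fin R) (k : ℕ) : ∑ r, visits ρ r k = k := by
  induction k with
  | zero => simp [visits]
  | succ k ih => simp [visits_succ, Finset.sum_add_distrib, ih]

lemma measurable_visits (r : Fin R) (k : ℕ) : Measurable fun ρ : ℕ → Fin R => visits ρ r k := by
  induction k with
  | zero => simp [visits]
  | succ k ih =>
    simp only [visits_succ]
    have h1 : MeasurableSet {ρ : ℕ → Fin R | ρ k = r} :=
      (measurable_pi_apply (X := fun _ => Fin R) k) (measurableSet_singleton r)
    exact ih.add (Measurable.ite h1 measurable_const measurable_const)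

/-- The event that the first `k` path segments stay in `W`, when the processors work in the
order `ρ`. -/
def survivalSet (W : Set E) (δ : ℝ≥0) (k : ℕ) : Set ((ℕ → Fin R) × (Fin R → RegularPath W)) :=
  {x | ∀ r, ((visits x.1 r k * δ : ℝ≥0) : ℝ≥0∞) < (x.2 r).exit}

/-- The path which is run in the `k`-th position, when the processors work in the order `ρ`. -/
def currentPath (hW : IsOpen W) (δ : ℝ≥0) (k : ℕ) (x : (ℕ → Fin R) × (Fin R → RegularPath W)) :
    RegularPath W :=
  (x.2 (x.1 k)).shift hW (visits x.1 (x.1 k) k * δ)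

/-- At position `k` only the processor `ρ k` advances, by one segment. -/
lemma survivalSet_succ (hW : IsOpen W) (δ : ℝ≥0) (k : ℕ) :
    survivalSet (R := R) W δ (k + 1)
      = survivalSet W δ k ∩ {x | (δ : ℝ≥0∞) < (currentPath hW δ k x).exit} := by
  have hadd : ∀ k : ℕ, ((k + 1 : ℕ) * δ : ℝ≥0) = k * δ + δ := fun k => by push_cast; ring
  ext x
  simp only [survivalSet, Set.mem_ofPred_eq, Set.mem_inter_iff, visits_succ]
  constructor
  · intro h
    refine ⟨fun r => lt_of_le_of_lt (ENNReal.coe_le_coe.2 ?_) (h r), ?_⟩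
    · gcongr
      exact le_self_add
    · have := h (x.1 k)
      rw [if_pos rfl, hadd, RegularPath.add_lt_exit_iff hW] at this
      exact this.2
  · rintro ⟨h1, h2⟩ r
    by_cases hr : x.1 k = r
    · subst hr
      rw [if_pos rfl, hadd, RegularPath.add_lt_exit_iff hW]
      exact ⟨h1 _, h2⟩
    · rw [if_neg hr, add_zero]
      exact h1 r

variable [MeasurableSpace E] [BorelSpace E]

lemma measurableSet_survivalSet (hW : IsOpen W) (δ : ℝ≥0) (k : ℕ) :
    MeasurableSet (survivalSet (R := R) W δ k) := by
  have : survivalSet (R := R) W δ k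
      = ⋂ r, {x | ((visits x.1 r k * δ : ℝ≥0) : ℝ≥0∞) < (x.2 r).exit} := by
    ext
    simp [survivalSet]
  rw [this]
  refine .iInter fun r => measurableSet_lt ?_ ?_
  · have h1 : Measurable fun n : ℕ => ((n * δ : ℝ≥0) : ℝ≥0∞) := measurable_from_top
    exact h1.comp ((measurable_visits r k).comp measurable_fst)
  · exact (RegularPath.measurable_exit hW).comp ((measurable_pi_apply r).comp measurable_snd)

/-- The processor and its shift time depend on the order only through a pair with countably many
values. -/
lemma measurable_currentPath (hW : IsOpen W) (δ : ℝ≥0) (k : ℕ) :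
    Measurable (currentPath (R := R) hW δ k) := by
  have h1 : Measurable fun q : (Fin R × ℕ) × (Fin R → RegularPath W) =>
      (q.2 q.1.1).shift hW (q.1.2 * δ) :=
    measurable_from_prod_countable_right fun q => by
      have hq : Measurable fun y : Fin R → RegularPath W => y q.1 := measurable_pi_apply q.1
      exact (RegularPath.measurable_shift hW (q.2 * δ)).comp hq
  have h2 : Measurable fun q : Fin R × (ℕ → Fin R) => visits q.2 q.1 k :=
    measurable_from_prod_countable_right fun r => measurable_visits r k
  have h3 : Measurable fun ρ : ℕ → Fin R => ρ k := measurable_pi_apply k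
  have h4 : Measurable fun ρ : ℕ → Fin R => visits ρ (ρ k) k := by
    have h6 : Measurable fun ρ : ℕ → Fin R => (ρ k, ρ) := h3.prodMk measurable_id
    exact h2.comp h6
  have h5 : Measurable fun x : (ℕ → Fin R) × (Fin R → RegularPath W) =>
      ((x.1 k, visits x.1 (x.1 k) k), x.2) :=
    ((h3.comp measurable_fst).prodMk (h4.comp measurable_fst)).prodMk measurable_snd
  have h6 := h1.comp h5
  exact h6

/-- Running independent paths in parallel, in an independent order, is a renewal scheme. -/
theorem IsRenewalLaw.isRenewalScheme_parallel {hW : IsOpen W} {ν : Measure (RegularPath W)}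
    [IsProbabilityMeasure ν] (h : IsRenewalLaw hW ν) (δ : ℝ≥0) (m : Measure (ℕ → Fin R))
    [IsProbabilityMeasure m] :
    IsRenewalScheme δ ν (m.prod (Measure.pi fun _ : Fin R => ν)) (survivalSet W δ)
      (currentPath hW δ) where
  measurableSet := measurableSet_survivalSet hW δ
  measurable := measurable_currentPath hW δ
  ae_zero := by
    have h1 : ∀ r : Fin R, ∀ᵐ x ∂(m.prod (Measure.pi fun _ : Fin R => ν)), 0 < (x.2 r).exit := by
      intro r
      have h2 : ∀ᵐ z ∂(Measure.pi fun _ : Fin R => ν), 0 < (z r).exit :=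
        (measurePreserving_eval (fun _ : Fin R => ν) r).quasiMeasurePreserving.ae h.exit_pos
      exact Measure.quasiMeasurePreserving_snd.ae h2
    filter_upwards [ae_all_iff.2 h1] with x hx r
    simpa [visits] using hx r
  succ := survivalSet_succ hW δ
  map_eq k := by
    ext B hB
    have hYB := measurable_currentPath (R := R) hW δ k hB
    rw [Measure.map_apply (measurable_currentPath hW δ k) hB, Measure.restrict_apply hYB,
      Measure.prod_apply (hYB.inter (measurableSet_survivalSet hW δ k))]
    -- For a fixed order the event is a product over the processors, with an extra condition only
    -- for `ρ k`. Renewal gives a factor `p ^ visits` for each processor and `ν B` for that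
    -- condition. The result does not involve `ρ`, so integrating over the order changes nothing.
    have key : ∀ ρ : ℕ → Fin R, (Measure.pi fun _ : Fin R => ν)
        (Prod.mk ρ ⁻¹' (currentPath hW δ k ⁻¹' B ∩ survivalSet W δ k))
        = ν {z | (δ : ℝ≥0∞) < z.exit} ^ k * ν B := by
      intro ρ
      have hset : Prod.mk ρ ⁻¹' (currentPath hW δ k ⁻¹' B ∩ survivalSet W δ k)
          = Set.univ.pi fun r => {z : RegularPath W |
              ((visits ρ r k * δ : ℝ≥0) : ℝ≥0∞) < z.exit} ∩
              if r = ρ k then (RegularPath.shift hW (visits ρ r k * δ)) ⁻¹' B else Set.univ := by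
        ext z
        simp only [Set.mem_preimage, Set.mem_inter_iff, survivalSet, Set.mem_ofPred_eq,
          Set.mem_univ_pi]
        constructor
        · rintro ⟨h1, h2⟩ r
          refine ⟨h2 r, ?_⟩
          by_cases hr : r = ρ k
          · rw [if_pos hr, hr]
            exact h1
          · rw [if_neg hr]
            trivial
        · intro h1
          refine ⟨?_, fun r => (h1 r).1⟩
          have := (h1 (ρ k)).2
          rw [if_pos rfl] at this
          exact this
      have hr : ∀ r, ν ({z : RegularPath W | ((visits ρ r k * δ : ℝ≥0) : ℝ≥0∞) < z.exit} ∩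
          if r = ρ k then (RegularPath.shift hW (visits ρ r k * δ)) ⁻¹' B else Set.univ)
          = ν {z | (δ : ℝ≥0∞) < z.exit} ^ visits ρ r k * if r = ρ k then ν B else 1 := by
        intro r
        by_cases hr : r = ρ k
        · rw [if_pos hr, if_pos hr, h.renewal _ _ hB, h.measure_lt_exit]
        · rw [if_neg hr, if_neg hr, Set.inter_univ, h.measure_lt_exit, mul_one]
      rw [hset, Measure.pi_pi]
      simp_rw [hr]
      rw [Finset.prod_mul_distrib, Finset.prod_pow_eq_pow_sum, sum_visits]
      simp
    simp_rw [key]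
    simp

end ParallelScheme

/-! ### Wall-clock orders -/

section Orders

variable {R : ℕ}

/-- The pairs (processor, index of its path segment), when the processors work in the order `ρ`. -/
def parallelOrder (ρ : ℕ → Fin R) (k : ℕ) : Fin R × ℕ := (ρ k, visits ρ (ρ k) k)

lemma IsWallClockOrder.injective {w : Fin R → ℕ → ℝ≥0} {κ : ℕ → Fin R × ℕ}
    (h : IsWallClockOrder w κ) : Function.Injective κ := fun i j hij =>
  h.2.injective (by simp only [hij])

/-- Monotone clocks make each processor serve its segments in their natural order, so the index of a
segment is the number of earlier visits. The order is thus encoded by its sequence of processors. -/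
lemma IsWallClockOrder.eq_parallelOrder {w : Fin R → ℕ → ℝ≥0} {κ : ℕ → Fin R × ℕ}
    (h : IsWallClockOrder w κ) (hw : ∀ r, Monotone (w r)) :
    κ = parallelOrder fun k => (κ k).1 := by
  set ρ : ℕ → Fin R := fun k => (κ k).1 with hρ
  -- A larger index would place the skipped pair at a strictly later wall-clock time, against
  -- monotonicity. A smaller one would repeat a pair already used.
  have hstep : ∀ k, (∀ r m, (∃ j < k, κ j = (r, m)) ↔ m < visits ρ r k) →
      κ k = (ρ k, visits ρ (ρ k) k) := by
    intro k hk
    refine Prod.ext rfl (le_antisymm ?_ ?_)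
    · by_contra! hlt
      obtain ⟨j, hj⟩ := h.1 (ρ k, visits ρ (ρ k) k)
      have hjk : ¬ j < k := fun hjk => lt_irrefl _ ((hk _ _).1 ⟨j, hjk, hj⟩)
      have hne : k ≠ j := by
        rintro rfl
        rw [hj] at hlt
        exact lt_irrefl _ hlt
      have h1 := h.2 (lt_of_le_of_ne (not_lt.1 hjk) hne)
      simp only [hj] at h1
      exact absurd (hw (ρ k) hlt.le) (not_le.2 h1)
    · by_contra! hlt
      obtain ⟨j, hj, hjk⟩ := (hk (ρ k) (κ k).2).2 hlt
      exact hj.ne (h.injective hjk)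
  have hinv : ∀ k r m, (∃ j < k, κ j = (r, m)) ↔ m < visits ρ r k := by
    intro k
    induction k with
    | zero => simp [visits]
    | succ k ih =>
      intro r m
      have h1 : (∃ j < k + 1, κ j = (r, m)) ↔ (∃ j < k, κ j = (r, m)) ∨ κ k = (r, m) := by
        constructor
        · rintro ⟨j, hj, hjr⟩
          rcases (Nat.lt_succ_iff.1 hj).lt_or_eq with h | rfl
          · exact Or.inl ⟨j, h, hjr⟩
          · exact Or.inr hjr
        · rintro (⟨j, hj, hjr⟩ | hk)
          · exact ⟨j, hj.trans k.lt_succ_self, hjr⟩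
          · exact ⟨k, k.lt_succ_self, hk⟩
      rw [h1, ih, visits_succ, hstep k ih, Prod.mk.injEq]
      by_cases hr : ρ k = r
      · subst hr
        simp only [true_and, if_true]
        omega
      · simp [hr]
  funext k
  exact hstep k (hinv k)

/-- The wall-clock times for which the processors take turns. -/
def turnTime (r : Fin R) (m : ℕ) : ℝ≥0 := (m * R + r : ℕ)

/-- The order in which the processors take turns. -/
def turnOrder [NeZero R] (k : ℕ) : Fin R × ℕ := (⟨k % R, Nat.mod_lt _ (NeZero.pos R)⟩, k / R)

lemma isWallClockOrder_turnOrder [NeZero R] : IsWallClockOrder (turnTime (R := R)) turnOrder := by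
  constructor
  · rintro ⟨r, m⟩
    refine ⟨m * R + r, ?_⟩
    rw [turnOrder, Prod.mk.injEq]
    constructor
    · ext
      simp [Nat.mod_eq_of_lt r.2]
    · rw [add_comm, Nat.add_mul_div_right _ _ (NeZero.pos R), Nat.div_eq_of_lt r.2, zero_add]
  · intro j k hjk
    simp only [turnTime, turnOrder, Nat.div_add_mod']
    exact_mod_cast hjk

lemma monotone_turnTime (r : Fin R) : Monotone (turnTime r) := by
  intro a b hab
  unfold turnTime
  gcongr

lemma wallClockOrder_spec [NeZero R] {w : Fin R → ℕ → ℝ≥0} (h : ∃ κ, IsWallClockOrder w κ) :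
    IsWallClockOrder w (wallClockOrder w) := Classical.epsilon_spec h

/-- A pair has position `k` if exactly `k` pairs precede it. There are countably many candidates `S`
for the set of its predecessors, which makes the chosen order measurable in the wall-clock times. -/
lemma IsWallClockOrder.eq_iff {w : Fin R → ℕ → ℝ≥0} {κ : ℕ → Fin R × ℕ}
    (h : IsWallClockOrder w κ) (k : ℕ) (c : Fin R × ℕ) :
    κ k = c ↔ ∃ S : Finset (Fin R × ℕ), S.card = k ∧ (∀ b ∈ S, w b.1 b.2 < w c.1 c.2) ∧
      ∀ b ∉ S, w c.1 c.2 ≤ w b.1 b.2 := by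
  constructor
  · rintro rfl
    refine ⟨(Finset.range k).image κ, ?_, ?_, ?_⟩
    · rw [Finset.card_image_of_injective _ h.injective, Finset.card_range]
    · intro b hb
      obtain ⟨j, hj, rfl⟩ := Finset.mem_image.1 hb
      exact h.2 (Finset.mem_range.1 hj)
    · intro b hb
      obtain ⟨j, rfl⟩ := h.1 b
      refine h.2.monotone (not_lt.1 fun hj => hb ?_)
      exact Finset.mem_image_of_mem _ (Finset.mem_range.2 hj)
  · rintro ⟨S, hS, h1, h2⟩
    obtain ⟨i, rfl⟩ := h.1 c
    have : S = (Finset.range i).image κ := by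
      ext b
      obtain ⟨j, rfl⟩ := h.1 b
      rw [h.injective.mem_finset_image, Finset.mem_range, ← h.2.lt_iff_lt]
      exact ⟨h1 _, fun hlt => by_contra fun hb => absurd hlt (not_lt.2 (h2 _ hb))⟩
    rw [this, Finset.card_image_of_injective _ h.injective, Finset.card_range] at hS
    rw [hS]

/-- The wall-clock times which are ordered, processor by processor and altogether. -/
abbrev WallClock (R : ℕ) : Type :=
  {w : Fin R → ℕ → ℝ≥0 // (∀ r, Monotone (w r)) ∧ ∃ κ, IsWallClockOrder w κ}

/-- The sequence of processors in the order of the wall-clock times `w`. -/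
def WallClock.processors [NeZero R] (w : WallClock R) (k : ℕ) : Fin R := (wallClockOrder w.1 k).1

lemma WallClock.parallelOrder_processors [NeZero R] (w : WallClock R) :
    wallClockOrder w.1 = parallelOrder w.processors :=
  (wallClockOrder_spec w.2.2).eq_parallelOrder w.2.1

lemma WallClock.measurable_processors [NeZero R] : Measurable (WallClock.processors (R := R)) := by
  refine measurable_pi_lambda _ fun k => ?_
  have hval : ∀ b : Fin R × ℕ, Measurable fun w : WallClock R => w.1 b.1 b.2 := fun b => by
    have h1 : Measurable fun w : Fin R → ℕ → ℝ≥0 => w b.1 := measurable_pi_apply _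
    have h2 : Measurable fun v : ℕ → ℝ≥0 => v b.2 := measurable_pi_apply _
    have h3 := (h2.comp h1).comp (measurable_subtype_coe (p := fun w : Fin R → ℕ → ℝ≥0 =>
      (∀ r, Monotone (w r)) ∧ ∃ κ, IsWallClockOrder w κ))
    exact h3
  have h1 : Measurable fun w : WallClock R => wallClockOrder w.1 k := by
    refine measurable_to_countable' fun c => ?_
    have : (fun w : WallClock R => wallClockOrder w.1 k) ⁻¹' {c}
        = ⋃ S : Finset (Fin R × ℕ), {w | S.card = k ∧ (∀ b ∈ S, w.1 b.1 b.2 < w.1 c.1 c.2) ∧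
          ∀ b ∉ S, w.1 c.1 c.2 ≤ w.1 b.1 b.2} := by
      ext w
      simp only [Set.mem_preimage, Set.mem_singleton_iff, Set.mem_iUnion]
      exact (wallClockOrder_spec w.2.2).eq_iff k c
    rw [this]
    have h2 : ∀ S : Finset (Fin R × ℕ),
        MeasurableSet {w : WallClock R | ∀ b ∈ S, w.1 b.1 b.2 < w.1 c.1 c.2} := by
      intro S
      simp only [Set.ofPred_forall]
      exact .iInter fun b => .iInter fun _ => measurableSet_lt (hval b) (hval c)
    have h3 : ∀ S : Finset (Fin R × ℕ),
        MeasurableSet {w : WallClock R | ∀ b ∉ S, w.1 c.1 c.2 ≤ w.1 b.1 b.2} := by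
      intro S
      simp only [Set.ofPred_forall]
      exact .iInter fun b => .iInter fun _ => measurableSet_le (hval c) (hval b)
    exact .iUnion fun S => .inter (.const _) (.inter (h2 S) (h3 S))
  exact measurable_fst.comp h1

end Orders

/-! ### Pathwise identification of the parallel steps with the scheme -/

section Pathwise

variable {E : Type*} [MetricSpace E] {W : Set E} {R : ℕ}

lemma ofReal_add_one_mul (m : ℕ) (δ : ℝ≥0) :
    ENNReal.ofReal (((m : ℝ) + 1) * δ) = ((m * δ + δ : ℝ≥0) : ℝ≥0∞) := by
  rw [← ENNReal.ofReal_coe_nnreal]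
  congr 1
  push_cast
  ring

/-- As long as all earlier segments have survived, the stopping criterion at position `k` says that
the `k`-th segment leaves `W`. The first such position is the last one whose survival event holds.
-/
lemma asyncK_eq (hW : IsOpen W) {δ : ℝ≥0} {x : (ℕ → Fin R) × (Fin R → RegularPath W)} {K : ℕ}
    (hK : x ∈ survivalSet W δ K) (hK' : x ∉ survivalSet W δ (K + 1)) :
    asyncK W δ (fun r => (x.2 r).1) (parallelOrder x.1) = K := by
  have hanti : Antitone (survivalSet (R := R) W δ) := antitone_nat_of_succ_le fun k => by
    rw [survivalSet_succ hW δ k]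
    exact Set.inter_subset_left
  have hiff : ∀ k, x ∈ survivalSet W δ k →
      (exitTime W (x.2 (parallelOrder x.1 k).1).1
        ≤ ENNReal.ofReal ((((parallelOrder x.1 k).2 : ℝ) + 1) * δ)
        ↔ x ∉ survivalSet W δ (k + 1)) := by
    intro k hk
    rw [ofReal_add_one_mul, survivalSet_succ hW δ k, ← not_lt, not_iff_not]
    refine (RegularPath.add_lt_exit_iff hW).trans ?_
    exact ⟨fun h => ⟨hk, h.2⟩, fun h => ⟨hk (x.1 k), h.2⟩⟩
  refine le_antisymm (Nat.sInf_le ((hiff K hK).2 hK'))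
    (le_csInf ⟨K, (hiff K hK).2 hK'⟩ fun k hk => ?_)
  by_contra! hlt
  exact (hiff k (hanti hlt.le hK)).1 hk (hanti hlt hK)

lemma asyncPar_eq (hW : IsOpen W) {δ : ℝ≥0} {x : (ℕ → Fin R) × (Fin R → RegularPath W)} {K : ℕ}
    (hK : x ∈ survivalSet W δ K) (hK' : x ∉ survivalSet W δ (K + 1))
    (hfin : ∀ r, (x.2 r).exit ≠ ⊤) (f : E → ℝ) :
    asyncPar W δ (fun r => (x.2 r).1) (parallelOrder x.1) f
      = ∑ k ∈ Finset.range (K + 1), (currentPath hW δ k x).segment f δ := by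
  have hanti : Antitone (survivalSet (R := R) W δ) := antitone_nat_of_succ_le fun k => by
    rw [survivalSet_succ hW δ k]
    exact Set.inter_subset_left
  have hs : ∀ k, x ∈ survivalSet W δ k → (x ∈ survivalSet W δ (k + 1) ↔
      ((visits x.1 (x.1 k) k * δ + δ : ℝ≥0) : ℝ≥0∞) < (x.2 (x.1 k)).exit) := by
    intro k hk
    rw [survivalSet_succ hW δ k, RegularPath.add_lt_exit_iff hW]
    exact ⟨fun h => ⟨hk (x.1 k), h.2⟩, fun h => ⟨hk, h.2⟩⟩
  rw [asyncPar, asyncK_eq hW hK hK', Finset.sum_range_succ]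
  congr 1
  · refine Finset.sum_congr rfl fun k hk => ?_
    have hkK := Finset.mem_range.1 hk
    rw [currentPath, RegularPath.segment_shift_of_lt hW
      ((hs k (hanti hkK.le hK)).1 (hanti hkK hK))]
    simp only [parallelOrder, NNReal.coe_mul, NNReal.coe_natCast]
    congr 1
    ring
  · rw [currentPath, RegularPath.segment_shift_of_le hW (hK _) (fun h => hK' ((hs K hK).2 h))
      (hfin _)]
    simp only [parallelOrder, NNReal.coe_mul, NNReal.coe_natCast]
    rfl

lemma RegularPath.segment_one (δ : ℝ≥0) (z : RegularPath W) :
    z.segment (fun _ => 1) δ = (min z.exit δ).toReal := by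
  rw [segment, pathIntegral_one, sub_zero]

lemma asyncTime_eq (hW : IsOpen W) {δ : ℝ≥0} {x : (ℕ → Fin R) × (Fin R → RegularPath W)} {K : ℕ}
    (hK : x ∈ survivalSet W δ K) (hK' : x ∉ survivalSet W δ (K + 1))
    (hfin : ∀ r, (x.2 r).exit ≠ ⊤) :
    asyncTime W δ (fun r => (x.2 r).1) (parallelOrder x.1)
      = K * δ + (currentPath hW δ K x).exit.toReal := by
  have hanti : Antitone (survivalSet (R := R) W δ) := antitone_nat_of_succ_le fun k => by
    rw [survivalSet_succ hW δ k]
    exact Set.inter_subset_left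
  rw [asyncTime, asyncPar_eq hW hK hK' hfin, Finset.sum_range_succ]
  congr 1
  · have h1 : ∀ k ∈ Finset.range K, (currentPath hW δ k x).segment (fun _ => 1) δ = δ := by
      intro k hk
      have h2 := hanti (Nat.succ_le_of_lt (Finset.mem_range.1 hk)) hK
      rw [survivalSet_succ hW δ k] at h2
      rw [RegularPath.segment_one, min_eq_right (le_of_lt h2.2), ENNReal.coe_toReal]
    rw [Finset.sum_congr rfl h1]
    simp
  · rw [RegularPath.segment_one, min_eq_left]
    by_contra! hc
    exact hK' (by rw [survivalSet_succ hW δ K]; exact ⟨hK, hc⟩)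

lemma asyncExit_eq (hW : IsOpen W) {δ : ℝ≥0} {x : (ℕ → Fin R) × (Fin R → RegularPath W)} {K : ℕ}
    (hK : x ∈ survivalSet W δ K) (hK' : x ∉ survivalSet W δ (K + 1))
    (hfin : ∀ r, (x.2 r).exit ≠ ⊤) :
    asyncExit W δ (fun r => (x.2 r).1) (parallelOrder x.1) = (currentPath hW δ K x).exitPoint := by
  rw [asyncExit, asyncK_eq hW hK hK', currentPath, RegularPath.exitPoint_shift hW (hK _) (hfin _)]
  rfl

/-- Synchronous steps are asynchronous steps in which the processors take turns. -/
lemma sync_eq_async {E : Type*} {W : Set E} [NeZero R] {Δ : ℝ} (hΔ : 0 < Δ)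
    {z : Fin R → ℝ≥0 → E} (hfin : ∃ r, exitTime W (z r) ≠ ⊤) :
    (∀ f, syncPar W Δ z f = asyncPar W Δ z turnOrder f) ∧
      syncExit W Δ z = asyncExit W Δ z turnOrder := by
  set S := {n : ℕ | 1 ≤ n ∧ ∃ r, exitTime W (z r) ≤ ENNReal.ofReal (n * Δ)} with hS
  have hSne : S.Nonempty := by
    obtain ⟨r, hr⟩ := hfin
    obtain ⟨n, hn⟩ := exists_nat_ge ((exitTime W (z r)).toReal / Δ)
    rw [div_le_iff₀ hΔ] at hn
    -- The successor guarantees the constraint `1 ≤ n` in the definition of `syncN`.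
    refine ⟨n + 1, Nat.le_add_left _ _, r, ?_⟩
    rw [← ENNReal.ofReal_toReal hr]
    refine ENNReal.ofReal_le_ofReal (hn.trans ?_)
    gcongr
    simp
  obtain ⟨hN1, hNr⟩ : syncN W Δ z ∈ S := Nat.sInf_mem hSne
  have hJ : IsLeast {r | exitTime W (z r) ≤ ENNReal.ofReal (syncN W Δ z * Δ)} (syncJ W Δ z) := by
    refine Classical.epsilon_spec (p := fun j => IsLeast
      {r | exitTime W (z r) ≤ ENNReal.ofReal (syncN W Δ z * Δ)} j) ?_
    exact ⟨_, wellFounded_lt.min_mem _ hNr, fun r hr => not_lt.1 (wellFounded_lt.not_lt_min _ hr)⟩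
  obtain ⟨M, hM⟩ : ∃ M, syncN W Δ z = M + 1 := ⟨syncN W Δ z - 1, by omega⟩
  have hcast : (syncN W Δ z : ℝ) = (M : ℝ) + 1 := by rw [hM]; push_cast; ring
  set J := syncJ W Δ z with hJdef
  have hR := NeZero.pos R
  have hturn : ∀ (m : ℕ) (r : Fin R), turnOrder (m * R + r) = (r, m) := by
    intro m r
    rw [turnOrder, Prod.mk.injEq]
    constructor
    · ext
      simp [Nat.mod_eq_of_lt r.2]
    · rw [add_comm, Nat.add_mul_div_right _ _ hR, Nat.div_eq_of_lt r.2, zero_add]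
  -- With `N = M + 1` there are `M` complete rounds of `R` segments, followed by the processors
  -- before `J` in the last round.
  have hK : asyncK W Δ z turnOrder = M * R + J := by
    have hmem : M * R + J ∈ {k : ℕ | exitTime W (z (turnOrder k).1)
        ≤ ENNReal.ofReal (((turnOrder (R := R) k).2 + 1) * Δ)} := by
      rw [Set.mem_ofPred_eq, hturn, ← hcast]
      exact hJ.1
    refine le_antisymm (Nat.sInf_le hmem) (le_csInf ⟨_, hmem⟩ fun k hk => ?_)
    by_contra! hlt
    -- An earlier stopping position would lie in round `M` by minimality of `N`, and there its
    -- processor would be at least `J` by minimality of `J`.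
    have hkN : syncN W Δ z ≤ k / R + 1 := by
      refine Nat.sInf_le ⟨Nat.le_add_left _ _, (turnOrder k).1, ?_⟩
      push_cast
      exact hk
    have hdiv : k / R = M := by
      refine le_antisymm ?_ (by omega)
      rw [← Nat.lt_succ_iff, Nat.div_lt_iff_lt_mul hR, Nat.succ_mul]
      have := J.2
      omega
    have h1 : J ≤ (turnOrder k).1 := by
      refine hJ.2 ?_
      rw [Set.mem_ofPred_eq, hcast, ← hdiv]
      exact hk
    have h2 : (J : ℕ) ≤ k % R := h1
    have h3 := Nat.div_add_mod' k R
    rw [hdiv] at h3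
    omega
  have hsum : ∀ g : Fin R × ℕ → ℝ, ∀ M : ℕ, ∑ k ∈ Finset.range (M * R), g (turnOrder k)
      = ∑ n ∈ Finset.Icc 1 M, ∑ r, g (r, n - 1) := by
    intro g M
    induction M with
    | zero => simp
    | succ M ih =>
      rw [Nat.succ_mul, Finset.sum_range_add, ih, Finset.sum_Icc_succ_top (by omega),
        Finset.sum_range]
      simp only [hturn, Nat.add_sub_cancel]
  have hsum2 : ∀ g : Fin R × ℕ → ℝ, ∑ k ∈ Finset.range J, g (turnOrder (M * R + k))
      = ∑ r ∈ Finset.Iio J, g (r, M) := by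
    intro g
    rw [← Nat.Iio_eq_range, ← Fin.map_valEmbedding_Iio, Finset.sum_map]
    refine Finset.sum_congr rfl fun r _ => ?_
    exact congrArg g (hturn M r)
  constructor
  · intro f
    rw [syncPar, asyncPar, hK, Finset.sum_range_add,
      hsum (fun c => pathIntegral f (z c.1) (c.2 * Δ) ((c.2 + 1) * Δ)),
      hsum2 (fun c => pathIntegral f (z c.1) (c.2 * Δ) ((c.2 + 1) * Δ)), hturn, hcast, hM,
      Nat.add_sub_cancel, ← hJdef, add_sub_cancel_right]
    congr 2
    refine Finset.sum_congr rfl fun n hn => Finset.sum_congr rfl fun r _ => ?_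
    have hn1 := (Finset.mem_Icc.1 hn).1
    simp only [Nat.cast_sub hn1, Nat.cast_one, sub_add_cancel]
  · rw [syncExit, asyncExit, hK, hturn]

end Pathwise

/-! ### Independence and laws of subtype valued variables -/

section Independence

/-- Independence depends only on the generated σ-algebras. It thus passes to path space valued
versions without measurability of the set of regular paths. -/
lemma comap_subtype_val {Ω α : Type*} [m : MeasurableSpace α] {p : α → Prop} (X : Ω → Subtype p) :
    MeasurableSpace.comap X Subtype.instMeasurableSpace = m.comap fun ω => (X ω).1 :=
  MeasurableSpace.comap_comp

lemma comap_pi_subtype_val {Ω ι α : Type*} [MeasurableSpace α] {p : α → Prop}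
    (X : Ω → ι → Subtype p) :
    MeasurableSpace.comap X MeasurableSpace.pi
      = MeasurableSpace.comap (fun ω i => (X ω i).1) MeasurableSpace.pi := by
  simp only [MeasurableSpace.pi, MeasurableSpace.comap_iSup, MeasurableSpace.comap_comp]
  exact iSup_congr fun i => comap_subtype_val fun ω => X ω i

/-- Two random variables with values in a subtype are equal in law if their values are. -/
lemma map_subtype_eq {Ω Ω' α : Type*} [MeasurableSpace Ω] [MeasurableSpace Ω']
    [MeasurableSpace α] {p : α → Prop} {P : Measure Ω} {P' : Measure Ω'}
    {X : Ω → Subtype p} {X' : Ω' → Subtype p} (hX : Measurable X)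
    (hX' : Measurable X') (h : P.map (fun ω => (X ω).1) = P'.map fun ω => (X' ω).1) :
    P.map X = P'.map X' := by
  ext B hB
  obtain ⟨B', hB', rfl⟩ := hB
  have h1 := congrArg (fun m => m B') h
  have h2 : Measurable fun ω => (X ω).1 := measurable_subtype_coe.comp hX
  have h3 : Measurable fun ω => (X' ω).1 := measurable_subtype_coe.comp hX'
  rw [Measure.map_apply hX (measurable_subtype_coe hB'),
    Measure.map_apply hX' (measurable_subtype_coe hB')]
  simp only [Measure.map_apply h2 hB', Measure.map_apply h3 hB'] at h1
  exact h1

end Independence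

/-! ### Comparison of the parallel step with a single path -/

/-- The law of the path of a process which is started from its quasistationary distribution. -/
theorem PDMP.IsRealization.isRenewalLaw {d : ℕ} {D : PDMP d} {Ω : Type*} [MeasurableSpace Ω]
    {P : Measure Ω} [IsProbabilityMeasure P] {Z : ℝ≥0 → Ω → State d} (hZ : D.IsRealization P Z)
    {W : Set (State d)} (hW : IsOpen W) {μ : Measure (State d)} (hμ : IsQSD P Z W μ)
    (hfin : ∀ᵐ ω ∂P, exitTime W (fun t => Z t ω) < ⊤) {Y : Ω → RegularPath W} (hY : Measurable Y)
    (hYZ : ∀ᵐ ω ∂P, (Y ω).1 = fun t => Z t ω) : IsRenewalLaw hW (P.map Y) where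
  exit_pos := by
    rw [ae_map_iff hY.aemeasurable
      (measurableSet_lt measurable_const (RegularPath.measurable_exit hW))]
    have h0 : ∀ᵐ ω ∂P, Z 0 ω ∈ W := by
      have hμp : IsProbabilityMeasure μ := by
        rw [← hμ.initial]
        exact Measure.isProbabilityMeasure_map (hZ.1 0).aemeasurable
      have h1 : ∀ᵐ x ∂(P.map (Z 0)), x ∈ W := by
        rw [hμ.initial]
        exact (mem_ae_iff_prob_eq_one hW.measurableSet).2 hμ.support
      exact ae_of_ae_map (hZ.1 0).aemeasurable h1
    filter_upwards [h0, hYZ] with ω h0 h1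
    have := (lt_exitTime_iff hW (Y ω).2.right_continuous 0).2 fun s hs => by
      rw [le_antisymm hs zero_le, h1]
      exact h0
    exact this
  exit_lt_top := by
    rw [ae_map_iff hY.aemeasurable
      (measurableSet_lt (RegularPath.measurable_exit hW) measurable_const)]
    filter_upwards [hfin, hYZ] with ω h0 h1
    rw [RegularPath.exit, h1]
    exact h0
  renewal t B hB := by
    have hlt : MeasurableSet {z : RegularPath W | (t : ℝ≥0∞) < z.exit} :=
      measurableSet_lt measurable_const (RegularPath.measurable_exit hW)
    rw [Measure.map_apply hY (hlt.inter (RegularPath.measurable_shift hW t hB)),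
      Measure.map_apply hY hlt, Measure.map_apply hY hB]
    -- Measurable sets of the path space are traces of measurable sets of functions, to which the
    -- renewal property applies.
    obtain ⟨B', hB', rfl⟩ := hB
    have h1 := hZ.renewal hW hμ hB' t
    convert h1 using 1
    · refine measure_congr ?_
      filter_upwards [hYZ] with ω hω
      have h2 : (t : ℝ≥0∞) < (Y ω).exit ↔ (t : ℝ≥0∞) < exitTime W fun s => Z s ω := by
        rw [RegularPath.exit, hω]
      refine propext ?_
      change (t : ℝ≥0∞) < (Y ω).exit ∧ ((Y ω).shift hW t).1 ∈ B' ↔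
        (t : ℝ≥0∞) < exitTime W (fun s => Z s ω) ∧ shiftPath t (fun s => Z s ω) ∈ B'
      rw [← h2]
      refine and_congr_right fun h3 => ?_
      rw [RegularPath.shift_val hW h3, hω]
    · congr 1
      · refine measure_congr ?_
        filter_upwards [hYZ] with ω hω
        refine propext ?_
        change (t : ℝ≥0∞) < exitTime W (Y ω).1 ↔ (t : ℝ≥0∞) < exitTime W (fun s => Z s ω)
        rw [hω]
      · refine measure_congr ?_
        filter_upwards [hYZ] with ω hω
        refine propext ?_
        change (Y ω).1 ∈ B' ↔ (fun s => Z s ω) ∈ B'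
        rw [hω]

section Comparison

variable {E : Type*} [MetricSpace E] [MeasurableSpace E] [BorelSpace E] {W : Set E} {hW : IsOpen W}
  {ν : Measure (RegularPath W)} [IsProbabilityMeasure ν] {δ : ℝ≥0}

/-- Any two renewal schemes of paths with the same law agree in their expected total contribution
and in the law of their total duration and exit point. -/
lemma IsRenewalLaw.comparison (hν : IsRenewalLaw hW ν) (hδ : 0 < δ) {Ω Ω' : Type*}
    [MeasurableSpace Ω] [MeasurableSpace Ω'] {P : Measure Ω} {P' : Measure Ω'}
    [IsProbabilityMeasure P] [IsProbabilityMeasure P'] {A : ℕ → Set Ω} {A' : ℕ → Set Ω'}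
    {Y : ℕ → Ω → RegularPath W} {Y' : ℕ → Ω' → RegularPath W} (h : IsRenewalScheme δ ν P A Y)
    (h' : IsRenewalScheme δ ν P' A' Y') {f : E → ℝ} (hf : Measurable f) {C : ℝ}
    (hfC : ∀ x, |f x| ≤ C) {V : Ω → ℝ} {V' : Ω' → ℝ} {U : Ω → ℝ × E} {U' : Ω' → ℝ × E}
    (hV : ∀ᵐ ω ∂P, ∀ K, ω ∈ A K → ω ∉ A (K + 1) →
      V ω = ∑ k ∈ Finset.range (K + 1), (Y k ω).segment f δ)
    (hV' : ∀ᵐ ω ∂P', ∀ K, ω ∈ A' K → ω ∉ A' (K + 1) →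
      V' ω = ∑ k ∈ Finset.range (K + 1), (Y' k ω).segment f δ)
    (hU : ∀ᵐ ω ∂P, ∀ K, ω ∈ A K → ω ∉ A (K + 1) →
      U ω = (K * δ + (Y K ω).exit.toReal, (Y K ω).exitPoint))
    (hU' : ∀ᵐ ω ∂P', ∀ K, ω ∈ A' K → ω ∉ A' (K + 1) →
      U' ω = (K * δ + (Y' K ω).exit.toReal, (Y' K ω).exitPoint)) :
    Integrable V P ∧ Integrable V' P' ∧ ∫ ω, V ω ∂P = ∫ ω, V' ω ∂P' ∧ IdentDistrib U U' P P' := by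
  have hp := hν.measure_lt_exit_lt_one hδ
  obtain ⟨h1, h2⟩ := h.integral_eq hW hp hf hfC hV
  obtain ⟨h1', h2'⟩ := h'.integral_eq hW hp hf hfC hV'
  obtain ⟨h3, h4⟩ := h.map_exit hW hp hU
  obtain ⟨h3', h4'⟩ := h'.map_exit hW hp hU'
  exact ⟨h1, h1', h2.trans h2'.symm, h3, h3',
    Measure.ext fun B hB => (h4 B hB).trans (h4' B hB).symm⟩

end Comparison

/-- Paths which are run in parallel, in an order which is independent of them. -/
theorem PDMP.parallelStep {d R : ℕ} (D : PDMP d) {Ω₀ : Type*} [MeasurableSpace Ω₀]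
    {P₀ : Measure Ω₀} [IsProbabilityMeasure P₀] {Ω : Type*} [MeasurableSpace Ω] {P : Measure Ω}
    [IsProbabilityMeasure P] {W : Set (State d)} (hW : IsOpen W) {μ : Measure (State d)}
    {f : State d → ℝ} (hf : Measurable f) {C : ℝ} (hfC : ∀ x, |f x| ≤ C) {δ : ℝ≥0} (hδ : 0 < δ)
    {Z₀ : ℝ≥0 → Ω₀ → State d} (hZ₀ : D.IsRealization P₀ Z₀) (hμ : IsQSD P₀ Z₀ W μ)
    (hfin : ∀ᵐ ω ∂P₀, exitTime W (fun t => Z₀ t ω) < ⊤)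
    {Z : Fin R → ℝ≥0 → Ω → State d} (hZ : ∀ r, D.IsRealization P (Z r))
    (hZμ : ∀ r, P.map (Z r 0) = μ) (hindep : iIndepFun (fun r ω t => Z r t ω) P)
    {ρ : Ω → ℕ → Fin R} (hρ : Measurable ρ) (hρZ : IndepFun ρ (fun ω r t => Z r t ω) P)
    {κ : Ω → ℕ → Fin R × ℕ} (hκ : ∀ᵐ ω ∂P, κ ω = parallelOrder (ρ ω)) :
    (∀ᵐ ω ∂P, ∀ r, exitTime W (fun t => Z r t ω) ≠ ⊤) ∧
    Integrable (fun ω => asyncPar W δ (fun r t => Z r t ω) (κ ω) f) P ∧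
    Integrable (fun ω => pathIntegral f (fun t => Z₀ t ω) 0
      (exitTime W fun t => Z₀ t ω).toReal) P₀ ∧
    ∫ ω, asyncPar W δ (fun r t => Z r t ω) (κ ω) f ∂P
      = ∫ ω, pathIntegral f (fun t => Z₀ t ω) 0 (exitTime W fun t => Z₀ t ω).toReal ∂P₀ ∧
    IdentDistrib
      (fun ω => (asyncTime W δ (fun r t => Z r t ω) (κ ω),
        asyncExit W δ (fun r t => Z r t ω) (κ ω)))
      (fun ω => ((exitTime W fun t => Z₀ t ω).toReal, Z₀ (exitTime W fun t => Z₀ t ω).toNNReal ω))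
      P P₀ := by
  obtain ⟨Y₀, hY₀, hYZ₀⟩ := exists_regularPath_version hW hZ₀.1 (hZ₀.ae_isRegularPath hW)
  choose Y hY hYZ using fun r =>
    exists_regularPath_version hW (hZ r).1 ((hZ r).ae_isRegularPath hW)
  have hν := hZ₀.isRenewalLaw hW hμ hfin hY₀ hYZ₀
  set ν := P₀.map Y₀ with hνdef
  have hνp : IsProbabilityMeasure ν := Measure.isProbabilityMeasure_map hY₀.aemeasurable
  -- All processes start from `μ`, and the initial law determines the law of the path.
  have hlaw : ∀ r, P.map (Y r) = ν := fun r => by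
    refine map_subtype_eq (hY r) hY₀ ?_
    rw [Measure.map_congr (hYZ r), Measure.map_congr hYZ₀, (hZ r).map_path, hZ₀.map_path, hZμ r,
      hμ.initial]
  have hYall : ∀ᵐ ω ∂P, ∀ r, (Y r ω).1 = fun t => Z r t ω := ae_all_iff.2 hYZ
  have hYm : Measurable fun ω r => Y r ω := measurable_pi_lambda _ hY
  have hYindep : iIndepFun Y P := by
    have h1 : iIndepFun (fun r ω => (Y r ω).1) P :=
      hindep.congr fun r => EventuallyEq.symm (hYZ r)
    rw [iIndepFun_iff_iIndep] at h1 ⊢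
    simpa only [comap_subtype_val] using h1
  have hYpi : P.map (fun ω r => Y r ω) = Measure.pi fun _ : Fin R => ν := by
    rw [hYindep.map_fun_eq_pi_map fun r => (hY r).aemeasurable]
    simp only [hlaw]
  have hρY : IndepFun ρ (fun ω r => Y r ω) P := by
    have h1 : IndepFun ρ (fun ω r => (Y r ω).1) P := by
      refine hρZ.congr ae_eq_rfl ?_
      filter_upwards [hYall] with ω hω
      funext r
      exact (hω r).symm
    rw [IndepFun_iff_Indep] at h1 ⊢
    rwa [comap_pi_subtype_val]
  have hφ : Measurable fun ω => (ρ ω, fun r => Y r ω) := hρ.prodMk hYm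
  have hjoint : P.map (fun ω => (ρ ω, fun r => Y r ω))
      = (P.map ρ).prod (Measure.pi fun _ : Fin R => ν) := by
    rw [(indepFun_iff_map_prod_eq_prod_map_map hρ.aemeasurable hYm.aemeasurable).1 hρY, hYpi]
  have hρp : IsProbabilityMeasure (P.map ρ) := Measure.isProbabilityMeasure_map hρ.aemeasurable
  have hYfin : ∀ᵐ ω ∂P, ∀ r, (Y r ω).exit ≠ ⊤ := ae_all_iff.2 fun r => by
    have h1 := hν.exit_lt_top
    rw [← hlaw r] at h1
    filter_upwards [ae_of_ae_map (hY r).aemeasurable h1] with ω hω using hω.ne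
  have hYfin₀ : ∀ᵐ ω ∂P₀, (Y₀ ω).exit ≠ ⊤ := by
    filter_upwards [ae_of_ae_map hY₀.aemeasurable hν.exit_lt_top] with ω hω using hω.ne
  -- The parallel scheme lives on the product space of orders and path families and is pulled back
  -- along the joint variable. The single path scheme is pulled back along `Y₀`.
  refine ⟨?_, hν.comparison hδ ((hν.isRenewalScheme_parallel δ (P.map ρ)).comp hφ hjoint)
    ((hν.isRenewalScheme δ).comp hY₀ rfl) hf hfC ?_ ?_ ?_ ?_⟩
  · filter_upwards [hYfin, hYall] with ω h1 h2 r
    rw [← h2 r]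
    exact h1 r
  · filter_upwards [hYfin, hYall, hκ] with ω h1 h2 h3 K hK hK'
    have h4 : (fun r t => Z r t ω) = fun r => (Y r ω).1 := funext fun r => (h2 r).symm
    rw [h3, h4]
    exact asyncPar_eq (x := (ρ ω, fun r => Y r ω)) hW hK hK' h1 f
  · filter_upwards [hYfin₀, hYZ₀] with ω h1 h2 K hK hK'
    rw [← h2]
    exact RegularPath.pathIntegral_eq_sum (z := Y₀ ω) hW hK hK' h1 hf hfC
  · filter_upwards [hYfin, hYall, hκ] with ω h1 h2 h3 K hK hK'
    have h4 : (fun r t => Z r t ω) = fun r => (Y r ω).1 := funext fun r => (h2 r).symm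
    rw [h3, h4]
    exact Prod.ext (asyncTime_eq (x := (ρ ω, fun r => Y r ω)) hW hK hK' h1)
      (asyncExit_eq (x := (ρ ω, fun r => Y r ω)) hW hK hK' h1)
  · filter_upwards [hYfin₀, hYZ₀] with ω h1 h2 K hK hK'
    refine Prod.ext ?_ ?_
    · rw [← h2]
      have h3 := RegularPath.exit_toReal (z := Y₀ ω) hW hK h1
      rw [NNReal.coe_mul, NNReal.coe_natCast] at h3
      exact h3
    · have h3 := RegularPath.exitPoint_shift (z := Y₀ ω) hW hK h1
      have h4 : (Y₀ ω).exitPoint = Z₀ (exitTime W fun t => Z₀ t ω).toNNReal ω := by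
        rw [RegularPath.exitPoint, RegularPath.exit, h2]
      exact (h3.trans h4).symm

/-- Wall-clock times which are almost surely ordered have a version which is always ordered. -/
lemma exists_wallClock_version {R : ℕ} [NeZero R] {Ω : Type*} [MeasurableSpace Ω] {P : Measure Ω}
    {t : Fin R → ℕ → Ω → ℝ≥0} (ht : ∀ r m, Measurable (t r m))
    (hmono : ∀ᵐ ω ∂P, ∀ r, Monotone fun m => t r m ω)
    (hord : ∀ᵐ ω ∂P, ∃ κ, IsWallClockOrder (fun r m => t r m ω) κ) :
    ∃ w : Ω → WallClock R, Measurable w ∧ ∀ᵐ ω ∂P, (w ω).1 = fun r m => t r m ω := by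
  have hm : Measurable fun ω r m => t r m ω :=
    measurable_pi_lambda _ fun r => measurable_pi_lambda _ fun m => ht r m
  -- Taking turns shows that ordered wall-clock times exist, so that the values on the null set can
  -- be replaced by ordered ones.
  obtain ⟨g, hg, hgr, hgt⟩ := hm.aemeasurable.exists_ae_eq_range_subset
    (t := {w : Fin R → ℕ → ℝ≥0 | (∀ r, Monotone (w r)) ∧ ∃ κ, IsWallClockOrder w κ})
    (by filter_upwards [hmono, hord] with ω h1 h2 using ⟨h1, h2⟩)
    ⟨turnTime, monotone_turnTime, turnOrder, isWallClockOrder_turnOrder⟩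
  refine ⟨fun ω => ⟨g ω, hgr ⟨ω, rfl⟩⟩, hg.subtype_mk, ?_⟩
  filter_upwards [hgt] with ω hω using hω.symm

end

theorem mainTheorem5 {d R : ℕ} [NeZero R] (D : PDMP d)
    {Ω₀ : Type*} [MeasurableSpace Ω₀] (P₀ : Measure Ω₀) [IsProbabilityMeasure P₀]
    {Ω : Type*} [MeasurableSpace Ω] (P : Measure Ω) [IsProbabilityMeasure P]
    (W : Set (State d)) (hW : IsOpen W) (μ : Measure (State d))
    (f : State d → ℝ) (hf : Measurable f) (hfb : ∃ C, ∀ x, |f x| ≤ C)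
    (Δ : ℝ) (hΔ : 0 < Δ)
    -- the process started from its quasistationary distribution, and its exit time
    (Z₀ : ℝ≥0 → Ω₀ → State d) (hZ₀ : D.IsRealization P₀ Z₀) (hμ : IsQSD P₀ Z₀ W μ)
    (τ : Ω₀ → ℝ≥0∞) (hτ : ∀ ω, τ ω = exitTime W fun t => Z₀ t ω)
    (hτ_fin : ∀ᵐ ω ∂P₀, τ ω < ⊤)
    -- the independent copies used by the parallel steps
    (Z : Fin R → ℝ≥0 → Ω → State d) (hZ : ∀ r, D.IsRealization P (Z r))
    (hZμ : ∀ r, P.map (Z r 0) = μ)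
    (hindep : iIndepFun (fun r ω t => Z r t ω) P) :
    -- the synchronous parallel step
    (Integrable (fun ω => syncPar W Δ (fun r t => Z r t ω) f) P ∧
      Integrable (fun ω => pathIntegral f (fun t => Z₀ t ω) 0 (τ ω).toReal) P₀ ∧
      ∫ ω, syncPar W Δ (fun r t => Z r t ω) f ∂P
        = ∫ ω, pathIntegral f (fun t => Z₀ t ω) 0 (τ ω).toReal ∂P₀ ∧
      IdentDistrib
        (fun ω => (syncTime W Δ (fun r t => Z r t ω), syncExit W Δ (fun r t => Z r t ω)))
        (fun ω => ((τ ω).toReal, Z₀ (τ ω).toNNReal ω)) P P₀) ∧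
    -- the asynchronous parallel step
    (∀ tWall : Fin R → ℕ → Ω → ℝ≥0,
      (∀ r m, Measurable (tWall r m)) →
      IndepFun (fun ω r m => tWall r m ω) (fun ω r t => Z r t ω) P →
      (∀ᵐ ω ∂P, ∀ r, Monotone fun m => tWall r m ω) →
      (∀ᵐ ω ∂P, ∃! κ : ℕ → Fin R × ℕ, IsWallClockOrder (fun r m => tWall r m ω) κ) →
      Integrable (fun ω => asyncPar W Δ (fun r t => Z r t ω)
        (wallClockOrder fun r m => tWall r m ω) f) P ∧
      Integrable (fun ω => pathIntegral f (fun t => Z₀ t ω) 0 (τ ω).toReal) P₀ ∧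
      ∫ ω, asyncPar W Δ (fun r t => Z r t ω) (wallClockOrder fun r m => tWall r m ω) f ∂P
        = ∫ ω, pathIntegral f (fun t => Z₀ t ω) 0 (τ ω).toReal ∂P₀ ∧
      IdentDistrib
        (fun ω => (asyncTime W Δ (fun r t => Z r t ω) (wallClockOrder fun r m => tWall r m ω),
          asyncExit W Δ (fun r t => Z r t ω) (wallClockOrder fun r m => tWall r m ω)))
        (fun ω => ((τ ω).toReal, Z₀ (τ ω).toNNReal ω)) P P₀) := by
  obtain rfl : τ = fun ω => exitTime W fun t => Z₀ t ω := funext hτ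
  obtain ⟨C, hfC⟩ := hfb
  lift Δ to ℝ≥0 using hΔ.le
  have hδ : 0 < Δ := by exact_mod_cast hΔ
  constructor
  -- Taking turns is a deterministic order, hence trivially independent of the paths.
  · obtain ⟨hfin, h1, h2, h3, h4⟩ := D.parallelStep hW hf hfC hδ hZ₀ hμ hτ_fin hZ hZμ hindep
      (ρ := fun _ k => (turnOrder k).1) (κ := fun _ => turnOrder) measurable_const
      (indepFun_const_left _ _) (Eventually.of_forall fun _ =>
        isWallClockOrder_turnOrder.eq_parallelOrder monotone_turnTime)
    have hsync : ∀ᵐ ω ∂P, (∀ g, syncPar W Δ (fun r t => Z r t ω) g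
        = asyncPar W Δ (fun r t => Z r t ω) turnOrder g) ∧
        syncExit W Δ (fun r t => Z r t ω) = asyncExit W Δ (fun r t => Z r t ω) turnOrder := by
      filter_upwards [hfin] with ω hω using sync_eq_async hΔ ⟨0, hω 0⟩
    have h5 : (fun ω => syncPar W Δ (fun r t => Z r t ω) f)
        =ᵐ[P] fun ω => asyncPar W Δ (fun r t => Z r t ω) turnOrder f := by
      filter_upwards [hsync] with ω hω using hω.1 f
    have h6 : (fun ω => (syncTime W Δ (fun r t => Z r t ω), syncExit W Δ (fun r t => Z r t ω)))
        =ᵐ[P] fun ω => (asyncTime W Δ (fun r t => Z r t ω) turnOrder,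
          asyncExit W Δ (fun r t => Z r t ω) turnOrder) := by
      filter_upwards [hsync] with ω hω using Prod.ext (hω.1 _) hω.2
    refine ⟨h1.congr h5.symm, h2, (integral_congr_ae h5).trans h3, h4.1.congr h6.symm, h4.2,
      (Measure.map_congr h6).trans h4.3⟩
  · intro tWall ht hindep' hmono hord
    obtain ⟨w, hw, hwt⟩ := exists_wallClock_version ht hmono
      (hord.mono fun ω hω => hω.exists)
    refine (D.parallelStep hW hf hfC hδ hZ₀ hμ hτ_fin hZ hZμ hindep
      (ρ := fun ω => (w ω).processors) (WallClock.measurable_processors.comp hw) ?_ ?_).2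
    · have h1 : IndepFun w (fun ω r t => Z r t ω) P := by
        have h2 := hindep'.congr (EventuallyEq.symm hwt) ae_eq_rfl
        rw [IndepFun_iff_Indep] at h2 ⊢
        rwa [comap_subtype_val]
      exact h1.comp WallClock.measurable_processors measurable_id
    · filter_upwards [hwt] with ω hω
      rw [← hω, WallClock.parallelOrder_processors]
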